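/- **Setting.** Let $\Sigma$ be a smooth surface with a conformal structure $c$ of signature $(1,1)$ and Hodge star $*$ on one-forms (so $*d\xi=d\xi$, $*d\eta=-d\eta$ in null coordinates $\xi,\eta$). Let $N:(\Sigma,c)\to S^2\subset\mathbb R^3$ be smooth and harmonic, i.e. the tangential component of $d{*dN}$ vanishes. Identify $v\in\mathbb C^3$ with the skew endomorphism $u\mapsto v\times u$, put $\mathcal N=N\times dN$, $\mathcal N^{\pm}=\frac12(\mathcal N\pm *\mathcal N)$, and $$d_\lambda=(d-\mathcal N)+\lambda\,\mathcal N^{+}+\lambda^{-1}\mathcal N^{-}\qquad(\lambda\in\mathbb C^\times)$$ on $\underline{\mathbb C}^3=\Sigma\times\mathbb C^3$; call $d_\lambda$ the connections associated with $N$. Let $\rho^N$ be the (complexified) reflection across $N^\perp$. A gauge transformation $g$ acts on a connection $D$ by $g\cdot D=g\circ D\circ g^{-1}$. Orthogonality and nullity in $\mathbb C^3$ refer to the complex bilinear dot product. For null line subbundles $L,L^*\subset\underline{\mathbb C}^3$ with $L\cap L^*=0$, let $\Gamma^L_{L^*}(\lambda)$ be $\lambda$ on $L$, $1$ on $(L\oplus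 L^*)^\perp$, and $\lambda^{-1}$ on $L^*$. **Lemma.** Let $L,L^*$ be smooth null line subbundles of $\underline{\mathbb C}^3$ with $L\cap L^*=0$, let $\lambda\mapsto D_\lambda=d+A_\lambda$ be any family of metric connections (that is, $A_\lambda$ has values in the endomorphisms that are skew for the dot product), and let $\psi$ be a linear fractional transformation. If $\psi$ has its zero at $\alpha\in\mathbb C$ and $A_\lambda$ is holomorphic in $\lambda$ at $\alpha$, then $\lambda\mapsto\Gamma^L_{L^*}(\psi(\lambda))\cdot D_\lambda$ is (extends to be) holomorphic at $\alpha$ if and only if $L$ is $D_\alpha$-parallel. If $\psi$ has its pole at $\beta\in\mathbb C$ and $A_\lambda$ is holomorphic in $\lambda$ at $\beta$, then it is holomorphic at $\beta$ if and only if $L^*$ is $D_\beta$-parallel. **Theorem.** Let $a>0$ and let $L\subset\underline{\mathbb C}^3$ be a smooth null line subbundle that is $d_{ia}$-parallel, with $\rho^NL=\overline L=:L^*$ and $L\cap L^*=0$. Put $$r(\lambda)=\Gamma^L_{L^*}\!\left(\frac{1+ia}{1-ia}\cdot\frac{\lambda-ia}{\lambda+ia}\right),\qquad r(\infty)=\Gamma^L_{L^*}\!\left(\frac{1+ia}{1-ia}\right).$$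 1. $\hat N:=r(\infty)N$ is a real unit vector field and $\hat N:(\Sigma,c)\to S^2$ is smooth and harmonic. Its associated connections $\hat d_\lambda$ are flat for all $\lambda\in\mathbb C^\times$, and $\hat d_\lambda=r(\lambda)\cdot d_\lambda$ for all $\lambda\in\mathbb C^\times\setminus\{\pm ia\}$; the family $r(\lambda)\cdot d_\lambda$ extends holomorphically across $\lambda=\pm ia$. 2. Let $W\subset\Sigma$ be open and let $f:W\to\mathbb R^3$ be smooth with $df=N\times *dN$. Then $\partial r/\partial\lambda|_{\lambda=1}$ takes values in the real skew endomorphisms, so is a map to $\mathbb R^3$, and $\hat f:=f-\partial r/\partial\lambda|_{\lambda=1}$ is smooth with $d\hat f=\hat N\times *d\hat N$. At every point of $W$: - wherever $f$ (respectively $\hat f$) immerses, it has unit normal $N$ (respectively $\hat N$) and Gauss curvature $-1$, and its second fundamental form is a non-zero multiple of (a representative metric of) $c$; - $\hat f$ is a Bäcklund transform $f_a$ of $f$: $\hat f-f$ is orthogonal to $N$ and to $\hat N$, lies in the tangent plane of $f$ (of $\hat f$) wherever $f$ ($\hat f$) immerses, $$|\hat f-f|=\frac{2}{a+a^{-1}},\qquad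 \hat N\cdot N=\frac{a^{-1}-a}{a^{-1}+a},$$ and $\hat f-f$ lies on the line $(L\oplus L^*)^\perp$; - wherever both $f$ and $\hat f$ immerse, they have the same asymptotic directions. -/

import Mathlib

open scoped Manifold ContDiff Topology Matrix

/-- The model plane of a smooth surface. -/
abbrev Plane : Type := EuclideanSpace ℝ (Fin 2)

/-- Euclidean three-space. -/
abbrev R3 : Type := EuclideanSpace ℝ (Fin 3)

/-- `ℂ³`, with its complex bilinear dot product `u ⬝ᵥ v`. -/
abbrev C3 : Type := Fin 3 → ℂ

/-- Endomorphisms of `ℂ³`. -/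
abbrev EndC3 : Type := C3 →L[ℂ] C3

/-! ### Vector algebra -/

/-- The cross product of `ℝ³`. -/
noncomputable def cross (u v : R3) : R3 := WithLp.toLp 2 (crossProduct u.ofLp v.ofLp)

/-- The inclusion `ℝ³ ⊆ ℂ³`. -/
noncomputable def cx (v : R3) : C3 := fun i => (v i : ℂ)

/-- The identification of vectors with skew endomorphisms, `w ↦ (u ↦ w × u)`. -/
noncomputable def crossEnd (w : C3) : EndC3 := LinearMap.toContinuousLinearMap (crossProduct w)

/-- For `n ∈ ℝ³`, the real-linear map `v ↦ (u ↦ (n × v) × u)` into the endomorphisms of `ℂ³`. -/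
noncomputable def crossCrossEnd (n : R3) : R3 →L[ℝ] EndC3 :=
  LinearMap.toContinuousLinearMap
    { toFun := fun v => crossEnd (cx (cross n v))
      map_add' := by
        intro x y
        ext u i
        fin_cases i <;> simp [crossEnd, cx, cross, crossProduct] <;> ring
      map_smul' := by
        intro k x
        ext u i
        fin_cases i <;> simp [crossEnd, cx, cross, crossProduct] <;> ring }

/-- The complex-linear reflection across the plane orthogonal to the unit vector `n ∈ ℝ³`. -/
noncomputable def reflC (n : R3) : C3 →ₗ[ℂ] C3 where
  toFun v := v - (2 * (v ⬝ᵥ cx n)) • cx n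
  map_add' := by
    intro x y
    rw [add_dotProduct, mul_add, add_smul]
    abel
  map_smul' := by
    intro k x
    rw [smul_dotProduct, RingHom.id_apply, smul_sub, smul_smul, smul_eq_mul]
    ring_nf

/-- The complex conjugate of a subspace of `ℂ³`. -/
def conjLine (l : Submodule ℂ C3) : Submodule ℂ C3 where
  carrier := {v | star v ∈ l}
  add_mem' := by
    intro x y hx hy
    simpa using l.add_mem hx hy
  zero_mem' := by simp
  smul_mem' := by
    intro k x hx
    simpa using l.smul_mem (star k) hx

/-- `g` is `z` on `l`, is `1` on `(l ⊕ m)^⊥`, and is `z⁻¹` on `m`. -/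
def IsGamma (l m : Submodule ℂ C3) (z : ℂ) (g : EndC3) : Prop :=
  (∀ u ∈ l, g u = z • u) ∧
  (∀ u : C3, (∀ v ∈ l ⊔ m, u ⬝ᵥ v = 0) → g u = u) ∧
  (∀ u ∈ m, g u = z⁻¹ • u)

open Classical in
/-- The endomorphism `Γ^l_m(z)`: it is `z` on `l`, is `1` on `(l ⊕ m)^⊥`, and is `z⁻¹` on `m`.
It exists and is unique if `l ≠ m` are null lines, see `gamma_spec` and `IsGamma.unique`. -/
noncomputable def gamma (l m : Submodule ℂ C3) (z : ℂ) : EndC3 :=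
  if h : ∃ g, IsGamma l m z g then h.choose else 1

/-- Two independent null vectors of `ℂ³` are not orthogonal. -/
theorem dot_ne_zero_of_null {u w : C3} (hu : u ⬝ᵥ u = 0) (hw : w ⬝ᵥ w = 0)
    (h : LinearIndependent ℂ ![u, w]) : u ⬝ᵥ w ≠ 0 := by
  intro huw
  have hwu : w ⬝ᵥ u = 0 := by rw [dotProduct_comm]; exact huw
  have hx : crossProduct u w ≠ 0 := crossProduct_ne_zero_iff_linearIndependent.2 h
  have h1 : crossProduct (crossProduct u w) u = 0 := by
    rw [cross_cross_eq_smul_sub_smul]; simp [hu, hwu]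
  have h2 : crossProduct (crossProduct u w) w = 0 := by
    rw [cross_cross_eq_smul_sub_smul]; simp [huw, hw]
  have key : ∀ v : C3, crossProduct (crossProduct u w) v = 0 →
      ∃ k : ℂ, v = k • crossProduct u w := by
    intro v hv
    have := mt crossProduct_ne_zero_iff_linearIndependent.2 (not_not.2 hv)
    rw [LinearIndependent.pair_iff' hx] at this
    push Not at this
    obtain ⟨k, hk⟩ := this
    exact ⟨k, hk.symm⟩
  obtain ⟨k, hk⟩ := key u h1
  obtain ⟨m, hm⟩ := key w h2
  apply hx
  have h3 : crossProduct u w =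
      crossProduct (k • crossProduct u w) (m • crossProduct u w) := by rw [← hk, ← hm]
  rw [h3]
  simp only [map_smul, LinearMap.smul_apply, cross_self, smul_zero]

/-- `Γ^l_m(z)` is as described if `l` and `m` are distinct null lines. -/
theorem gamma_spec {u w : C3} (hu : u ⬝ᵥ u = 0) (hw : w ⬝ᵥ w = 0)
    (h : LinearIndependent ℂ ![u, w]) (z : ℂ) :
    IsGamma (Submodule.span ℂ {u}) (Submodule.span ℂ {w}) z
      (gamma (Submodule.span ℂ {u}) (Submodule.span ℂ {w}) z) := by
  have huw := dot_ne_zero_of_null hu hw h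
  have hex : ∃ g, IsGamma (Submodule.span ℂ {u}) (Submodule.span ℂ {w}) z g := by
    let g : C3 →ₗ[ℂ] C3 :=
      { toFun := fun v => v + ((z - 1) * (v ⬝ᵥ w) / (u ⬝ᵥ w)) • u
          + ((z⁻¹ - 1) * (v ⬝ᵥ u) / (u ⬝ᵥ w)) • w
        map_add' := by
          intro x y
          simp only [add_dotProduct]
          module
        map_smul' := by
          intro k x
          simp only [smul_dotProduct, smul_eq_mul, RingHom.id_apply]
          module }
    have hg : ∀ v, LinearMap.toContinuousLinearMap g v = v + ((z - 1) * (v ⬝ᵥ w) / (u ⬝ᵥ w)) • u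
          + ((z⁻¹ - 1) * (v ⬝ᵥ u) / (u ⬝ᵥ w)) • w := fun v => rfl
    have hwu : w ⬝ᵥ u = u ⬝ᵥ w := dotProduct_comm w u
    refine ⟨LinearMap.toContinuousLinearMap g, ?_, ?_, ?_⟩
    · intro v hv
      obtain ⟨k, rfl⟩ := Submodule.mem_span_singleton.1 hv
      rw [hg]
      simp only [smul_dotProduct, smul_eq_mul, hu, mul_zero, zero_div, zero_smul, add_zero]
      rw [show (z - 1) * (k * u ⬝ᵥ w) / u ⬝ᵥ w = (z - 1) * k by field_simp]
      module
    · intro v hv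
      rw [hg, hv u (Submodule.mem_sup_left (Submodule.mem_span_singleton_self u)),
        hv w (Submodule.mem_sup_right (Submodule.mem_span_singleton_self w))]
      simp
    · intro v hv
      obtain ⟨k, rfl⟩ := Submodule.mem_span_singleton.1 hv
      rw [hg]
      simp only [smul_dotProduct, smul_eq_mul, hw, hwu, mul_zero, zero_div, zero_smul, add_zero]
      rw [show (z⁻¹ - 1) * (k * u ⬝ᵥ w) / u ⬝ᵥ w = (z⁻¹ - 1) * k by field_simp]
      module
  unfold gamma
  rw [dif_pos hex]
  exact hex.choose_spec

/-- The endomorphism `Γ^l_m(z)` is unique if `l` and `m` are distinct null lines. -/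
theorem IsGamma.unique {u w : C3} (hu : u ⬝ᵥ u = 0) (hw : w ⬝ᵥ w = 0)
    (h : LinearIndependent ℂ ![u, w]) {z : ℂ} {g g' : EndC3}
    (hg : IsGamma (Submodule.span ℂ {u}) (Submodule.span ℂ {w}) z g)
    (hg' : IsGamma (Submodule.span ℂ {u}) (Submodule.span ℂ {w}) z g') : g = g' := by
  have huw := dot_ne_zero_of_null hu hw h
  have hwu : w ⬝ᵥ u = u ⬝ᵥ w := dotProduct_comm w u
  have mu : u ∈ Submodule.span ℂ {u} := Submodule.mem_span_singleton_self u
  have mw : w ∈ Submodule.span ℂ {w} := Submodule.mem_span_singleton_self w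
  ext1 v
  have hv : v = (v ⬝ᵥ w / u ⬝ᵥ w) • u + (v ⬝ᵥ u / u ⬝ᵥ w) • w +
      (v - (v ⬝ᵥ w / u ⬝ᵥ w) • u - (v ⬝ᵥ u / u ⬝ᵥ w) • w) := by abel
  have hp : ∀ y ∈ Submodule.span ℂ {u} ⊔ Submodule.span ℂ {w},
      (v - (v ⬝ᵥ w / u ⬝ᵥ w) • u - (v ⬝ᵥ u / u ⬝ᵥ w) • w) ⬝ᵥ y = 0 := by
    intro y hy
    obtain ⟨y₁, h₁, y₂, h₂, rfl⟩ := Submodule.mem_sup.1 hy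
    obtain ⟨k, rfl⟩ := Submodule.mem_span_singleton.1 h₁
    obtain ⟨m, rfl⟩ := Submodule.mem_span_singleton.1 h₂
    simp only [sub_dotProduct, smul_dotProduct, dotProduct_add, dotProduct_smul, smul_eq_mul,
      hu, hw, hwu]
    field_simp
    ring
  rw [hv]
  simp only [map_add, map_smul, hg.1 u mu, hg'.1 u mu, hg.2.2 w mw, hg'.2.2 w mw]
  rw [hg.2.1 _ hp, hg'.2.1 _ hp]

/-! ### Calculus on a surface -/

section Surface

variable {M : Type*} [TopologicalSpace M] [ChartedSpace Plane M]
variable {F : Type*} [NormedAddCommGroup F] [NormedSpace ℝ F]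

/-- The differential of a map from the surface to a vector space. -/
noncomputable def dmap (f : M → F) (p : M) : TangentSpace 𝓘(ℝ, Plane) p →L[ℝ] F :=
  mfderiv 𝓘(ℝ, Plane) 𝓘(ℝ, F) f p

/-- The coordinate frame of the chart at `p₀`, at the point with coordinates `x`. -/
noncomputable def chartFrame (p₀ : M) (x : Plane) :
    Plane →L[ℝ] TangentSpace 𝓘(ℝ, Plane) ((extChartAt 𝓘(ℝ, Plane) p₀).symm x) :=
  mfderiv 𝓘(ℝ, Plane) 𝓘(ℝ, Plane) (extChartAt 𝓘(ℝ, Plane) p₀).symm x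

/-- The exterior derivative `dθ(X, Y)` at `p` of a vector-valued one-form, computed in the chart
at `p` (in which Mathlib identifies the tangent space at `p` with the model plane). -/
noncomputable def extD (θ : ∀ p : M, TangentSpace 𝓘(ℝ, Plane) p →L[ℝ] F) (p : M)
    (X Y : TangentSpace 𝓘(ℝ, Plane) p) : F :=
  let form : Plane → Plane →L[ℝ] F :=
    fun x => (θ ((extChartAt 𝓘(ℝ, Plane) p).symm x)).comp (chartFrame p x)
  fderiv ℝ form (extChartAt 𝓘(ℝ, Plane) p p) X Y - fderiv ℝ form (extChartAt 𝓘(ℝ, Plane) p p) Y X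

/-! ### Connections on the trivial bundle with fibre `ℂ³` -/

variable (M) in
/-- `End(ℂ³)`-valued one-forms `A`; the form `A` stands for the connection `d + A`. -/
abbrev ConnForm : Type _ := ∀ p : M, TangentSpace 𝓘(ℝ, Plane) p →L[ℝ] EndC3

variable (M) in
/-- First-order operators on sections of the trivial bundle: `D s p X` stands for `(D_X s)(p)`. -/
abbrev SectionOp : Type _ := (M → C3) → ∀ p : M, TangentSpace 𝓘(ℝ, Plane) p → C3

/-- The covariant derivative of the connection `d + A`. -/
noncomputable def covD (A : ConnForm M) : SectionOp M := fun s p X => dmap s p X + A p X (s p)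

/-- The connection `d + A` is flat: `dA + A ∧ A = 0`. -/
def IsFlat (A : ConnForm M) : Prop :=
  ∀ (p : M) (X Y : TangentSpace 𝓘(ℝ, Plane) p),
    extD A p X Y + (A p X * A p Y - A p Y * A p X) = 0

/-- The connection `d + A` is metric: it preserves the complex bilinear dot product. -/
def IsMetricConn (A : ConnForm M) : Prop :=
  ∀ (p : M) (X : TangentSpace 𝓘(ℝ, Plane) p) (u v : C3), A p X u ⬝ᵥ v + u ⬝ᵥ A p X v = 0

/-- The action `g · D = g ∘ D ∘ g⁻¹` of gauge transformations. -/
noncomputable def gaugeAct (g : M → EndC3) (D : SectionOp M) : SectionOp M :=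
  fun s p X => g p (D (fun q => (g q).inverse (s q)) p X)

/-- The family of connections `z ↦ D z`, given near `α` except perhaps at `α` itself, is (after
removal of the singularity) holomorphic at `α`. -/
def HolomorphicAcross (D : ℂ → SectionOp M) (α : ℂ) : Prop :=
  ∀ (s : M → C3) (p : M), ContMDiffAt 𝓘(ℝ, Plane) 𝓘(ℝ, C3) ∞ s p →
    ∀ X : TangentSpace 𝓘(ℝ, Plane) p,
      ∃ h : ℂ → C3, AnalyticAt ℂ h α ∧ (fun z => D z s p X) =ᶠ[𝓝[≠] α] h

/-- `L` is a smooth null line subbundle of the trivial bundle with fibre `ℂ³`. -/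
structure IsNullLineSubbundle (L : M → Submodule ℂ C3) : Prop where
  null : ∀ p, ∀ u ∈ L p, u ⬝ᵥ u = 0
  smooth : ∀ p, ∃ U ∈ 𝓝 p, ∃ s : M → C3, ContMDiffOn 𝓘(ℝ, Plane) 𝓘(ℝ, C3) ∞ s U ∧
    ∀ q ∈ U, s q ≠ 0 ∧ L q = Submodule.span ℂ {s q}

/-- `L` is `D`-parallel: covariant derivatives of local smooth sections of `L` lie in `L`. -/
def IsParallel (D : SectionOp M) (L : M → Submodule ℂ C3) : Prop :=
  ∀ (s : M → C3) (p : M), ContMDiffAt 𝓘(ℝ, Plane) 𝓘(ℝ, C3) ∞ s p →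
    (∀ᶠ q in 𝓝 p, s q ∈ L q) → ∀ X : TangentSpace 𝓘(ℝ, Plane) p, D s p X ∈ L p

/-! ### Conformal structures of signature `(1,1)`, harmonic maps to the sphere -/

variable (M) in
/-- A conformal structure of signature `(1,1)`, given by a representative smooth metric, together
with its Hodge star. The latter is recorded by the endomorphism `J` of the tangent bundle with
`*θ = θ ∘ J`; the two conditions on `J` say that `g(J ·, ·)` is the area form of an orientation.
In null coordinates, `J ∂_ξ = ∂_ξ` and `J ∂_η = -∂_η` (in the appropriate order). -/
structure LorentzConformalStructure where
  metric : ∀ p : M, TangentSpace 𝓘(ℝ, Plane) p →L[ℝ] TangentSpace 𝓘(ℝ, Plane) p →L[ℝ] ℝ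
  symm : ∀ p X Y, metric p X Y = metric p Y X
  exists_pos : ∀ p, ∃ X, 0 < metric p X X
  exists_neg : ∀ p, ∃ X, metric p X X < 0
  smooth_metric : ∀ (p₀ : M) (u v : Plane),
    ContDiffOn ℝ ∞
      (fun x => metric ((extChartAt 𝓘(ℝ, Plane) p₀).symm x) (chartFrame p₀ x u)
        (chartFrame p₀ x v))
      (extChartAt 𝓘(ℝ, Plane) p₀).target
  hodge : ∀ p : M, TangentSpace 𝓘(ℝ, Plane) p →L[ℝ] TangentSpace 𝓘(ℝ, Plane) p
  hodge_hodge : ∀ p X, hodge p (hodge p X) = X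
  metric_hodge : ∀ p X Y, metric p (hodge p X) Y = - metric p X (hodge p Y)
  smooth_hodge : ∀ (p₀ : M) (u : Plane),
    ContDiffOn ℝ ∞
      (fun x => dmap (extChartAt 𝓘(ℝ, Plane) p₀) ((extChartAt 𝓘(ℝ, Plane) p₀).symm x)
        (hodge ((extChartAt 𝓘(ℝ, Plane) p₀).symm x) (chartFrame p₀ x u)))
      (extChartAt 𝓘(ℝ, Plane) p₀).target

/-- The Hodge star on one-forms. -/
noncomputable def hodgeStar (c : LorentzConformalStructure M)
    (θ : ∀ p : M, TangentSpace 𝓘(ℝ, Plane) p →L[ℝ] F) (p : M) :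
    TangentSpace 𝓘(ℝ, Plane) p →L[ℝ] F :=
  (θ p).comp (c.hodge p)

/-- `N : (M, c) → S²` is a smooth harmonic map: the component of `d * dN` tangent to the sphere
vanishes. -/
structure IsHarmonic (c : LorentzConformalStructure M) (N : M → R3) : Prop where
  smooth : ContMDiff 𝓘(ℝ, Plane) 𝓘(ℝ, R3) ∞ N
  unit : ∀ p, ‖N p‖ = 1
  tension : ∀ (p : M) (X Y : TangentSpace 𝓘(ℝ, Plane) p),
    cross (N p) (extD (hodgeStar c (dmap N)) p X Y) = 0

/-- The `so(3)`-valued one-form `N × dN`. If `|N| = 1`, this is the part of `d` which anti-commutes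
with the reflection across the plane orthogonal to `N`. -/
noncomputable def offDiag (N : M → R3) : ConnForm M :=
  fun p => (crossCrossEnd (N p)).comp (dmap N p)

/-- The part of `offDiag N` on which the Hodge star is `1`. -/
noncomputable def offDiagPlus (c : LorentzConformalStructure M) (N : M → R3) : ConnForm M :=
  fun p => (1 / 2 : ℂ) • (offDiag N p + hodgeStar c (offDiag N) p)

/-- The part of `offDiag N` on which the Hodge star is `-1`. -/
noncomputable def offDiagMinus (c : LorentzConformalStructure M) (N : M → R3) : ConnForm M :=
  fun p => (1 / 2 : ℂ) • (offDiag N p - hodgeStar c (offDiag N) p)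

/-- The connections associated with `N`: the off-diagonal part `n` of `d` is replaced by
`z n⁺ + z⁻¹ n⁻`. -/
noncomputable def assocForm (c : LorentzConformalStructure M) (N : M → R3) (z : ℂ) : ConnForm M :=
  fun p => - offDiag N p + z • offDiagPlus c N p + z⁻¹ • offDiagMinus c N p

/-! ### The dressing transformation -/

/-- `r(z) = Γ^L_{L*}( ((1 + ia)/(1 - ia)) ((z - ia)/(z + ia)) )`, where `L*` is the complex
conjugate of `L`. -/
noncomputable def dressing (L : M → Submodule ℂ C3) (a : ℝ) (z : ℂ) (p : M) : EndC3 :=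
  gamma (L p) (conjLine (L p))
    ((1 + Complex.I * a) / (1 - Complex.I * a) * ((z - Complex.I * a) / (z + Complex.I * a)))

/-- `r(∞)`. -/
noncomputable def dressingInfty (L : M → Submodule ℂ C3) (a : ℝ) (p : M) : EndC3 :=
  gamma (L p) (conjLine (L p)) ((1 + Complex.I * a) / (1 - Complex.I * a))

/-! ### Surfaces in space -/

/-- `df = N × *dN` at `p`. -/
def IsPotentialAt (c : LorentzConformalStructure M) (N f : M → R3) (p : M) : Prop :=
  ∀ X : TangentSpace 𝓘(ℝ, Plane) p, dmap f p X = cross (N p) (hodgeStar c (dmap N) p X)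

/-- The second fundamental form `-df · dN`. -/
noncomputable def secondForm (f N : M → R3) (p : M) (X Y : TangentSpace 𝓘(ℝ, Plane) p) : ℝ :=
  - inner ℝ (dmap f p X) (dmap N p Y)

/-- `f` immerses at `p`. -/
def ImmersesAt (f : M → R3) (p : M) : Prop := Function.Injective (dmap f p)

/-- At `p`, the map `f` is an immersion with unit normal `N` and with Gauss curvature `K`, the
determinant of the shape operator `S = -(df)⁻¹ ∘ dN`. -/
structure HasGaussMapAndCurvatureAt (f N : M → R3) (p : M) (K : ℝ) : Prop where
  immerses : ImmersesAt f p
  unit : ‖N p‖ = 1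
  normal : ∀ X : TangentSpace 𝓘(ℝ, Plane) p, inner ℝ (N p) (dmap f p X) = 0
  curvature : ∃ S : TangentSpace 𝓘(ℝ, Plane) p →ₗ[ℝ] TangentSpace 𝓘(ℝ, Plane) p,
    (∀ X, dmap f p (S X) = - dmap N p X) ∧ LinearMap.det S = K

/-- At `p`, the conformal structure `c` is the one spanned by the second fundamental form. -/
def SecondFormSpansAt (c : LorentzConformalStructure M) (f N : M → R3) (p : M) : Prop :=
  ∃ k : ℝ, k ≠ 0 ∧ ∀ X Y : TangentSpace 𝓘(ℝ, Plane) p, secondForm f N p X Y = k * c.metric p X Y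

/-- The Bäcklund relation with parameter `a` at `p`, for surfaces `f`, `f'` of Gauss curvature `-1`
with unit normals `N`, `N'`: the segment from `f` to `f'` is tangent to both surfaces (orthogonal to
both normals, and in the image of the differential wherever this is a plane) and has length
`2 / (a + a⁻¹)`, and `N' · N = (a⁻¹ - a) / (a⁻¹ + a)`. -/
structure IsBacklundAt (a : ℝ) (f N f' N' : M → R3) (p : M) : Prop where
  orthogonal : inner ℝ (N p) (f' p - f p) = 0
  orthogonal' : inner ℝ (N' p) (f' p - f p) = 0
  tangent : ImmersesAt f p → ∃ X, dmap f p X = f' p - f p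
  tangent' : ImmersesAt f' p → ∃ X, dmap f' p X = f' p - f p
  distance : dist (f' p) (f p) = 2 / (a + a⁻¹)
  angle : inner ℝ (N' p) (N p) = (a⁻¹ - a) / (a⁻¹ + a)

end Surface

/-! The reflection condition allows `L` to be normalised: its section with `N`-component `1` is `N +
it` for a real unit field `t` orthogonal to `N`. With `w = N × t` the data become a real orthonormal
frame `(N, t, w)`; the line `L*` is spanned by `N - it`, and `(L ⊕ L*)^⊥` by `w`
(`exists_smoothFrame`). Since `(1 + ia)/(1 - ia) = C + iS` with `C = (1 - a²)/(1 + a²)` and `S =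
2a/(1 + a²)`, the gauge `r(∞)` is a real rotation about `w`, and `N̂ = C N - S t`, `t̂ = C t + S N`.

In this frame, parallelism of `L` at `ia` is one real equation, expressing `w·dt` through `w·dN` and
`w·*dN` (`IsSmoothFrame.isBacklundFrame`). It gives `w·dN̂ = w·*dN`, while the rotation alone gives
`t̂·dN̂ = t·dN`. Together they yield `N̂ × *dN̂ = N × *dN + S dw`
(`IsBacklundFrame.cross_dmap_hodge`). As `d(N × *dN) = N × d*dN` (`extD_cross_hodgeStar`),
harmonicity says that `N × *dN` is closed; so `N̂` is harmonic, and `f + S w` is a potential for it.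
This is the Sym-type formula of the theorem, because `∂r/∂λ` at `1` is the skew endomorphism of `-S
w` (`hasDerivAt_dressing`). The distance `S` and the angle cosine `C` are then read off, and the
curvature and second fundamental form are linear algebra at a point (`surface_of_isPotentialAt`).

For the gauge relation, `N ± it` and `N̂ ± it̂` span the same lines, so `d̂_λ` and `r(λ)·d_λ` can be
compared on the three fields `N + it`, `N - it`, `w`. What remains is a scalar identity, taken for
both square roots of `-1` (`IsBacklundFrame.spectral_plus`). Since `d̂_λ` is analytic away from `0`,
it is itself the holomorphic extension across `±ia`. Flatness follows from harmonicity by computing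
the curvature (`IsHarmonic.isFlat_assocForm`).

The general lemma on `Γ(ψ)·D` is proved separately, in a local frame `u, w, u × w` with `u` in `L`
and `w` in `L*`. There the gauged connection is a Laurent polynomial in `ψ`. Metricity kills the
double pole at the zero of `ψ`, and the simple poles cancel when `L` is parallel at that point;
conversely, a limit shows parallelism. Exchanging the two lines inverts `ψ`, which settles the pole.
-/

set_option linter.unusedSectionVars false

/-! ### Calculus of vector-valued maps and one-forms in charts. -/

section Calculus

variable {M : Type*} [TopologicalSpace M] [ChartedSpace Plane M]
variable {E F G : Type*} [NormedAddCommGroup E] [NormedSpace ℝ E]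
  [NormedAddCommGroup F] [NormedSpace ℝ F] [NormedAddCommGroup G] [NormedSpace ℝ G]

/-- The expression of a vector-valued map in the chart at `p`. -/
noncomputable def chartRep (f : M → F) (p : M) : Plane → F :=
  f ∘ (extChartAt 𝓘(ℝ, Plane) p).symm

/-- The coordinates of `p` in the chart at `p`. -/
noncomputable abbrev chartPt (p : M) : Plane := extChartAt 𝓘(ℝ, Plane) p p

theorem chartRep_chartPt (f : M → F) (p : M) : chartRep f p (chartPt p) = f p := by
  simp [chartRep, chartPt]

/-- The differential of a vector-valued map in the chart at `p`. -/
noncomputable def dmapRep (f : M → F) (p : M) : Plane →L[ℝ] F := dmap f p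

theorem hasFDerivAt_chartRep {f : M → F} {p : M}
    (hf : MDifferentiableAt 𝓘(ℝ, Plane) 𝓘(ℝ, F) f p) :
    HasFDerivAt (chartRep f p) (dmapRep f p) (chartPt p) := by
  have h := hf.hasMFDerivAt.2
  rw [modelWithCornersSelf_coe, Set.range_id] at h
  exact hasFDerivWithinAt_univ.1 h

theorem dmap_eq_of_hasFDerivAt {f : M → F} {p : M}
    (hf : MDifferentiableAt 𝓘(ℝ, Plane) 𝓘(ℝ, F) f p) {f' : Plane →L[ℝ] F}
    (h : HasFDerivAt (chartRep f p) f' (chartPt p)) : dmap f p = f' :=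
  (hasFDerivAt_chartRep hf).unique h

theorem dmap_congr {f g : M → F} {p : M} (h : f =ᶠ[𝓝 p] g) : dmap f p = dmap g p :=
  h.mfderiv_eq

theorem mdifferentiableAt_bilin (B : E →L[ℝ] F →L[ℝ] G) {f : M → E} {g : M → F} {p : M}
    (hf : MDifferentiableAt 𝓘(ℝ, Plane) 𝓘(ℝ, E) f p)
    (hg : MDifferentiableAt 𝓘(ℝ, Plane) 𝓘(ℝ, F) g p) :
    MDifferentiableAt 𝓘(ℝ, Plane) 𝓘(ℝ, G) (fun q => B (f q) (g q)) p :=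
  ((B.isBoundedBilinearMap.differentiableAt (f p, g p)).mdifferentiableAt).comp
    (f := fun q => (f q, g q)) p (hf.prodMk_space hg)

theorem contMDiffAt_bilin (B : E →L[ℝ] F →L[ℝ] G) {f : M → E} {g : M → F} {p : M}
    (hf : ContMDiffAt 𝓘(ℝ, Plane) 𝓘(ℝ, E) ∞ f p)
    (hg : ContMDiffAt 𝓘(ℝ, Plane) 𝓘(ℝ, F) ∞ g p) :
    ContMDiffAt 𝓘(ℝ, Plane) 𝓘(ℝ, G) ∞ (fun q => B (f q) (g q)) p :=
  (B.isBoundedBilinearMap.contDiff.contDiffAt.contMDiffAt).comp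
    (f := fun q => (f q, g q)) p (hf.prodMk_space hg)

theorem dmap_bilin (B : E →L[ℝ] F →L[ℝ] G) {f : M → E} {g : M → F} {p : M}
    (hf : MDifferentiableAt 𝓘(ℝ, Plane) 𝓘(ℝ, E) f p)
    (hg : MDifferentiableAt 𝓘(ℝ, Plane) 𝓘(ℝ, F) g p) (X : TangentSpace 𝓘(ℝ, Plane) p) :
    dmap (fun q => B (f q) (g q)) p X = B (f p) (dmap g p X) + B (dmap f p X) (g p) := by
  have h := B.hasFDerivAt_of_bilinear (hasFDerivAt_chartRep hf) (hasFDerivAt_chartRep hg)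
  rw [dmap_eq_of_hasFDerivAt (mdifferentiableAt_bilin B hf hg) h]
  simp only [chartRep_chartPt]
  rfl

theorem dmap_clm (B : F →L[ℝ] G) {f : M → F} {p : M}
    (hf : MDifferentiableAt 𝓘(ℝ, Plane) 𝓘(ℝ, F) f p) (X : TangentSpace 𝓘(ℝ, Plane) p) :
    dmap (fun q => B (f q)) p X = B (dmap f p X) := by
  have h : dmap (fun q => B (f q)) p = _ :=
    dmap_eq_of_hasFDerivAt (B.differentiableAt.mdifferentiableAt.comp p hf)
      (B.hasFDerivAt.comp _ (hasFDerivAt_chartRep hf))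
  rw [h]
  rfl

theorem contMDiffAt_clm (B : F →L[ℝ] G) {f : M → F} {p : M}
    (hf : ContMDiffAt 𝓘(ℝ, Plane) 𝓘(ℝ, F) ∞ f p) :
    ContMDiffAt 𝓘(ℝ, Plane) 𝓘(ℝ, G) ∞ (fun q => B (f q)) p :=
  B.contDiff.contDiffAt.contMDiffAt.comp p hf

theorem dmap_add {f g : M → F} {p : M}
    (hf : MDifferentiableAt 𝓘(ℝ, Plane) 𝓘(ℝ, F) f p)
    (hg : MDifferentiableAt 𝓘(ℝ, Plane) 𝓘(ℝ, F) g p) :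
    dmap (fun q => f q + g q) p = dmap f p + dmap g p :=
  dmap_eq_of_hasFDerivAt (hf.add hg) ((hasFDerivAt_chartRep hf).add (hasFDerivAt_chartRep hg))

theorem dmap_const (v : F) (p : M) : dmap (fun _ : M => v) p = 0 :=
  dmap_eq_of_hasFDerivAt mdifferentiableAt_const (hasFDerivAt_const v _)

/-- The expression of a one-form in the chart at `p`. -/
noncomputable def coordForm (θ : ∀ p : M, TangentSpace 𝓘(ℝ, Plane) p →L[ℝ] F) (p : M)
    (x : Plane) : Plane →L[ℝ] F :=
  (θ ((extChartAt 𝓘(ℝ, Plane) p).symm x)).comp (chartFrame p x)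

theorem extD_eq (θ : ∀ p : M, TangentSpace 𝓘(ℝ, Plane) p →L[ℝ] F) (p : M)
    (X Y : TangentSpace 𝓘(ℝ, Plane) p) :
    extD θ p X Y = fderiv ℝ (coordForm θ p) (chartPt p) X Y
      - fderiv ℝ (coordForm θ p) (chartPt p) Y X := rfl

/-- A one-form is differentiable at `p`. -/
def FormDiffAt (θ : ∀ p : M, TangentSpace 𝓘(ℝ, Plane) p →L[ℝ] F) (p : M) : Prop :=
  DifferentiableAt ℝ (coordForm θ p) (chartPt p)

theorem coordForm_add (θ η : ∀ p : M, TangentSpace 𝓘(ℝ, Plane) p →L[ℝ] F) (p : M) :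
    coordForm (fun q => θ q + η q) p = coordForm θ p + coordForm η p := rfl

theorem extD_add {θ η : ∀ p : M, TangentSpace 𝓘(ℝ, Plane) p →L[ℝ] F} {p : M}
    (hθ : FormDiffAt θ p) (hη : FormDiffAt η p) (X Y : TangentSpace 𝓘(ℝ, Plane) p) :
    extD (fun q => θ q + η q) p X Y = extD θ p X Y + extD η p X Y := by
  have h := fderiv_add hθ hη
  simp only [extD_eq, coordForm_add]
  rw [h]
  exact add_sub_add_comm _ _ _ _

theorem FormDiffAt.clm {θ : ∀ p : M, TangentSpace 𝓘(ℝ, Plane) p →L[ℝ] F} {p : M}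
    (hθ : FormDiffAt θ p) (B : F →L[ℝ] G) : FormDiffAt (fun q => B.comp (θ q)) p :=
  ((ContinuousLinearMap.compL ℝ Plane F G B).hasFDerivAt.comp _
    hθ.hasFDerivAt).differentiableAt

theorem extD_clm {θ : ∀ p : M, TangentSpace 𝓘(ℝ, Plane) p →L[ℝ] F} {p : M}
    (hθ : FormDiffAt θ p) (B : F →L[ℝ] G) (X Y : TangentSpace 𝓘(ℝ, Plane) p) :
    extD (fun q => B.comp (θ q)) p X Y = B (extD θ p X Y) := by
  have h : HasFDerivAt (coordForm (fun q => B.comp (θ q)) p) _ (chartPt p) :=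
    (ContinuousLinearMap.compL ℝ Plane F G B).hasFDerivAt.comp (chartPt p) hθ.hasFDerivAt
  simp only [extD_eq]
  rw [h.fderiv, map_sub]
  rfl

variable [IsManifold 𝓘(ℝ, Plane) ∞ M]

theorem chartFrame_comp_chart (p : M) {x : Plane} (hx : x ∈ (extChartAt 𝓘(ℝ, Plane) p).target)
    (v : TangentSpace 𝓘(ℝ, Plane) ((extChartAt 𝓘(ℝ, Plane) p).symm x)) :
    chartFrame p x (dmap (extChartAt 𝓘(ℝ, Plane) p) ((extChartAt 𝓘(ℝ, Plane) p).symm x) v)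
      = v := by
  have h := mfderivWithin_extChartAt_symm_comp_mfderiv_extChartAt (I := 𝓘(ℝ, Plane)) hx
  rw [modelWithCornersSelf_coe, Set.range_id, mfderivWithin_univ] at h
  exact DFunLike.congr_fun h v

/-- The tangent space at `p` is modelled through the chart at `p` itself, so no change of frame
appears there. This lets exterior derivatives at `p` be evaluated directly on tangent vectors. -/
theorem chartFrame_chartPt (p : M) :
    (chartFrame p (chartPt p) : Plane →L[ℝ] Plane) = ContinuousLinearMap.id ℝ Plane := by
  have h := mfderivWithin_range_extChartAt_symm (I := 𝓘(ℝ, Plane)) (x := p)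
  rw [modelWithCornersSelf_coe, Set.range_id, mfderivWithin_univ] at h
  exact h

theorem coordForm_chartPt (θ : ∀ p : M, TangentSpace 𝓘(ℝ, Plane) p →L[ℝ] F) (p : M) :
    coordForm θ p (chartPt p) = (θ p : Plane →L[ℝ] F) := by
  have h : (extChartAt 𝓘(ℝ, Plane) p).symm (chartPt p) = p := by simp [chartPt]
  have h2 : (θ ((extChartAt 𝓘(ℝ, Plane) p).symm (chartPt p)) : Plane →L[ℝ] F) = θ p :=
    congrArg (β := Plane →L[ℝ] F) θ h
  calc coordForm θ p (chartPt p)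
      = (θ ((extChartAt 𝓘(ℝ, Plane) p).symm (chartPt p)) : Plane →L[ℝ] F).comp
          (chartFrame p (chartPt p) : Plane →L[ℝ] Plane) := rfl
    _ = (θ p : Plane →L[ℝ] F).comp (ContinuousLinearMap.id ℝ Plane) := by
      rw [h2, chartFrame_chartPt]
      rfl
    _ = _ := rfl

theorem eventually_mem_target (p : M) :
    ∀ᶠ x in 𝓝 (chartPt p), x ∈ (extChartAt 𝓘(ℝ, Plane) p).target :=
  extChartAt_target_mem_nhds p

theorem coordForm_dmap {f : M → F} (hf : MDifferentiable 𝓘(ℝ, Plane) 𝓘(ℝ, F) f) (p : M)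
    {x : Plane} (hx : x ∈ (extChartAt 𝓘(ℝ, Plane) p).target) :
    coordForm (dmap f) p x = fderiv ℝ (chartRep f p) x := by
  have h1 := mdifferentiableWithinAt_extChartAt_symm (I := 𝓘(ℝ, Plane)) hx
  rw [modelWithCornersSelf_coe, Set.range_id, mdifferentiableWithinAt_univ] at h1
  rw [← mfderiv_eq_fderiv]
  exact (mfderiv_comp x (hf _) h1).symm

theorem contDiffAt_chartRep {f : M → F} {p : M}
    (hf : ContMDiffAt 𝓘(ℝ, Plane) 𝓘(ℝ, F) ∞ f p) :
    ContDiffAt ℝ ∞ (chartRep f p) (chartPt p) := by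
  have h := (contMDiffAt_iff.1 hf).2
  simpa [chartRep, contDiffWithinAt_univ, Function.comp_def] using! h

theorem coordForm_dmap_eventuallyEq {f : M → F} (hf : ContMDiff 𝓘(ℝ, Plane) 𝓘(ℝ, F) ∞ f) (p : M) :
    coordForm (dmap f) p =ᶠ[𝓝 (chartPt p)] fderiv ℝ (chartRep f p) :=
  (eventually_mem_target p).mono fun _ hx => coordForm_dmap (hf.mdifferentiable (by simp)) p hx

theorem formDiffAt_dmap {f : M → F} (hf : ContMDiff 𝓘(ℝ, Plane) 𝓘(ℝ, F) ∞ f) (p : M) :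
    FormDiffAt (dmap f) p := by
  refine DifferentiableAt.congr_of_eventuallyEq ?_ (coordForm_dmap_eventuallyEq hf p)
  exact ((contDiffAt_chartRep (hf p)).fderiv_right (m := 1) (by norm_num; exact ENat.LEInfty.out)).differentiableAt
    (by simp)

/-- This is `d² = 0`: near the base point the form is the derivative of the chart expression of `f`,
whose second derivative is symmetric. -/
theorem extD_dmap {f : M → F} (hf : ContMDiff 𝓘(ℝ, Plane) 𝓘(ℝ, F) ∞ f) (p : M)
    (X Y : TangentSpace 𝓘(ℝ, Plane) p) : extD (dmap f) p X Y = 0 := by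
  rw [extD_eq, (coordForm_dmap_eventuallyEq hf p).fderiv_eq, sub_eq_zero]
  exact ((contDiffAt_chartRep (hf p)).isSymmSndFDerivAt (by simp; exact ENat.LEInfty.out)) X Y

/-- The product of a vector-valued function and a one-form, with respect to a bilinear map. -/
noncomputable def bilinForm (B : E →L[ℝ] F →L[ℝ] G) (f : M → E)
    (θ : ∀ p : M, TangentSpace 𝓘(ℝ, Plane) p →L[ℝ] F) (p : M) :
    TangentSpace 𝓘(ℝ, Plane) p →L[ℝ] G := (B (f p)).comp (θ p)

theorem hasFDerivAt_coordForm_bilinForm (B : E →L[ℝ] F →L[ℝ] G) {f : M → E}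
    {θ : ∀ p : M, TangentSpace 𝓘(ℝ, Plane) p →L[ℝ] F} {p : M}
    (hf : MDifferentiableAt 𝓘(ℝ, Plane) 𝓘(ℝ, E) f p) (hθ : FormDiffAt θ p) :
    HasFDerivAt (coordForm (bilinForm B f θ) p)
      (((ContinuousLinearMap.compL ℝ Plane F G).comp B).precompR Plane (f p)
          (fderiv ℝ (coordForm θ p) (chartPt p))
        + ((ContinuousLinearMap.compL ℝ Plane F G).comp B).precompL Plane (dmapRep f p)
          (coordForm θ p (chartPt p))) (chartPt p) := by
  have h := ((ContinuousLinearMap.compL ℝ Plane F G).comp B).hasFDerivAt_of_bilinear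
    (hasFDerivAt_chartRep hf) hθ.hasFDerivAt
  rw [chartRep_chartPt] at h
  exact h

theorem formDiffAt_bilinForm (B : E →L[ℝ] F →L[ℝ] G) {f : M → E}
    {θ : ∀ p : M, TangentSpace 𝓘(ℝ, Plane) p →L[ℝ] F} {p : M}
    (hf : MDifferentiableAt 𝓘(ℝ, Plane) 𝓘(ℝ, E) f p) (hθ : FormDiffAt θ p) :
    FormDiffAt (bilinForm B f θ) p :=
  (hasFDerivAt_coordForm_bilinForm B hf hθ).differentiableAt

/-- The Leibniz rule, obtained by differentiating the bilinear pairing in the chart and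
antisymmetrising. All later exterior derivatives rest on it. -/
theorem extD_bilinForm (B : E →L[ℝ] F →L[ℝ] G) {f : M → E}
    {θ : ∀ p : M, TangentSpace 𝓘(ℝ, Plane) p →L[ℝ] F} {p : M}
    (hf : MDifferentiableAt 𝓘(ℝ, Plane) 𝓘(ℝ, E) f p) (hθ : FormDiffAt θ p)
    (X Y : TangentSpace 𝓘(ℝ, Plane) p) :
    extD (bilinForm B f θ) p X Y = B (dmap f p X) (θ p Y) - B (dmap f p Y) (θ p X)
      + B (f p) (extD θ p X Y) := by
  rw [extD_eq, (hasFDerivAt_coordForm_bilinForm B hf hθ).fderiv, coordForm_chartPt, extD_eq,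
    map_sub]
  change (B (f p) (fderiv ℝ (coordForm θ p) (chartPt p) X Y) + B (dmap f p X) (θ p Y))
    - (B (f p) (fderiv ℝ (coordForm θ p) (chartPt p) Y X) + B (dmap f p Y) (θ p X)) = _
  rw [add_sub_add_comm, add_comm]

variable (c : LorentzConformalStructure M)

/-- The Hodge star in the chart at `p`. -/
noncomputable def hodgeRep (p : M) (x : Plane) : Plane →L[ℝ] Plane :=
  (dmap (extChartAt 𝓘(ℝ, Plane) p) ((extChartAt 𝓘(ℝ, Plane) p).symm x)).comp
    ((c.hodge ((extChartAt 𝓘(ℝ, Plane) p).symm x)).comp (chartFrame p x))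

theorem contDiffAt_hodgeRep (p : M) : ContDiffAt ℝ ∞ (hodgeRep c p) (chartPt p) := by
  have h : ContDiffOn ℝ ∞ (hodgeRep c p) (extChartAt 𝓘(ℝ, Plane) p).target :=
    contDiffOn_clm_apply.2 fun u => c.smooth_hodge p u
  exact h.contDiffAt (extChartAt_target_mem_nhds p)

/-- Inserting the chart differential and its inverse turns the star into composition with a smooth
matrix-valued function, so it preserves differentiability of forms. -/
theorem coordForm_hodgeStar (θ : ∀ p : M, TangentSpace 𝓘(ℝ, Plane) p →L[ℝ] F) (p : M) {x : Plane}
    (hx : x ∈ (extChartAt 𝓘(ℝ, Plane) p).target) :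
    coordForm (hodgeStar c θ) p x = (coordForm θ p x).comp (hodgeRep c p x) := by
  ext1 v
  have h := chartFrame_comp_chart p hx
    (c.hodge ((extChartAt 𝓘(ℝ, Plane) p).symm x) (chartFrame p x v))
  exact congrArg (θ ((extChartAt 𝓘(ℝ, Plane) p).symm x)) h.symm

theorem formDiffAt_hodgeStar {θ : ∀ p : M, TangentSpace 𝓘(ℝ, Plane) p →L[ℝ] F} {p : M}
    (hθ : FormDiffAt θ p) : FormDiffAt (hodgeStar c θ) p := by
  refine DifferentiableAt.congr_of_eventuallyEq (DifferentiableAt.clm_comp hθ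
    ((contDiffAt_hodgeRep c p).differentiableAt (by simp))) ?_
  exact (eventually_mem_target p).mono fun x hx => coordForm_hodgeStar c θ p hx

end Calculus

/-! ### Algebra of `Γ` on a pair of null lines. -/

section GammaAlgebra

theorem isGamma_swap {l m : Submodule ℂ C3} {z : ℂ} {g : EndC3} :
    IsGamma l m z g ↔ IsGamma m l z⁻¹ g := by
  unfold IsGamma
  rw [sup_comm, inv_inv]
  tauto

/-- This symmetry reduces statements about a pole of the parameter to statements about a zero. -/
theorem gamma_swap (l m : Submodule ℂ C3) (z : ℂ) : gamma l m z = gamma m l z⁻¹ := by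
  have h : IsGamma l m z = IsGamma m l z⁻¹ := funext fun g => propext isGamma_swap
  unfold gamma
  rw [h]

/-- Two null vectors with non-zero product complete to a basis by their cross product. -/
theorem null_frame_decomp {u w : C3} (hu : u ⬝ᵥ u = 0) (hw : w ⬝ᵥ w = 0) (huw : u ⬝ᵥ w ≠ 0)
    (v : C3) :
    v = (v ⬝ᵥ w / u ⬝ᵥ w) • u + (v ⬝ᵥ u / u ⬝ᵥ w) • w
      + (-(v ⬝ᵥ crossProduct u w) / (u ⬝ᵥ w) ^ 2) • crossProduct u w := by
  have hwu : w ⬝ᵥ u = u ⬝ᵥ w := dotProduct_comm w u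
  -- Put `x = u × w` and compute `x × (v × x)` twice. It is `(x·x) v - (x·v) x` with `x·x = -(u·w)²`
  -- by nullity; expanding `v × x` first gives multiples of `u` and `w` only.
  have h1 := cross_cross_eq_smul_sub_smul' (crossProduct u w) v (crossProduct u w)
  rw [cross_cross_eq_smul_sub_smul' v u w, map_sub, map_smul, map_smul,
    cross_cross_eq_smul_sub_smul, cross_cross_eq_smul_sub_smul, cross_dot_cross,
    hu, hw, hwu, dotProduct_comm u v] at h1
  simp only [zero_smul, zero_sub, sub_zero, zero_mul] at h1
  have key : ((u ⬝ᵥ w) ^ 2) • v = ((u ⬝ᵥ w) * (v ⬝ᵥ w)) • u + ((u ⬝ᵥ w) * (v ⬝ᵥ u)) • w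
      - (v ⬝ᵥ crossProduct u w) • crossProduct u w := by
    linear_combination (norm := module) h1
  have h2 : v = ((u ⬝ᵥ w) ^ 2)⁻¹ • (((u ⬝ᵥ w) ^ 2) • v) := by
    rw [smul_smul, inv_mul_cancel₀ (pow_ne_zero 2 huw), one_smul]
  conv_lhs => rw [h2, key]
  match_scalars <;> field_simp

theorem gamma_apply_left {u w : C3} (hu : u ⬝ᵥ u = 0) (hw : w ⬝ᵥ w = 0)
    (h : LinearIndependent ℂ ![u, w]) (z : ℂ) :
    gamma (Submodule.span ℂ {u}) (Submodule.span ℂ {w}) z u = z • u :=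
  (gamma_spec hu hw h z).1 u (Submodule.mem_span_singleton_self u)

theorem gamma_apply_right {u w : C3} (hu : u ⬝ᵥ u = 0) (hw : w ⬝ᵥ w = 0)
    (h : LinearIndependent ℂ ![u, w]) (z : ℂ) :
    gamma (Submodule.span ℂ {u}) (Submodule.span ℂ {w}) z w = z⁻¹ • w :=
  (gamma_spec hu hw h z).2.2 w (Submodule.mem_span_singleton_self w)

theorem gamma_apply_of_orthogonal {u w : C3} (hu : u ⬝ᵥ u = 0) (hw : w ⬝ᵥ w = 0)
    (h : LinearIndependent ℂ ![u, w]) (z : ℂ) {v : C3} (hvu : v ⬝ᵥ u = 0) (hvw : v ⬝ᵥ w = 0) :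
    gamma (Submodule.span ℂ {u}) (Submodule.span ℂ {w}) z v = v := by
  refine (gamma_spec hu hw h z).2.1 v fun y hy => ?_
  obtain ⟨y₁, h₁, y₂, h₂, rfl⟩ := Submodule.mem_sup.1 hy
  obtain ⟨k, rfl⟩ := Submodule.mem_span_singleton.1 h₁
  obtain ⟨m, rfl⟩ := Submodule.mem_span_singleton.1 h₂
  simp [dotProduct_add, dotProduct_smul, hvu, hvw]

/-- The projection to the line of `u` along the orthogonal complement of `w`. -/
noncomputable def lineProj (u w : C3) : EndC3 :=
  LinearMap.toContinuousLinearMap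
    (LinearMap.smulRight
      { toFun := fun v => v ⬝ᵥ w / u ⬝ᵥ w
        map_add' := fun x y => by rw [add_dotProduct, add_div]
        map_smul' := fun k x => by
          rw [smul_dotProduct, smul_eq_mul, mul_div_assoc, RingHom.id_apply, smul_eq_mul] } u)

theorem lineProj_apply (u w v : C3) : lineProj u w v = (v ⬝ᵥ w / u ⬝ᵥ w) • u := rfl

/-- The projection to the orthogonal complement of `u` and `w`. -/
noncomputable def perpProj (u w : C3) : EndC3 := 1 - lineProj u w - lineProj w u

theorem perpProj_apply (u w v : C3) :
    perpProj u w v = v - (v ⬝ᵥ w / u ⬝ᵥ w) • u - (v ⬝ᵥ u / u ⬝ᵥ w) • w := by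
  simp [perpProj, lineProj_apply, dotProduct_comm w u]

/-- The spectral decomposition makes the dependence on `z` explicit, with coefficients independent
of `z`: poles and derivatives of `Γ` can be read off. -/
theorem gamma_eq {u w : C3} (hu : u ⬝ᵥ u = 0) (hw : w ⬝ᵥ w = 0)
    (h : LinearIndependent ℂ ![u, w]) (z : ℂ) :
    gamma (Submodule.span ℂ {u}) (Submodule.span ℂ {w}) z =
      perpProj u w + z • lineProj u w + z⁻¹ • lineProj w u := by
  have huw := dot_ne_zero_of_null hu hw h
  have hwu : w ⬝ᵥ u = u ⬝ᵥ w := dotProduct_comm w u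
  ext1 v
  have hv : v = (v ⬝ᵥ w / u ⬝ᵥ w) • u + (v ⬝ᵥ u / u ⬝ᵥ w) • w + perpProj u w v := by
    rw [perpProj_apply]; abel
  have hp1 : perpProj u w v ⬝ᵥ u = 0 := by
    rw [perpProj_apply]
    simp only [sub_dotProduct, smul_dotProduct, hu, hwu, smul_eq_mul]
    field_simp
    ring
  have hp2 : perpProj u w v ⬝ᵥ w = 0 := by
    rw [perpProj_apply]
    simp only [sub_dotProduct, smul_dotProduct, hw, smul_eq_mul]
    field_simp
    ring
  conv_lhs => rw [hv]
  simp only [map_add, map_smul, gamma_apply_left hu hw h, gamma_apply_right hu hw h,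
    gamma_apply_of_orthogonal hu hw h z hp1 hp2, _root_.add_apply,
    _root_.smul_apply, lineProj_apply, hwu]
  module

theorem gamma_apply_cross {u w : C3} (hu : u ⬝ᵥ u = 0) (hw : w ⬝ᵥ w = 0)
    (h : LinearIndependent ℂ ![u, w]) (z : ℂ) :
    gamma (Submodule.span ℂ {u}) (Submodule.span ℂ {w}) z (crossProduct u w) =
      crossProduct u w :=
  gamma_apply_of_orthogonal hu hw h z (by rw [dotProduct_comm, dot_self_cross])
    (by rw [dotProduct_comm, dot_cross_self])

theorem gamma_comp_gamma_inv {u w : C3} (hu : u ⬝ᵥ u = 0) (hw : w ⬝ᵥ w = 0)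
    (h : LinearIndependent ℂ ![u, w]) {z : ℂ} (hz : z ≠ 0) :
    (gamma (Submodule.span ℂ {u}) (Submodule.span ℂ {w}) z).comp
      (gamma (Submodule.span ℂ {u}) (Submodule.span ℂ {w}) z⁻¹) = ContinuousLinearMap.id ℂ C3 := by
  ext1 v
  have hv := null_frame_decomp hu hw (dot_ne_zero_of_null hu hw h) v
  rw [ContinuousLinearMap.comp_apply, ContinuousLinearMap.id_apply]
  conv_rhs => rw [hv]
  conv_lhs => rw [hv]
  simp only [map_add, map_smul, gamma_apply_left hu hw h, gamma_apply_right hu hw h,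
    gamma_apply_cross hu hw h, inv_inv]
  match_scalars <;> field_simp

theorem gamma_inverse {u w : C3} (hu : u ⬝ᵥ u = 0) (hw : w ⬝ᵥ w = 0)
    (h : LinearIndependent ℂ ![u, w]) {z : ℂ} (hz : z ≠ 0) :
    (gamma (Submodule.span ℂ {u}) (Submodule.span ℂ {w}) z).inverse =
      gamma (Submodule.span ℂ {u}) (Submodule.span ℂ {w}) z⁻¹ := by
  refine ContinuousLinearMap.inverse_eq (gamma_comp_gamma_inv hu hw h hz) ?_
  have := gamma_comp_gamma_inv hu hw h (inv_ne_zero hz)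
  rwa [inv_inv] at this

theorem linearIndependent_of_span_inf_eq_bot {u w : C3} (hu : u ≠ 0) (hw : w ≠ 0)
    (h : Submodule.span ℂ {u} ⊓ Submodule.span ℂ {w} = ⊥) : LinearIndependent ℂ ![u, w] := by
  rw [LinearIndependent.pair_iff' hu]
  rintro k rfl
  apply hw
  have : k • u ∈ Submodule.span ℂ {u} ⊓ Submodule.span ℂ {k • u} :=
    ⟨Submodule.smul_mem _ k (Submodule.mem_span_singleton_self u),
      Submodule.mem_span_singleton_self _⟩
  rwa [h, Submodule.mem_bot] at this

end GammaAlgebra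

/-! ### Covariant derivatives and gauge transformations in frames. -/

section Covariant

variable {M : Type*} [TopologicalSpace M] [ChartedSpace Plane M]

/-- The dot product of `ℂ³` as a continuous real-bilinear map. -/
noncomputable def dotB : C3 →L[ℝ] C3 →L[ℝ] ℂ :=
  LinearMap.toContinuousBilinearMap
    (LinearMap.mk₂ ℝ (fun u v : C3 => u ⬝ᵥ v) add_dotProduct smul_dotProduct dotProduct_add
      (fun k u v => dotProduct_smul k u v))

theorem dotB_apply (u v : C3) : dotB u v = u ⬝ᵥ v := rfl

/-- The cross product of `ℂ³` as a continuous real-bilinear map. -/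
noncomputable def crossB : C3 →L[ℝ] C3 →L[ℝ] C3 :=
  LinearMap.toContinuousBilinearMap
    (LinearMap.mk₂ ℝ (fun u v : C3 => crossProduct u v)
      (fun u v w => by rw [map_add, LinearMap.add_apply])
      (fun k u v => by ext i; fin_cases i <;> simp [cross_apply, mul_sub])
      (fun u v w => by rw [map_add])
      (fun k u v => by ext i; fin_cases i <;> simp [cross_apply, mul_sub]))

/-- Scalar multiplication on `ℂ³` as a continuous real-bilinear map. -/
noncomputable abbrev smulB : ℂ →L[ℝ] C3 →L[ℝ] C3 := ContinuousLinearMap.lsmul ℝ ℂ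

theorem covD_congr {A : ConnForm M} {s s' : M → C3} {p : M} (h : s =ᶠ[𝓝 p] s')
    (X : TangentSpace 𝓘(ℝ, Plane) p) : covD A s p X = covD A s' p X := by
  rw [covD, covD, dmap_congr h, h.self_of_nhds]

theorem covD_add {A : ConnForm M} {s s' : M → C3} {p : M}
    (hs : MDifferentiableAt 𝓘(ℝ, Plane) 𝓘(ℝ, C3) s p)
    (hs' : MDifferentiableAt 𝓘(ℝ, Plane) 𝓘(ℝ, C3) s' p) (X : TangentSpace 𝓘(ℝ, Plane) p) :
    covD A (fun q => s q + s' q) p X = covD A s p X + covD A s' p X := by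
  simp only [covD, dmap_add hs hs', map_add]
  exact add_add_add_comm _ _ _ _

theorem covD_smul {A : ConnForm M} {c : M → ℂ} {s : M → C3} {p : M}
    (hc : MDifferentiableAt 𝓘(ℝ, Plane) 𝓘(ℝ, ℂ) c p)
    (hs : MDifferentiableAt 𝓘(ℝ, Plane) 𝓘(ℝ, C3) s p) (X : TangentSpace 𝓘(ℝ, Plane) p) :
    covD A (fun q => c q • s q) p X = dmap c p X • s p + c p • covD A s p X := by
  have h := dmap_bilin smulB hc hs X
  simp only [ContinuousLinearMap.lsmul_apply] at h
  simp only [covD, h, map_smul, smul_add]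
  abel

theorem covD_const_smul {A : ConnForm M} (k : ℂ) {s : M → C3} {p : M}
    (hs : MDifferentiableAt 𝓘(ℝ, Plane) 𝓘(ℝ, C3) s p) (X : TangentSpace 𝓘(ℝ, Plane) p) :
    covD A (fun q => k • s q) p X = k • covD A s p X := by
  rw [covD_smul (c := fun _ => k) mdifferentiableAt_const hs, dmap_const]
  simp

theorem dmap_dotProduct {A : ConnForm M} (hA : IsMetricConn A) {s s' : M → C3} {p : M}
    (hs : MDifferentiableAt 𝓘(ℝ, Plane) 𝓘(ℝ, C3) s p)
    (hs' : MDifferentiableAt 𝓘(ℝ, Plane) 𝓘(ℝ, C3) s' p) (X : TangentSpace 𝓘(ℝ, Plane) p) :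
    dmap (fun q => s q ⬝ᵥ s' q) p X = covD A s p X ⬝ᵥ s' p + s p ⬝ᵥ covD A s' p X := by
  have h := dmap_bilin dotB hs hs' X
  simp only [dotB_apply] at h
  rw [h, covD, covD, add_dotProduct, dotProduct_add]
  linear_combination -hA p X (s p) (s' p)

theorem mdifferentiableAt_smul {c : M → ℂ} {s : M → C3} {p : M}
    (hc : MDifferentiableAt 𝓘(ℝ, Plane) 𝓘(ℝ, ℂ) c p)
    (hs : MDifferentiableAt 𝓘(ℝ, Plane) 𝓘(ℝ, C3) s p) :
    MDifferentiableAt 𝓘(ℝ, Plane) 𝓘(ℝ, C3) (fun q => c q • s q) p :=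
  mdifferentiableAt_bilin smulB hc hs

theorem covD_frame (A : ConnForm M) {s : M → C3} {p : M} {e : Fin 3 → M → C3} {c : Fin 3 → M → ℂ}
    (he : ∀ j, MDifferentiableAt 𝓘(ℝ, Plane) 𝓘(ℝ, C3) (e j) p)
    (hc : ∀ j, MDifferentiableAt 𝓘(ℝ, Plane) 𝓘(ℝ, ℂ) (c j) p)
    (hs : ∀ᶠ q in 𝓝 p, s q = ∑ j, c j q • e j q) (X : TangentSpace 𝓘(ℝ, Plane) p) :
    covD A s p X = ∑ j, (dmap (c j) p X • e j p + c j p • covD A (e j) p X) := by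
  rw [covD_congr hs]
  simp only [Fin.sum_univ_three]
  have h := fun j => mdifferentiableAt_smul (hc j) (he j)
  rw [covD_add (s := fun q => c 0 q • e 0 q + c 1 q • e 1 q) ((h 0).add (h 1)) (h 2), covD_add (h 0) (h 1)]
  simp only [covD_smul (hc _) (he _)]

/-- In a frame of eigenvectors of `g` whose eigenvalues are constant over the surface, the
derivatives of the coefficients are untouched by the gauge. Only the derivatives of the frame
vectors are rescaled and acted upon by `g`. -/
theorem gaugeAct_covD_frame (A : ConnForm M) {g : M → EndC3} {s : M → C3} {p : M}
    {e : Fin 3 → M → C3} {c : Fin 3 → M → ℂ} {m : Fin 3 → ℂ} (hm : ∀ j, m j ≠ 0)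
    (he : ∀ j, MDifferentiableAt 𝓘(ℝ, Plane) 𝓘(ℝ, C3) (e j) p)
    (hc : ∀ j, MDifferentiableAt 𝓘(ℝ, Plane) 𝓘(ℝ, ℂ) (c j) p)
    (hs : ∀ᶠ q in 𝓝 p, s q = ∑ j, c j q • e j q)
    (hg : ∀ᶠ q in 𝓝 p, ∀ j, (g q).inverse (e j q) = (m j)⁻¹ • e j q)
    (hgp : ∀ j, g p (e j p) = m j • e j p) (X : TangentSpace 𝓘(ℝ, Plane) p) :
    gaugeAct g (covD A) s p X =
      ∑ j, (dmap (c j) p X • e j p + c j p • (m j)⁻¹ • g p (covD A (e j) p X)) := by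
  have he' : ∀ j, MDifferentiableAt 𝓘(ℝ, Plane) 𝓘(ℝ, C3) (fun q => (m j)⁻¹ • e j q) p :=
    fun j => mdifferentiableAt_smul (c := fun _ => (m j)⁻¹) mdifferentiableAt_const (he j)
  have h1 : ∀ᶠ q in 𝓝 p, (g q).inverse (s q) = ∑ j, c j q • (m j)⁻¹ • e j q := by
    filter_upwards [hs, hg] with q hq hgq
    rw [hq, map_sum]
    simp only [map_smul, hgq]
  rw [gaugeAct, covD_frame A he' hc h1, map_sum]
  refine Finset.sum_congr rfl fun j _ => ?_
  rw [covD_const_smul _ (he j)]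
  simp only [map_add, map_smul, hgp]
  rw [smul_smul (m j)⁻¹, inv_mul_cancel₀ (hm j), one_smul]

end Covariant

/-- A function agrees, near a point but perhaps not at it, with an analytic function. -/
def AnalyticAcross (h : ℂ → C3) (α : ℂ) : Prop :=
  ∃ k : ℂ → C3, AnalyticAt ℂ k α ∧ h =ᶠ[𝓝[≠] α] k

/-! ### Removable singularities of vector-valued functions. -/

section AnalyticAcross

variable {h k : ℂ → C3} {α : ℂ}

theorem AnalyticAt.analyticAcross (hh : AnalyticAt ℂ h α) : AnalyticAcross h α :=
  ⟨h, hh, Filter.EventuallyEq.rfl⟩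

theorem AnalyticAcross.congr (hh : AnalyticAcross h α) (e : k =ᶠ[𝓝[≠] α] h) :
    AnalyticAcross k α :=
  let ⟨f, hf, e'⟩ := hh
  ⟨f, hf, e.trans e'⟩

theorem AnalyticAcross.add (hh : AnalyticAcross h α) (hk : AnalyticAcross k α) :
    AnalyticAcross (fun z => h z + k z) α :=
  let ⟨f, hf, e⟩ := hh
  let ⟨f', hf', e'⟩ := hk
  ⟨fun z => f z + f' z, hf.add hf', e.add e'⟩

theorem AnalyticAcross.const_smul (hh : AnalyticAcross h α) (c : ℂ) :
    AnalyticAcross (fun z => c • h z) α :=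
  let ⟨f, hf, e⟩ := hh
  ⟨fun z => c • f z, analyticAt_const.fun_smul hf, e.const_smul c⟩

theorem AnalyticAcross.sum {ι : Type*} (s : Finset ι) {h : ι → ℂ → C3}
    (hh : ∀ i, AnalyticAcross (h i) α) : AnalyticAcross (fun z => ∑ i ∈ s, h i z) α := by
  classical
  induction s using Finset.induction_on with
  | empty => simpa using (analyticAt_const (v := (0 : C3))).analyticAcross
  | insert i s hi ih =>
    simp only [Finset.sum_insert hi]
    exact (hh i).add ih

end AnalyticAcross

/-! ### Linear fractional transformations near a zero. -/

section Mobius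

variable {k₁ k₂ k₃ k₄ α : ℂ}

theorem mobius_zero_ne (hdet : k₁ * k₄ - k₂ * k₃ ≠ 0) (hα : k₁ * α + k₂ = 0) :
    k₁ ≠ 0 ∧ k₃ * α + k₄ ≠ 0 := by
  constructor
  · rintro rfl
    apply hdet
    linear_combination (-k₃) * hα
  · intro h
    apply hdet
    linear_combination k₁ * h - k₃ * hα

theorem analyticAt_mobius (hdet : k₁ * k₄ - k₂ * k₃ ≠ 0) (hα : k₁ * α + k₂ = 0) :
    AnalyticAt ℂ (fun z => (k₁ * z + k₂) / (k₃ * z + k₄)) α :=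
  AnalyticAt.div (by fun_prop) (by fun_prop) (mobius_zero_ne hdet hα).2

theorem eventually_mobius_ne_zero (hdet : k₁ * k₄ - k₂ * k₃ ≠ 0) (hα : k₁ * α + k₂ = 0) :
    ∀ᶠ z in 𝓝[≠] α, (k₁ * z + k₂) / (k₃ * z + k₄) ≠ 0 := by
  obtain ⟨h1, h3⟩ := mobius_zero_ne hdet hα
  have hc : ∀ᶠ z in 𝓝 α, k₃ * z + k₄ ≠ 0 :=
    (Continuous.continuousAt (by fun_prop)).eventually_ne h3
  filter_upwards [self_mem_nhdsWithin, hc.filter_mono nhdsWithin_le_nhds] with z hz hz'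
  refine div_ne_zero (fun h => hz ?_) hz'
  have : k₁ * (z - α) = 0 := by linear_combination h - hα
  exact sub_eq_zero.1 ((mul_eq_zero.1 this).resolve_left h1)

/-- The zero of a linear fractional transformation is simple, so its reciprocal has a simple pole,
cancelled by any analytic factor vanishing there. -/
theorem analyticAcross_inv_mobius_smul (hdet : k₁ * k₄ - k₂ * k₃ ≠ 0) (hα : k₁ * α + k₂ = 0)
    {h : ℂ → C3} (hh : AnalyticAt ℂ h α) (h0 : h α = 0) :
    AnalyticAcross (fun z => ((k₁ * z + k₂) / (k₃ * z + k₄))⁻¹ • h z) α := by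
  obtain ⟨h1, h3⟩ := mobius_zero_ne hdet hα
  have hord : ((1 : ℕ) : ℕ∞) ≤ analyticOrderAt h α := by
    rw [Nat.cast_one, Order.one_le_iff_ne_zero]
    exact fun h => (hh.analyticOrderAt_eq_zero.1 h) h0
  obtain ⟨g, hg, hgz⟩ := (natCast_le_analyticOrderAt hh).1 hord
  refine ⟨fun z => ((k₃ * z + k₄) / k₁) • g z, AnalyticAt.fun_smul ?_ hg, ?_⟩
  · exact AnalyticAt.div (by fun_prop) analyticAt_const h1
  · filter_upwards [self_mem_nhdsWithin, hgz.filter_mono nhdsWithin_le_nhds] with z hz hz'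
    have hzα : z - α ≠ 0 := sub_ne_zero.2 hz
    rw [hz', pow_one, smul_smul, show k₁ * z + k₂ = k₁ * (z - α) by linear_combination hα]
    congr 1
    field_simp

end Mobius

/-! ### Holomorphy of the gauged family and parallel lines. -/

section GaugedFamily

variable {M : Type*} [TopologicalSpace M] [ChartedSpace Plane M]

theorem IsNullLineSubbundle.exists_local_section {L : M → Submodule ℂ C3}
    (hL : IsNullLineSubbundle L) (p : M) :
    ∃ s : M → C3, ContMDiffAt 𝓘(ℝ, Plane) 𝓘(ℝ, C3) ∞ s p ∧
      ∀ᶠ q in 𝓝 p, s q ≠ 0 ∧ s q ⬝ᵥ s q = 0 ∧ L q = Submodule.span ℂ {s q} := by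
  obtain ⟨U, hU, s, hs, h⟩ := hL.smooth p
  refine ⟨s, hs.contMDiffAt hU, Filter.mem_of_superset hU fun q hq => ⟨(h q hq).1, ?_, (h q hq).2⟩⟩
  apply hL.null q
  rw [(h q hq).2]
  exact Submodule.mem_span_singleton_self _

theorem contMDiffAt_div {f g : M → ℂ} {p : M} (hf : ContMDiffAt 𝓘(ℝ, Plane) 𝓘(ℝ, ℂ) ∞ f p)
    (hg : ContMDiffAt 𝓘(ℝ, Plane) 𝓘(ℝ, ℂ) ∞ g p) (h : g p ≠ 0) :
    ContMDiffAt 𝓘(ℝ, Plane) 𝓘(ℝ, ℂ) ∞ (fun q => f q / g q) p := by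
  have hd : ContDiffAt ℝ ∞ (fun x : ℂ × ℂ => x.1 / x.2) (f p, g p) := by
    simp only [div_eq_mul_inv]
    exact contDiffAt_fst.mul (contDiffAt_snd.inv h)
  exact hd.contMDiffAt.comp (f := fun q => (f q, g q)) p (hf.prodMk_space hg)

theorem analyticAt_covD {A : ℂ → ConnForm M} {α : ℂ} {p : M} {X : TangentSpace 𝓘(ℝ, Plane) p}
    (hA : AnalyticAt ℂ (fun z => A z p X) α) (s : M → C3) :
    AnalyticAt ℂ (fun z => covD (A z) s p X) α :=
  analyticAt_const.add (((ContinuousLinearMap.apply ℂ C3 (s p)).analyticAt _).comp hA)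

/-- In the frame `u, w, u × w` the gauged derivative contains negative powers of `ψ` only in the
`L'` and perpendicular components of `D u` and in the `L'` component of `D (u × w)`. The first
vanishes identically because `D` is metric and `u` null; the other two vanish at `α` because `L` is
parallel there, and their poles are simple. -/
theorem holomorphicAcross_of_isParallel {L L' : M → Submodule ℂ C3}
    (hL : IsNullLineSubbundle L) (hL' : IsNullLineSubbundle L') (hLL' : ∀ p, L p ⊓ L' p = ⊥)
    {A : ℂ → ConnForm M} (hA : ∀ z, IsMetricConn (A z)) {k₁ k₂ k₃ k₄ α : ℂ}
    (hdet : k₁ * k₄ - k₂ * k₃ ≠ 0) (hα : k₁ * α + k₂ = 0)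
    (han : ∀ p (X : TangentSpace 𝓘(ℝ, Plane) p), AnalyticAt ℂ (fun z => A z p X) α)
    (hpar : IsParallel (covD (A α)) L) :
    HolomorphicAcross
      (fun z => gaugeAct (fun p => gamma (L p) (L' p) ((k₁ * z + k₂) / (k₃ * z + k₄)))
        (covD (A z))) α := by
  intro s p hs X
  obtain ⟨u, hus, hu⟩ := hL.exists_local_section p
  obtain ⟨w, hws, hw⟩ := hL'.exists_local_section p
  have hind : ∀ᶠ q in 𝓝 p, LinearIndependent ℂ ![u q, w q] := by
    filter_upwards [hu, hw] with q hq hq'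
    have := hLL' q
    rw [hq.2.2, hq'.2.2] at this
    exact linearIndependent_of_span_inf_eq_bot hq.1 hq'.1 this
  have hup := hu.self_of_nhds
  have hwp := hw.self_of_nhds
  have hip := hind.self_of_nhds
  have huw := dot_ne_zero_of_null hup.2.1 hwp.2.1 hip
  set ψ : ℂ → ℂ := fun z => (k₁ * z + k₂) / (k₃ * z + k₄) with hψ
  have hψa : AnalyticAt ℂ ψ α := analyticAt_mobius hdet hα
  have hdot : ∀ {x y : M → C3}, ContMDiffAt 𝓘(ℝ, Plane) 𝓘(ℝ, C3) ∞ x p →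
      ContMDiffAt 𝓘(ℝ, Plane) 𝓘(ℝ, C3) ∞ y p →
      ContMDiffAt 𝓘(ℝ, Plane) 𝓘(ℝ, ℂ) ∞ (fun q => x q ⬝ᵥ y q) p :=
    fun hx hy => contMDiffAt_bilin dotB hx hy
  have hes : ContMDiffAt 𝓘(ℝ, Plane) 𝓘(ℝ, C3) ∞ (fun q => crossProduct (u q) (w q)) p :=
    contMDiffAt_bilin crossB hus hws
  have hmd : ∀ {x : M → C3}, ContMDiffAt 𝓘(ℝ, Plane) 𝓘(ℝ, C3) ∞ x p →
      MDifferentiableAt 𝓘(ℝ, Plane) 𝓘(ℝ, C3) x p := fun h => h.mdifferentiableAt (by simp)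
  have hmd' : ∀ {x : M → ℂ}, ContMDiffAt 𝓘(ℝ, Plane) 𝓘(ℝ, ℂ) ∞ x p →
      MDifferentiableAt 𝓘(ℝ, Plane) 𝓘(ℝ, ℂ) x p := fun h => h.mdifferentiableAt (by simp)
  let e : Fin 3 → M → C3 := ![u, w, fun q => crossProduct (u q) (w q)]
  let c : Fin 3 → M → ℂ := ![fun q => s q ⬝ᵥ w q / u q ⬝ᵥ w q, fun q => s q ⬝ᵥ u q / u q ⬝ᵥ w q,
    fun q => -(s q ⬝ᵥ crossProduct (u q) (w q)) / (u q ⬝ᵥ w q) ^ 2]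
  -- The eigenvalues of `Γ(ψ z)` on the three frame vectors.
  let m : ℂ → Fin 3 → ℂ := fun z => ![ψ z, (ψ z)⁻¹, 1]
  have he : ∀ j, MDifferentiableAt 𝓘(ℝ, Plane) 𝓘(ℝ, C3) (e j) p := by
    intro j
    fin_cases j
    exacts [hmd hus, hmd hws, hmd hes]
  have hc : ∀ j, MDifferentiableAt 𝓘(ℝ, Plane) 𝓘(ℝ, ℂ) (c j) p := by
    intro j
    fin_cases j
    · exact hmd' (contMDiffAt_div (hdot hs hws) (hdot hus hws) huw)
    · exact hmd' (contMDiffAt_div (hdot hs hus) (hdot hus hws) huw)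
    · refine hmd' (contMDiffAt_div (hdot hs hes).neg ?_ (pow_ne_zero 2 huw))
      simp only [sq]
      exact contMDiffAt_bilin (ContinuousLinearMap.mul ℝ ℂ) (hdot hus hws) (hdot hus hws)
  have hdec : ∀ᶠ q in 𝓝 p, s q = ∑ j, c j q • e j q := by
    filter_upwards [hu, hw, hind] with q hq hq' hqi
    rw [Fin.sum_univ_three]
    exact null_frame_decomp hq.2.1 hq'.2.1 (dot_ne_zero_of_null hq.2.1 hq'.2.1 hqi) (s q)
  have hgauge : ∀ᶠ z in 𝓝[≠] α,
      gaugeAct (fun p => gamma (L p) (L' p) (ψ z)) (covD (A z)) s p X =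
        ∑ j, (dmap (c j) p X • e j p
          + c j p • (m z j)⁻¹ • gamma (L p) (L' p) (ψ z) (covD (A z) (e j) p X)) := by
    filter_upwards [eventually_mobius_ne_zero hdet hα] with z hz
    refine gaugeAct_covD_frame (A z) (m := m z) ?_ he hc hdec ?_ ?_ X
    · intro j
      fin_cases j
      exacts [hz, inv_ne_zero hz, one_ne_zero]
    · filter_upwards [hu, hw, hind] with q hq hq' hqi j
      rw [hq.2.2, hq'.2.2, gamma_inverse hq.2.1 hq'.2.1 hqi hz]
      fin_cases j
      · exact gamma_apply_left hq.2.1 hq'.2.1 hqi _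
      · exact gamma_apply_right hq.2.1 hq'.2.1 hqi _
      · change _ = (1 : ℂ)⁻¹ • _
        rw [inv_one, one_smul]
        exact gamma_apply_cross hq.2.1 hq'.2.1 hqi _
    · intro j
      rw [hup.2.2, hwp.2.2]
      fin_cases j
      · exact gamma_apply_left hup.2.1 hwp.2.1 hip _
      · exact gamma_apply_right hup.2.1 hwp.2.1 hip _
      · change _ = (1 : ℂ) • _
        rw [one_smul]
        exact gamma_apply_cross hup.2.1 hwp.2.1 hip _
  have hDan : ∀ x : M → C3, AnalyticAt ℂ (fun z => covD (A z) x p X) α :=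
    fun x => analyticAt_covD (han p X) x
  have hPan : ∀ (P : EndC3) (x : M → C3), AnalyticAt ℂ (fun z => P (covD (A z) x p X)) α :=
    fun P x => (P.analyticAt _).comp (hDan x)
  -- Differentiating `u·u = 0` removes the `ψ⁻²` term for every parameter, not only at `α`.
  have huD : ∀ z, covD (A z) u p X ⬝ᵥ u p = 0 := by
    intro z
    have h1 := dmap_dotProduct (hA z) (hmd hus) (hmd hus) X
    have h2 : (fun q => u q ⬝ᵥ u q) =ᶠ[𝓝 p] fun _ => 0 := hu.mono fun q hq => hq.2.1
    rw [dmap_congr h2, dmap_const, dotProduct_comm (u p)] at h1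
    have h3 : (0 : ℂ) = covD (A z) u p X ⬝ᵥ u p + covD (A z) u p X ⬝ᵥ u p := h1
    linear_combination -h3 / 2
  have hLu : ∃ k : ℂ, k • u p = covD (A α) u p X := by
    have := hpar u p hus (hu.mono fun q hq => by
      rw [hq.2.2]; exact Submodule.mem_span_singleton_self _) X
    rw [hup.2.2] at this
    exact Submodule.mem_span_singleton.1 this
  obtain ⟨k, hk⟩ := hLu
  -- Differentiate `(u × w)·u = 0` and use that `D_α u` is a multiple of `u`.
  have heD : covD (A α) (e 2) p X ⬝ᵥ u p = 0 := by
    have h1 := dmap_dotProduct (hA α) (hmd hes) (hmd hus) X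
    have h2 : (fun q => crossProduct (u q) (w q) ⬝ᵥ u q) = fun _ => 0 :=
      funext fun q => by rw [dotProduct_comm, dot_self_cross]
    rw [h2, dmap_const, ← hk, dotProduct_smul, dotProduct_comm (crossProduct (u p) (w p)),
      dot_self_cross, smul_zero, add_zero] at h1
    exact h1.symm
  have hex : ∀ j, AnalyticAcross
      (fun z => (m z j)⁻¹ • gamma (L p) (L' p) (ψ z) (covD (A z) (e j) p X)) α := by
    intro j
    rw [hup.2.2, hwp.2.2]
    simp only [gamma_eq hup.2.1 hwp.2.1 hip]
    have hwu : w p ⬝ᵥ u p = u p ⬝ᵥ w p := dotProduct_comm _ _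
    fin_cases j
    · refine ((hPan (lineProj (u p) (w p)) u).analyticAcross.add
        (analyticAcross_inv_mobius_smul hdet hα (hPan (perpProj (u p) (w p)) u) ?_)).congr ?_
      · rw [← hk, map_smul, perpProj_apply, hup.2.1, div_self huw]
        simp
      · filter_upwards [eventually_mobius_ne_zero hdet hα] with z hz
        change (ψ z)⁻¹ • (perpProj (u p) (w p) (covD (A z) u p X)
          + ψ z • lineProj (u p) (w p) (covD (A z) u p X)
          + (ψ z)⁻¹ • lineProj (w p) (u p) (covD (A z) u p X)) = _
        rw [lineProj_apply (w p), huD z, zero_div, zero_smul, smul_zero, add_zero, smul_add,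
          smul_smul, inv_mul_cancel₀ hz, one_smul, add_comm]
    -- The inverse gauge multiplies `w` by `ψ`, so only the powers `ψ`, `ψ²` and `1` occur here.
    · refine (((hψa.smul (hPan (perpProj (u p) (w p)) w)).add
        ((hψa.pow 2).smul (hPan (lineProj (u p) (w p)) w))).add
        (hPan (lineProj (w p) (u p)) w)).analyticAcross.congr ?_
      filter_upwards [eventually_mobius_ne_zero hdet hα] with z hz
      change ((ψ z)⁻¹)⁻¹ • (perpProj (u p) (w p) (covD (A z) w p X)
          + ψ z • lineProj (u p) (w p) (covD (A z) w p X)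
          + (ψ z)⁻¹ • lineProj (w p) (u p) (covD (A z) w p X)) =
          ψ z • perpProj (u p) (w p) (covD (A z) w p X)
          + ψ z ^ 2 • lineProj (u p) (w p) (covD (A z) w p X)
          + lineProj (w p) (u p) (covD (A z) w p X)
      rw [inv_inv, smul_add, smul_add, smul_smul, smul_smul, mul_inv_cancel₀ hz, one_smul, sq]
    · refine (((hPan (perpProj (u p) (w p)) (e 2)).add
        (hψa.smul (hPan (lineProj (u p) (w p)) (e 2)))).analyticAcross.add
        (analyticAcross_inv_mobius_smul hdet hα (hPan (lineProj (w p) (u p)) (e 2)) ?_)).congr ?_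
      · rw [lineProj_apply, heD, zero_div, zero_smul]
      · refine Filter.Eventually.of_forall fun z => ?_
        change (1 : ℂ)⁻¹ • _ = _
        rw [inv_one, one_smul]
        rfl
  have htot := AnalyticAcross.sum Finset.univ fun j =>
    (analyticAt_const (𝕜 := ℂ) (x := α) (v := dmap (c j) p X • e j p)).analyticAcross.add
      ((hex j).const_smul (c j p))
  exact htot.congr hgauge

/-- For a section `s` of `L`, undoing the gauge expresses `D_z s` by the holomorphic extension `h`
with powers `1`, `ψ`, `ψ²` on the components along `L`, the perpendicular line and `L'`. As `z`
tends to `α` only the `L` component survives. -/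
theorem isParallel_of_holomorphicAcross {L L' : M → Submodule ℂ C3}
    (hL : IsNullLineSubbundle L) (hL' : IsNullLineSubbundle L') (hLL' : ∀ p, L p ⊓ L' p = ⊥)
    {A : ℂ → ConnForm M} {k₁ k₂ k₃ k₄ α : ℂ}
    (hdet : k₁ * k₄ - k₂ * k₃ ≠ 0) (hα : k₁ * α + k₂ = 0)
    (han : ∀ p (X : TangentSpace 𝓘(ℝ, Plane) p), AnalyticAt ℂ (fun z => A z p X) α)
    (hhol : HolomorphicAcross
      (fun z => gaugeAct (fun p => gamma (L p) (L' p) ((k₁ * z + k₂) / (k₃ * z + k₄)))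
        (covD (A z))) α) :
    IsParallel (covD (A α)) L := by
  intro s p hs hsL X
  obtain ⟨h, hh, hheq⟩ := hhol s p hs X
  obtain ⟨u, -, hu⟩ := hL.exists_local_section p
  obtain ⟨w, -, hw⟩ := hL'.exists_local_section p
  have hind : ∀ᶠ q in 𝓝 p, LinearIndependent ℂ ![u q, w q] := by
    filter_upwards [hu, hw] with q hq hq'
    have := hLL' q
    rw [hq.2.2, hq'.2.2] at this
    exact linearIndependent_of_span_inf_eq_bot hq.1 hq'.1 this
  have hup := hu.self_of_nhds
  have hwp := hw.self_of_nhds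
  have hip := hind.self_of_nhds
  set ψ : ℂ → ℂ := fun z => (k₁ * z + k₂) / (k₃ * z + k₄) with hψ
  have hψa : AnalyticAt ℂ ψ α := analyticAt_mobius hdet hα
  have hψ0 : ψ α = 0 := by simp [hψ, hα]
  have hsd : MDifferentiableAt 𝓘(ℝ, Plane) 𝓘(ℝ, C3) s p := hs.mdifferentiableAt (by simp)
  have key : ∀ᶠ z in 𝓝[≠] α, covD (A z) s p X = ψ z • perpProj (u p) (w p) (h z)
      + lineProj (u p) (w p) (h z) + ψ z ^ 2 • lineProj (w p) (u p) (h z) := by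
    filter_upwards [eventually_mobius_ne_zero hdet hα, hheq] with z hz hz'
    replace hz : ψ z ≠ 0 := hz
    have h1 : (fun q => (gamma (L q) (L' q) (ψ z)).inverse (s q)) =ᶠ[𝓝 p]
        fun q => (ψ z)⁻¹ • s q := by
      filter_upwards [hu, hw, hind, hsL] with q hq hq' hqi hsq
      rw [hq.2.2] at hsq
      obtain ⟨k, hk⟩ := Submodule.mem_span_singleton.1 hsq
      rw [hq.2.2, hq'.2.2, gamma_inverse hq.2.1 hq'.2.1 hqi hz, ← hk, map_smul,
        gamma_apply_left hq.2.1 hq'.2.1 hqi, smul_comm]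
    have h2 : h z = (ψ z)⁻¹ • gamma (L p) (L' p) (ψ z) (covD (A z) s p X) := by
      rw [← hz', gaugeAct, covD_congr h1, covD_const_smul _ hsd, map_smul]
    have h3 : gamma (L p) (L' p) (ψ z)⁻¹ (gamma (L p) (L' p) (ψ z) (covD (A z) s p X))
        = covD (A z) s p X := by
      rw [hup.2.2, hwp.2.2]
      have := gamma_comp_gamma_inv hup.2.1 hwp.2.1 hip (inv_ne_zero hz)
      rw [inv_inv] at this
      exact DFunLike.congr_fun this _
    have h4 : covD (A z) s p X = ψ z • gamma (L p) (L' p) (ψ z)⁻¹ (h z) := by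
      rw [h2, map_smul, h3, smul_smul, mul_inv_cancel₀ hz, one_smul]
    rw [h4, hup.2.2, hwp.2.2, gamma_eq hup.2.1 hwp.2.1 hip, inv_inv]
    simp only [_root_.add_apply, _root_.smul_apply, smul_add, smul_smul,
      mul_inv_cancel₀ hz, one_smul, sq]
  have hPan : ∀ P : EndC3, AnalyticAt ℂ (fun z => P (h z)) α := fun P => (P.analyticAt _).comp hh
  have hR : AnalyticAt ℂ (fun z => ψ z • perpProj (u p) (w p) (h z)
      + lineProj (u p) (w p) (h z) + ψ z ^ 2 • lineProj (w p) (u p) (h z)) α :=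
    ((hψa.smul (hPan _)).add (hPan _)).add ((hψa.pow 2).smul (hPan _))
  -- Two functions analytic at `α` agree near `α` except perhaps at `α`, hence have the same value
  -- there; `ψ` vanishes at `α`.
  have hlim : covD (A α) s p X = lineProj (u p) (w p) (h α) := by
    have h1 := (analyticAt_covD (han p X) s).continuousAt.tendsto.mono_left
      (nhdsWithin_le_nhds (s := {α}ᶜ))
    have h2 := hR.continuousAt.tendsto.mono_left (nhdsWithin_le_nhds (s := {α}ᶜ))
    have h3 := tendsto_nhds_unique (h1.congr' key) h2
    rw [h3, hψ0]
    simp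
  rw [hlim, hup.2.2, lineProj_apply]
  exact Submodule.smul_mem _ _ (Submodule.mem_span_singleton_self _)

theorem holomorphicAcross_iff_isParallel {L L' : M → Submodule ℂ C3}
    (hL : IsNullLineSubbundle L) (hL' : IsNullLineSubbundle L') (hLL' : ∀ p, L p ⊓ L' p = ⊥)
    {A : ℂ → ConnForm M} (hA : ∀ z, IsMetricConn (A z)) {k₁ k₂ k₃ k₄ α : ℂ}
    (hdet : k₁ * k₄ - k₂ * k₃ ≠ 0) (hα : k₁ * α + k₂ = 0)
    (han : ∀ p (X : TangentSpace 𝓘(ℝ, Plane) p), AnalyticAt ℂ (fun z => A z p X) α) :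
    HolomorphicAcross
      (fun z => gaugeAct (fun p => gamma (L p) (L' p) ((k₁ * z + k₂) / (k₃ * z + k₄)))
        (covD (A z))) α ↔ IsParallel (covD (A α)) L :=
  ⟨isParallel_of_holomorphicAcross hL hL' hLL' hdet hα han,
    holomorphicAcross_of_isParallel hL hL' hLL' hA hdet hα han⟩

theorem holomorphicAcross_iff_isParallel_pole {L L' : M → Submodule ℂ C3}
    (hL : IsNullLineSubbundle L) (hL' : IsNullLineSubbundle L') (hLL' : ∀ p, L p ⊓ L' p = ⊥)
    {A : ℂ → ConnForm M} (hA : ∀ z, IsMetricConn (A z)) {k₁ k₂ k₃ k₄ β : ℂ}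
    (hdet : k₁ * k₄ - k₂ * k₃ ≠ 0) (hβ : k₃ * β + k₄ = 0)
    (han : ∀ p (X : TangentSpace 𝓘(ℝ, Plane) p), AnalyticAt ℂ (fun z => A z p X) β) :
    HolomorphicAcross
      (fun z => gaugeAct (fun p => gamma (L p) (L' p) ((k₁ * z + k₂) / (k₃ * z + k₄)))
        (covD (A z))) β ↔ IsParallel (covD (A β)) L' := by
  have h := holomorphicAcross_iff_isParallel hL' hL
    (fun p => by rw [inf_comm]; exact hLL' p) hA
    -- The pole of `ψ` is the zero of `1/ψ`, and `1/ψ` is the parameter once `L` and `L'` are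
    -- exchanged.
    (show k₃ * k₂ - k₄ * k₁ ≠ 0 from fun h => hdet (by linear_combination -h)) hβ han
  have h2 : (fun z => gaugeAct (fun p => gamma (L p) (L' p) ((k₁ * z + k₂) / (k₃ * z + k₄)))
        (covD (A z))) = (fun z => gaugeAct (fun p => gamma (L' p) (L p)
          ((k₃ * z + k₄) / (k₁ * z + k₂))) (covD (A z))) := by
    funext z
    simp only [gamma_swap (L _) (L' _), inv_div]
  rw [h2]
  exact h

end GaugedFamily

/-! ### Vector algebra of real and complex three-space. -/

section VectorAlgebra

theorem eq_zero_of_eq_neg_self {G : Type*} [AddCommGroup G] [Module ℝ G] {x : G} (h : x = -x) :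
    x = 0 := by
  have h2 : (2 : ℝ) • x = 0 := by rw [two_smul]; nth_rewrite 2 [h]; exact add_neg_cancel x
  exact (smul_eq_zero.1 h2).resolve_left two_ne_zero

theorem inner_R3 (a b : R3) : inner ℝ a b = a 0 * b 0 + a 1 * b 1 + a 2 * b 2 := by
  simp [PiLp.inner_apply, Fin.sum_univ_three, mul_comm]

/-- The cross product of `ℝ³` as a continuous bilinear map. -/
noncomputable def crossR : R3 →L[ℝ] R3 →L[ℝ] R3 :=
  LinearMap.toContinuousBilinearMap
    (LinearMap.mk₂ ℝ cross
      (fun u v w => by ext i; fin_cases i <;> simp [cross])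
      (fun k u v => by ext i; fin_cases i <;> simp [cross])
      (fun u v w => by ext i; fin_cases i <;> simp [cross])
      (fun k u v => by ext i; fin_cases i <;> simp [cross]))

theorem crossR_apply (u v : R3) : crossR u v = cross u v := rfl

theorem cross_swap (a b : R3) : cross a b = -cross b a := by
  ext i; fin_cases i <;> simp [cross, cross_apply] <;> ring

theorem cross_cross_right (a b c : R3) :
    cross a (cross b c) = (inner ℝ a c : ℝ) • b - (inner ℝ a b : ℝ) • c := by
  ext i
  fin_cases i <;> simp [cross, cross_apply, inner_R3] <;> ring

theorem inner_cross_left (a b : R3) : inner ℝ a (cross a b) = 0 := by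
  simp only [inner_R3]
  simp [cross, cross_apply]
  ring

theorem inner_cross_right (a b : R3) : inner ℝ b (cross a b) = 0 := by
  simp only [inner_R3]
  simp [cross, cross_apply]
  ring

theorem inner_cross_self (a b : R3) : inner ℝ (cross a b) (cross a b) =
    inner ℝ a a * inner ℝ b b - inner ℝ a b ^ 2 := by
  simp only [inner_R3]
  simp [cross, cross_apply]
  ring

theorem cross_cross_cross (n a b : R3) :
    cross (cross n a) (cross n b) = (inner ℝ n (cross a b) : ℝ) • n := by
  ext i
  fin_cases i <;> simp [cross, cross_apply, inner_R3] <;> ring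

/-- If `a` and `b` are orthogonal to the unit vector `n`, then the quarter turn about `n` does not
change their cross product. -/
theorem cross_quarterTurn {n a b : R3} (hn : inner ℝ n n = (1 : ℝ)) (ha : inner ℝ n a = (0 : ℝ))
    (hb : inner ℝ n b = (0 : ℝ)) : cross (cross n a) (cross n b) = cross a b := by
  have h := cross_cross_right n n (cross a b)
  rw [cross_cross_right n a b, ha, hb, hn, zero_smul, zero_smul, sub_zero] at h
  have h0 : cross n (0 : R3) = 0 := map_zero (crossR n)
  rw [h0, one_smul] at h
  rw [cross_cross_cross, ← sub_eq_zero, ← h]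

/-- The inclusion `ℝ³ ⊆ ℂ³` as a continuous real-linear map. -/
noncomputable def cxL : R3 →L[ℝ] C3 :=
  LinearMap.toContinuousLinearMap
    { toFun := cx
      map_add' := fun x y => by ext i; simp [cx]
      map_smul' := fun k x => by ext i; simp [cx] }

theorem cx_add (a b : R3) : cx (a + b) = cx a + cx b := map_add cxL a b

theorem cx_sub (a b : R3) : cx (a - b) = cx a - cx b := map_sub cxL a b

theorem cx_neg (a : R3) : cx (-a) = -cx a := map_neg cxL a

theorem cx_smul (k : ℝ) (a : R3) : cx (k • a) = (k : ℂ) • cx a := by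
  ext i; simp [cx]

theorem cx_dotProduct (a b : R3) : cx a ⬝ᵥ cx b = ((inner ℝ a b : ℝ) : ℂ) := by
  simp [cx, inner_R3, Matrix.vec3_dotProduct]

theorem cx_crossProduct (a b : R3) : crossProduct (cx a) (cx b) = cx (cross a b) := by
  ext i
  fin_cases i <;> simp [cx, cross, cross_apply]

theorem star_cx (a : R3) : star (cx a) = cx a := by
  ext i; simp [cx]

theorem crossEnd_apply (w u : C3) : crossEnd w u = crossProduct w u := rfl

theorem crossEnd_add (v w : C3) : crossEnd (v + w) = crossEnd v + crossEnd w := by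
  ext1 u; simp [crossEnd_apply]

theorem crossEnd_smul (k : ℂ) (w : C3) : crossEnd (k • w) = k • crossEnd w := by
  ext1 u; simp [crossEnd_apply]

/-- Real vectors as endomorphisms of `ℂ³`. -/
noncomputable def crossEndR : R3 →L[ℝ] EndC3 :=
  LinearMap.toContinuousLinearMap
    { toFun := fun v => crossEnd (cx v)
      map_add' := fun x y => by rw [cx_add, crossEnd_add]
      map_smul' := fun k x => by
        rw [cx_smul, crossEnd_smul, RingHom.id_apply]
        ext1 u
        exact Complex.coe_smul k _ }

/-- This is the Jacobi identity: the identification of vectors with skew endomorphisms is a Lie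
algebra homomorphism. -/
theorem crossEndR_commutator (a b : R3) :
    crossEndR a * crossEndR b - crossEndR b * crossEndR a = crossEndR (cross a b) := by
  ext1 u
  have h := cross_cross (cx a) (cx b) u
  rw [cx_crossProduct] at h
  exact h.symm

/-- Three vectors of `ℝ³` forming a positively oriented orthonormal basis. -/
structure IsOrthoFrame (n t w : R3) : Prop where
  n_n : inner ℝ n n = (1 : ℝ)
  t_t : inner ℝ t t = (1 : ℝ)
  n_t : inner ℝ n t = (0 : ℝ)
  cross_n_t : cross n t = w

namespace IsOrthoFrame

theorem cross_t_w {n t w : R3} (h : IsOrthoFrame n t w) : cross t w = n := by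
  rw [← h.cross_n_t, cross_cross_right, h.t_t, real_inner_comm, h.n_t]
  simp

theorem cross_w_n {n t w : R3} (h : IsOrthoFrame n t w) : cross w n = t := by
  rw [cross_swap, ← h.cross_n_t, cross_cross_right, h.n_n, h.n_t]
  simp

theorem n_w {n t w : R3} (h : IsOrthoFrame n t w) : inner ℝ n w = (0 : ℝ) := by
  rw [← h.cross_n_t, inner_cross_left]

theorem t_w {n t w : R3} (h : IsOrthoFrame n t w) : inner ℝ t w = (0 : ℝ) := by
  rw [← h.cross_n_t, inner_cross_right]

theorem w_w {n t w : R3} (h : IsOrthoFrame n t w) : inner ℝ w w = (1 : ℝ) := by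
  rw [← h.cross_n_t, inner_cross_self, h.n_n, h.t_t, h.n_t]
  norm_num

theorem decomp {n t w : R3} (h : IsOrthoFrame n t w) (v : R3) :
    v = (inner ℝ n v : ℝ) • n + (inner ℝ t v : ℝ) • t + (inner ℝ w v : ℝ) • w := by
  have h1 := cross_cross_right w v w
  have h2 : cross v w = (inner ℝ t v : ℝ) • n - (inner ℝ n v : ℝ) • t := by
    rw [← h.cross_n_t, cross_cross_right, real_inner_comm, real_inner_comm v n]
  have h3 : ∀ (x y : ℝ), cross w (x • n - y • t) = x • t + y • n := by
    intro x y
    rw [← crossR_apply, map_sub, map_smul, map_smul, crossR_apply, crossR_apply, h.cross_w_n,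
      cross_swap w t, h.cross_t_w]
    module
  rw [h2, h3, h.w_w, one_smul] at h1
  linear_combination (norm := module) -h1

theorem rotate {n t w : R3} (h : IsOrthoFrame n t w) {C S : ℝ} (hCS : C ^ 2 + S ^ 2 = 1) :
    IsOrthoFrame (C • n - S • t) (C • t + S • n) w where
  n_n := by
    simp only [inner_sub_left, inner_sub_right, inner_smul_left, inner_smul_right, h.n_n, h.t_t,
      h.n_t, real_inner_comm n t]
    simp
    linarith
  t_t := by
    simp only [inner_add_left, inner_add_right, inner_smul_left, inner_smul_right, h.n_n, h.t_t,
      h.n_t, real_inner_comm n t]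
    simp
    linarith
  n_t := by
    simp only [inner_sub_left, inner_add_right, inner_smul_left, inner_smul_right, h.n_n, h.t_t,
      h.n_t, real_inner_comm n t]
    simp
    ring
  cross_n_t := by
    have h1 : cross n n = 0 := by
      have := cross_swap n n
      exact eq_zero_of_eq_neg_self this
    have h2 : cross t t = 0 := by
      have := cross_swap t t
      exact eq_zero_of_eq_neg_self this
    rw [← crossR_apply]
    simp only [map_sub, map_add, map_smul, _root_.sub_apply, _root_.smul_apply]
    simp only [crossR_apply, h1, h2, cross_swap t n, h.cross_n_t]
    linear_combination (norm := module) hCS • w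

end IsOrthoFrame

end VectorAlgebra

/-! ### Linear algebra of the Hodge star on a Lorentzian plane. -/

section HodgeAlgebra

variable {V G : Type*} [AddCommGroup V] [Module ℝ V] [AddCommGroup G] [Module ℝ G]

/-- An involution of a plane that is skew for a symmetric indefinite form has a basis of
eigenvectors. -/
theorem exists_null_basis (hV : Module.finrank ℝ V = 2) (g : V →ₗ[ℝ] V →ₗ[ℝ] ℝ) (J : V →ₗ[ℝ] V)
    (hpos : ∃ X, 0 < g X X) (hJ : ∀ X, J (J X) = X)
    (hgJ : ∀ X Y, g (J X) Y = -g X (J Y)) :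
    ∃ b : Module.Basis (Fin 2) ℝ V, J (b 0) = b 0 ∧ J (b 1) = -b 1 := by
  obtain ⟨X₀, hX₀⟩ := hpos
  have h1 : ∃ X, J X ≠ X := by
    by_contra! h
    have := hgJ X₀ X₀
    rw [h] at this
    linarith
  have h2 : ∃ X, J X ≠ -X := by
    by_contra! h
    have := hgJ X₀ X₀
    rw [h, map_neg, map_neg, LinearMap.neg_apply] at this
    linarith
  obtain ⟨X, hX⟩ := h1
  obtain ⟨Y, hY⟩ := h2
  -- The operators `1 + J` and `1 - J` map into the two eigenspaces. Neither is zero: `J = ±1` would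
  -- make the form vanish on the diagonal by skewness.
  have e0 : J (Y + J Y) = Y + J Y := by rw [map_add, hJ, add_comm]
  have e1 : J (X - J X) = -(X - J X) := by rw [map_sub, hJ, neg_sub]
  have n0 : Y + J Y ≠ 0 := fun h => hY (eq_neg_of_add_eq_zero_right h)
  have n1 : X - J X ≠ 0 := fun h => hX (sub_eq_zero.1 h).symm
  have hli : LinearIndependent ℝ ![Y + J Y, X - J X] := by
    rw [LinearIndependent.pair_iff' n0]
    intro a ha
    have h3 := congrArg J ha
    rw [map_smul, e0, ha, e1] at h3
    exact n1 (eq_zero_of_eq_neg_self h3)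
  refine ⟨basisOfLinearIndependentOfCardEqFinrank hli (by simp [hV]), ?_, ?_⟩
  · simpa using e0
  · simpa using e1

/-- A skew bilinear map on a plane, twisted by a trace-free involution, is symmetric. -/
theorem skew_comp_involution (b : Module.Basis (Fin 2) ℝ V) {J : V →ₗ[ℝ] V} (h0 : J (b 0) = b 0)
    (h1 : J (b 1) = -b 1) (B : V →ₗ[ℝ] V →ₗ[ℝ] G) (hB : ∀ X Y, B X Y = -B Y X) (X Y : V) :
    B X (J Y) = B Y (J X) := by
  have hself : ∀ X, B X X = 0 := fun X => eq_zero_of_eq_neg_self (hB X X)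
  rw [← b.sum_repr X, ← b.sum_repr Y]
  simp only [Fin.sum_univ_two, map_add, map_smul, h0, h1, LinearMap.add_apply,
    LinearMap.smul_apply, hself, map_neg, hB (b 1) (b 0)]
  module

/-- On a plane, all symmetric bilinear forms for which `J` is skew are proportional. -/
theorem exists_proportional (b : Module.Basis (Fin 2) ℝ V) {J : V →ₗ[ℝ] V} (h0 : J (b 0) = b 0)
    (h1 : J (b 1) = -b 1) (g : V →ₗ[ℝ] V →ₗ[ℝ] ℝ) (hsymm : ∀ X Y, g X Y = g Y X)
    (hpos : ∃ X, 0 < g X X) (hgJ : ∀ X Y, g (J X) Y = -g X (J Y))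
    (B : V →ₗ[ℝ] V →ₗ[ℝ] ℝ) (hB : ∀ X Y, B X Y = -B Y X) :
    ∃ k : ℝ, ∀ X Y, B (J X) Y = k * g X Y := by
  have hself : ∀ X, B X X = 0 := fun X => eq_zero_of_eq_neg_self (hB X X)
  -- The eigenvectors of `J` are null, so `g` is determined by its one mixed value, and so is `B(J·,
  -- ·)`.
  have g0 : g (b 0) (b 0) = 0 := by
    have := hgJ (b 0) (b 0)
    rw [h0] at this
    linarith
  have g1 : g (b 1) (b 1) = 0 := by
    have := hgJ (b 1) (b 1)
    rw [h1, map_neg, map_neg, LinearMap.neg_apply] at this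
    linarith
  have g01 : g (b 0) (b 1) ≠ 0 := by
    intro h
    obtain ⟨X, hX⟩ := hpos
    rw [← b.sum_repr X] at hX
    simp only [Fin.sum_univ_two, map_add, map_smul, LinearMap.add_apply, LinearMap.smul_apply,
      g0, g1, h, hsymm (b 1) (b 0), smul_zero, add_zero, lt_irrefl] at hX
  refine ⟨B (b 0) (b 1) / g (b 0) (b 1), fun X Y => ?_⟩
  rw [← b.sum_repr X, ← b.sum_repr Y]
  simp only [Fin.sum_univ_two, map_add, map_smul, h0, h1, LinearMap.add_apply,
    LinearMap.smul_apply, hself, map_neg, hB (b 1) (b 0), g0, g1, hsymm (b 1) (b 0),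
    LinearMap.neg_apply, smul_eq_mul]
  field_simp
  ring

theorem det_involution (b : Module.Basis (Fin 2) ℝ V) {J : V →ₗ[ℝ] V} (h0 : J (b 0) = b 0)
    (h1 : J (b 1) = -b 1) : LinearMap.det J = -1 := by
  rw [← LinearMap.det_toMatrix b, Matrix.det_fin_two]
  simp [LinearMap.toMatrix_apply, h0, h1]

end HodgeAlgebra

theorem commutator_smul_add_smul (k l : ℂ) (a b a' b' : EndC3) :
    (k • a + l • a') * (k • b + l • b') - (k • b + l • b') * (k • a + l • a') =
      k ^ 2 • (a * b - b * a) + (k * l) • (a * b' - b' * a) + (k * l) • (a' * b - b * a')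
        + l ^ 2 • (a' * b' - b' * a') := by
  ext1 v
  change (k • a (k • b v + l • b' v) + l • a' (k • b v + l • b' v))
      - (k • b (k • a v + l • a' v) + l • b' (k • a v + l • a' v))
    = k ^ 2 • (a (b v) - b (a v)) + (k * l) • (a (b' v) - b' (a v))
      + (k * l) • (a' (b v) - b (a' v)) + l ^ 2 • (a' (b' v) - b' (a' v))
  simp only [map_add, map_smul]
  module

/-! ### Harmonic maps and flatness of the associated connections. -/

section Harmonic

variable {M : Type*} [TopologicalSpace M] [ChartedSpace Plane M]

namespace LorentzConformalStructure

variable (c : LorentzConformalStructure M)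

/-- The representative metric as a bilinear form. -/
noncomputable def metricForm (p : M) :
    TangentSpace 𝓘(ℝ, Plane) p →ₗ[ℝ] TangentSpace 𝓘(ℝ, Plane) p →ₗ[ℝ] ℝ :=
  LinearMap.mk₂ ℝ (fun X Y => c.metric p X Y)
    (fun X Y Z => by rw [map_add]; rfl) (fun k X Y => by rw [map_smul]; rfl)
    (fun X Y Z => map_add _ _ _) (fun k X Y => map_smul _ _ _)

/-- The Hodge star as a linear endomorphism of the tangent plane. -/
noncomputable def hodgeMap (p : M) :
    TangentSpace 𝓘(ℝ, Plane) p →ₗ[ℝ] TangentSpace 𝓘(ℝ, Plane) p := (c.hodge p).toLinearMap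

theorem finrank_tangentSpace (p : M) : Module.finrank ℝ (TangentSpace 𝓘(ℝ, Plane) p) = 2 :=
  finrank_euclideanSpace_fin (𝕜 := ℝ) (n := 2)

theorem exists_basis (p : M) : ∃ b : Module.Basis (Fin 2) ℝ (TangentSpace 𝓘(ℝ, Plane) p),
    c.hodgeMap p (b 0) = b 0 ∧ c.hodgeMap p (b 1) = -b 1 :=
  exists_null_basis (finrank_tangentSpace p) (c.metricForm p) (c.hodgeMap p) (c.exists_pos p)
    (c.hodge_hodge p) (c.metric_hodge p)

theorem skew_hodge {G : Type*} [AddCommGroup G] [Module ℝ G] (p : M)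
    (B : TangentSpace 𝓘(ℝ, Plane) p →ₗ[ℝ] TangentSpace 𝓘(ℝ, Plane) p →ₗ[ℝ] G)
    (hB : ∀ X Y, B X Y = -B Y X) (X Y : TangentSpace 𝓘(ℝ, Plane) p) :
    B X (c.hodge p Y) = B Y (c.hodge p X) := by
  obtain ⟨b, h0, h1⟩ := c.exists_basis p
  exact skew_comp_involution b h0 h1 B hB X Y

/-- A skew form satisfies `B(JX, Y) + B(X, JY) = tr(J) B(X, Y)`, and `J` is trace-free. Hence the
wedge of `A` with `*A` under the cross product vanishes. -/
theorem cross_hodge {p : M} (A : TangentSpace 𝓘(ℝ, Plane) p →L[ℝ] R3)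
    (X Y : TangentSpace 𝓘(ℝ, Plane) p) :
    cross (A X) (A (c.hodge p Y)) = cross (A Y) (A (c.hodge p X)) := by
  let B : TangentSpace 𝓘(ℝ, Plane) p →ₗ[ℝ] TangentSpace 𝓘(ℝ, Plane) p →ₗ[ℝ] R3 :=
    LinearMap.mk₂ ℝ (fun X Y => crossR (A X) (A Y))
      (fun X Y Z => by simp only [map_add, _root_.add_apply])
      (fun k X Y => by simp only [map_smul, _root_.smul_apply])
      (fun X Y Z => by simp only [map_add]) (fun k X Y => by simp only [map_smul])
  exact c.skew_hodge p B (fun X Y => cross_swap _ _) X Y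

end LorentzConformalStructure

theorem dmap_inner {f g : M → R3} {p : M} (hf : MDifferentiableAt 𝓘(ℝ, Plane) 𝓘(ℝ, R3) f p)
    (hg : MDifferentiableAt 𝓘(ℝ, Plane) 𝓘(ℝ, R3) g p) {k : ℝ}
    (h : ∀ q, inner ℝ (f q) (g q) = k) (X : TangentSpace 𝓘(ℝ, Plane) p) :
    inner ℝ (f p) (dmap g p X) + inner ℝ (g p) (dmap f p X) = 0 := by
  have h1 := dmap_bilin (innerSL ℝ : R3 →L[ℝ] R3 →L[ℝ] ℝ) hf hg X
  have h2 : (fun q => (innerSL ℝ : R3 →L[ℝ] R3 →L[ℝ] ℝ) (f q) (g q)) = fun _ => k := funext h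
  rw [h2, dmap_const] at h1
  rw [real_inner_comm (dmap f p X)]
  exact h1.symm

theorem IsHarmonic.mdifferentiableAt {c : LorentzConformalStructure M} {N : M → R3}
    (h : IsHarmonic c N) (p : M) : MDifferentiableAt 𝓘(ℝ, Plane) 𝓘(ℝ, R3) N p :=
  h.smooth.mdifferentiable (by simp) p

theorem IsHarmonic.inner_self {c : LorentzConformalStructure M} {N : M → R3}
    (h : IsHarmonic c N) (p : M) : inner ℝ (N p) (N p) = (1 : ℝ) := by
  rw [real_inner_self_eq_norm_sq, h.unit, one_pow]

theorem IsHarmonic.inner_dmap {c : LorentzConformalStructure M} {N : M → R3}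
    (h : IsHarmonic c N) (p : M) (X : TangentSpace 𝓘(ℝ, Plane) p) :
    inner ℝ (N p) (dmap N p X) = (0 : ℝ) := by
  have := dmap_inner (h.mdifferentiableAt p) (h.mdifferentiableAt p) h.inner_self X
  linarith

/-- The bilinear map `(n, v) ↦ (u ↦ (n × v) × u)`. -/
noncomputable def crossCrossB : R3 →L[ℝ] R3 →L[ℝ] EndC3 :=
  (ContinuousLinearMap.compL ℝ R3 R3 EndC3 crossEndR).comp crossR

theorem crossCrossB_apply (n v : R3) : crossCrossB n v = crossEndR (cross n v) := rfl

theorem offDiag_eq (N : M → R3) : offDiag N = bilinForm crossCrossB N (dmap N) := rfl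

theorem offDiag_apply (N : M → R3) (p : M) (X : TangentSpace 𝓘(ℝ, Plane) p) :
    offDiag N p X = crossEndR (cross (N p) (dmap N p X)) := rfl

theorem hodgeStar_offDiag_eq (c : LorentzConformalStructure M) (N : M → R3) :
    hodgeStar c (offDiag N) = bilinForm crossCrossB N (hodgeStar c (dmap N)) := rfl

/-- Collecting the two star-eigenparts leaves a combination of `N × dN` and its star with constant
coefficients, so that the exterior derivative can be taken term by term. -/
theorem assocForm_eq (c : LorentzConformalStructure M) (N : M → R3) (z : ℂ) :
    assocForm c N z = fun p =>
      (((z + z⁻¹) / 2 - 1) • ContinuousLinearMap.id ℝ EndC3).comp (offDiag N p)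
      + (((z - z⁻¹) / 2) • ContinuousLinearMap.id ℝ EndC3).comp (hodgeStar c (offDiag N) p) := by
  funext p
  ext1 X
  change -offDiag N p X + z • (1 / 2 : ℂ) • (offDiag N p X + hodgeStar c (offDiag N) p X)
      + z⁻¹ • (1 / 2 : ℂ) • (offDiag N p X - hodgeStar c (offDiag N) p X)
    = ((z + z⁻¹) / 2 - 1) • offDiag N p X + ((z - z⁻¹) / 2) • hodgeStar c (offDiag N) p X
  module

theorem assocForm_apply (c : LorentzConformalStructure M) (N : M → R3) (z : ℂ) (p : M)
    (X : TangentSpace 𝓘(ℝ, Plane) p) : assocForm c N z p X =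
      ((z + z⁻¹) / 2 - 1) • offDiag N p X + ((z - z⁻¹) / 2) • offDiag N p (c.hodge p X) := by
  rw [assocForm_eq]
  rfl

variable [IsManifold 𝓘(ℝ, Plane) ∞ M]

/-- The Leibniz term pairing `dN` with `*dN` vanishes by `cross_hodge`. Thus the tension condition
is closedness of `N × *dN`, the form in which harmonicity is transferred to the transform. -/
theorem extD_cross_hodgeStar (c : LorentzConformalStructure M) {N : M → R3}
    (hN : ContMDiff 𝓘(ℝ, Plane) 𝓘(ℝ, R3) ∞ N) (p : M) (X Y : TangentSpace 𝓘(ℝ, Plane) p) :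
    extD (bilinForm crossR N (hodgeStar c (dmap N))) p X Y =
      cross (N p) (extD (hodgeStar c (dmap N)) p X Y) := by
  rw [extD_bilinForm crossR (hN.mdifferentiable (by simp) p)
    (formDiffAt_hodgeStar c (formDiffAt_dmap hN p))]
  have h := c.cross_hodge (dmap N p) X Y
  change cross _ (dmap N p (c.hodge p Y)) - cross _ (dmap N p (c.hodge p X)) + _ = _
  rw [h, sub_self, zero_add]
  rfl

/-- Since `d² N = 0`, only the product of `dN` with itself remains; antisymmetry of the cross
product counts it twice. -/
theorem IsHarmonic.extD_offDiag {c : LorentzConformalStructure M} {N : M → R3}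
    (h : IsHarmonic c N) (p : M) (X Y : TangentSpace 𝓘(ℝ, Plane) p) :
    extD (offDiag N) p X Y = (2 : ℂ) • crossEndR (cross (dmap N p X) (dmap N p Y)) := by
  rw [offDiag_eq, extD_bilinForm _ (h.mdifferentiableAt p) (formDiffAt_dmap h.smooth p),
    extD_dmap h.smooth, map_zero, add_zero, crossCrossB_apply, crossCrossB_apply,
    cross_swap (dmap N p Y), map_neg]
  module

theorem IsHarmonic.extD_hodgeStar_offDiag {c : LorentzConformalStructure M} {N : M → R3}
    (h : IsHarmonic c N) (p : M) (X Y : TangentSpace 𝓘(ℝ, Plane) p) :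
    extD (hodgeStar c (offDiag N)) p X Y = 0 := by
  rw [hodgeStar_offDiag_eq, extD_bilinForm _ (h.mdifferentiableAt p)
    (formDiffAt_hodgeStar c (formDiffAt_dmap h.smooth p)), crossCrossB_apply, crossCrossB_apply,
    crossCrossB_apply, h.tension, map_zero, add_zero, sub_eq_zero]
  exact congrArg crossEndR (c.cross_hodge (dmap N p) X Y)

theorem IsHarmonic.offDiag_commutator {c : LorentzConformalStructure M} {N : M → R3}
    (h : IsHarmonic c N) (p : M) (X Y : TangentSpace 𝓘(ℝ, Plane) p) :
    offDiag N p X * offDiag N p Y - offDiag N p Y * offDiag N p X =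
      crossEndR (cross (dmap N p X) (dmap N p Y)) := by
  rw [offDiag_apply, offDiag_apply, crossEndR_commutator,
    cross_quarterTurn (h.inner_self p) (h.inner_dmap p X) (h.inner_dmap p Y)]

/-- Write the form as `(P - 1) n + Q *n` with `P = (z + z⁻¹)/2`, `Q = (z - z⁻¹)/2`, and let `K` be
`dN(X) × dN(Y)`. Then `dn = 2K`, `d*n = 0`, the commutators of `n` and of `*n` are `K` and `-K`, and
the mixed ones cancel. The curvature is `2(P - 1) + (P - 1)² - Q² = P² - Q² - 1 = 0` times `K`. -/
theorem IsHarmonic.isFlat_assocForm {c : LorentzConformalStructure M} {N : M → R3}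
    (h : IsHarmonic c N) {z : ℂ} (hz : z ≠ 0) : IsFlat (assocForm c N z) := by
  intro p X Y
  have hd1 : FormDiffAt (offDiag N) p := by
    rw [offDiag_eq]
    exact formDiffAt_bilinForm _ (h.mdifferentiableAt p) (formDiffAt_dmap h.smooth p)
  have hd2 : FormDiffAt (hodgeStar c (offDiag N)) p := formDiffAt_hodgeStar c hd1
  have hext : extD (assocForm c N z) p X Y = ((z + z⁻¹) - 2) •
      crossEndR (cross (dmap N p X) (dmap N p Y)) := by
    rw [assocForm_eq, extD_add (hd1.clm _) (hd2.clm _), extD_clm hd1, extD_clm hd2,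
      h.extD_hodgeStar_offDiag, map_zero, add_zero, h.extD_offDiag]
    change ((z + z⁻¹) / 2 - 1) • (2 : ℂ) • (crossEndR (cross (dmap N p X) (dmap N p Y))) = _
    module
  have hJ : cross (dmap N p (c.hodge p X)) (dmap N p (c.hodge p Y)) =
      -cross (dmap N p X) (dmap N p Y) := by
    have h1 := c.cross_hodge (dmap N p) (c.hodge p X) Y
    rw [c.hodge_hodge] at h1
    rw [h1, cross_swap]
  have hmix : cross (dmap N p X) (dmap N p (c.hodge p Y)) =
      -cross (dmap N p (c.hodge p X)) (dmap N p Y) := by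
    rw [c.cross_hodge, cross_swap]
  have e := h.offDiag_commutator p
  rw [hext, assocForm_apply, assocForm_apply]
  have e1 := e X Y
  have e2 := e X (c.hodge p Y)
  have e3 := e (c.hodge p X) Y
  have e4 := e (c.hodge p X) (c.hodge p Y)
  rw [hJ, map_neg] at e4
  rw [hmix, map_neg] at e2
  have hPQ : ((z + z⁻¹) / 2) ^ 2 - ((z - z⁻¹) / 2) ^ 2 = 1 := by field_simp; ring
  set P := (z + z⁻¹) / 2
  set Q := (z - z⁻¹) / 2
  have hP : z + z⁻¹ = 2 * P := by simp only [P]; ring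
  rw [hP]
  have hPQ' : Q ^ 2 = P ^ 2 - 1 := by linear_combination -hPQ
  rw [commutator_smul_add_smul, e1, e2, e3, e4, hPQ']
  module

end Harmonic

/-! ### Curvature and second fundamental form of a potential. -/

section Surface

variable {M : Type*} [TopologicalSpace M] [ChartedSpace Plane M]

/-- A surface with `df = N × *dN`, described by a frame adapted to `N`: where it immerses, its
Gauss curvature is `-1`, its second fundamental form spans the conformal structure, and its
differential maps onto the orthogonal complement of `N`. -/
theorem surface_of_isPotentialAt (c : LorentzConformalStructure M) {N f : M → R3} {p : M}
    {t w : R3} (hfr : IsOrthoFrame (N p) t w) (hf : IsPotentialAt c N f p)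
    (hN : ∀ X, inner ℝ (N p) (dmap N p X) = (0 : ℝ)) (him : ImmersesAt f p) :
    HasGaussMapAndCurvatureAt f N p (-1) ∧ SecondFormSpansAt c f N p ∧
      ∀ k : ℝ, ∃ X, dmap f p X = k • w := by
  let α : TangentSpace 𝓘(ℝ, Plane) p →ₗ[ℝ] ℝ := ((innerSL ℝ t).comp (dmap N p)).toLinearMap
  let β : TangentSpace 𝓘(ℝ, Plane) p →ₗ[ℝ] ℝ := ((innerSL ℝ w).comp (dmap N p)).toLinearMap
  let J := c.hodgeMap p
  have hJJ : ∀ X, J (J X) = X := c.hodge_hodge p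
  have hdN : ∀ X, dmap N p X = α X • t + β X • w := by
    intro X
    have := hfr.decomp (dmap N p X)
    rw [hN, zero_smul, zero_add] at this
    exact this
  have hdf : ∀ X, dmap f p X = α (J X) • w - β (J X) • t := by
    intro X
    rw [hf X]
    change cross (N p) (dmap N p (J X)) = _
    rw [hdN, ← crossR_apply, map_add, map_smul, map_smul, crossR_apply, crossR_apply,
      hfr.cross_n_t, cross_swap (N p) w, hfr.cross_w_n]
    module
  -- Up to `J`, the pair `(α, β)` is the differential of `f` in the basis `w, -t`, so immersing
  -- means that `α` and `β` are coordinates on the tangent plane.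
  have hinj : Function.Injective (α.prod β) := by
    rw [injective_iff_map_eq_zero]
    intro X hX
    have h1 : α X = 0 := congrArg Prod.fst hX
    have h2 : β X = 0 := congrArg Prod.snd hX
    have h3 : dmap f p (J X) = 0 := by rw [hdf, hJJ, h1, h2]; simp
    have h4 : J X = 0 := him (h3.trans (map_zero _).symm)
    rw [← hJJ X, h4, map_zero]
  let Φ : TangentSpace 𝓘(ℝ, Plane) p ≃ₗ[ℝ] ℝ × ℝ :=
    LinearEquiv.ofBijective (α.prod β) ⟨hinj, by
      have : FiniteDimensional ℝ (TangentSpace 𝓘(ℝ, Plane) p) :=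
        inferInstanceAs (FiniteDimensional ℝ Plane)
      exact (LinearMap.injective_iff_surjective_of_finrank_eq_finrank (by
        rw [LorentzConformalStructure.finrank_tangentSpace]; simp)).1 hinj⟩
  have hα : ∀ x, α (Φ.symm x) = x.1 := fun x => congrArg Prod.fst (Φ.apply_symm_apply x)
  have hβ : ∀ x, β (Φ.symm x) = x.2 := fun x => congrArg Prod.snd (Φ.apply_symm_apply x)
  obtain ⟨b, hb0, hb1⟩ := c.exists_basis p
  refine ⟨⟨him, ?_, ?_, ?_⟩, ?_, ?_⟩
  · rw [← sq_eq_sq₀ (norm_nonneg _) zero_le_one, one_pow, ← real_inner_self_eq_norm_sq, hfr.n_n]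
  · intro X
    rw [hdf, inner_sub_right, inner_smul_right, inner_smul_right, hfr.n_w, hfr.n_t]
    simp
  -- `df` is `dN` composed with `J`, followed by a quarter turn about `N`. The shape operator is
  -- therefore `J` times a conjugate of the quarter turn `R`, with determinant `(-1)·1`.
  · let R : ℝ × ℝ →ₗ[ℝ] ℝ × ℝ := (-LinearMap.snd ℝ ℝ ℝ).prod (LinearMap.fst ℝ ℝ ℝ)
    have hR : LinearMap.det R = 1 := by
      rw [← LinearMap.det_toMatrix (Module.Basis.finTwoProd ℝ), Matrix.det_fin_two]
      simp [LinearMap.toMatrix_apply, R]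
    refine ⟨J ∘ₗ (Φ.symm.toLinearMap ∘ₗ R ∘ₗ Φ.symm.symm.toLinearMap), fun X => ?_, ?_⟩
    · change dmap f p (J (Φ.symm (R (Φ X)))) = _
      rw [hdf, hJJ, hα, hβ, hdN]
      change (-β X) • w - α X • t = _
      module
    · rw [LinearMap.det_comp, LinearMap.det_conj, hR, mul_one]
      exact det_involution b hb0 hb1
  -- The second fundamental form is `B(J·, ·)` for the area form `B` of the coordinates `α, β`,
  -- hence proportional to the metric; it is non-zero because `B` takes the value `-1` on the dual
  -- basis.
  · let B : TangentSpace 𝓘(ℝ, Plane) p →ₗ[ℝ] TangentSpace 𝓘(ℝ, Plane) p →ₗ[ℝ] ℝ :=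
      LinearMap.mk₂ ℝ (fun X Y => β X * α Y - α X * β Y)
        (fun X Y Z => by simp only [map_add]; ring)
        (fun k X Y => by simp only [map_smul, smul_eq_mul]; ring)
        (fun X Y Z => by simp only [map_add]; ring)
        (fun k X Y => by simp only [map_smul, smul_eq_mul]; ring)
    have hB : ∀ X Y, B X Y = β X * α Y - α X * β Y := fun X Y => rfl
    obtain ⟨k, hk⟩ := exists_proportional b hb0 hb1 (c.metricForm p) (c.symm p) (c.exists_pos p)
      (c.metric_hodge p) B (fun X Y => by rw [hB, hB]; ring)
    refine ⟨k, ?_, fun X Y => ?_⟩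
    · rintro rfl
      have h1 := hk (J (Φ.symm (1, 0))) (Φ.symm (0, 1))
      change B (J (J _)) _ = _ at h1
      rw [hJJ, hB, hα, hβ, hα, hβ] at h1
      norm_num at h1
    · have h2 := hk X Y
      change B (J X) Y = k * c.metric p X Y at h2
      rw [← h2, hB, secondForm, hdf, hdN]
      simp only [inner_sub_left, inner_add_right, inner_smul_left, inner_smul_right, hfr.t_t,
        hfr.w_w, hfr.t_w, real_inner_comm t w]
      simp
      ring
  · intro k
    refine ⟨J (Φ.symm (k, 0)), ?_⟩
    rw [hdf, hJJ, hα, hβ]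
    simp

end Surface

/-! ### Moving frames and the associated connections in them. -/

section SmoothFrame

variable {M : Type*} [TopologicalSpace M] [ChartedSpace Plane M]

/-- Three smooth vector fields forming a positively oriented orthonormal frame of `ℝ³`. -/
structure IsSmoothFrame (N t w : M → R3) : Prop where
  smooth_n : ContMDiff 𝓘(ℝ, Plane) 𝓘(ℝ, R3) ∞ N
  smooth_t : ContMDiff 𝓘(ℝ, Plane) 𝓘(ℝ, R3) ∞ t
  smooth_w : ContMDiff 𝓘(ℝ, Plane) 𝓘(ℝ, R3) ∞ w
  ortho : ∀ p, IsOrthoFrame (N p) (t p) (w p)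

/-- The component `e · df` of the differential of `f`. -/
noncomputable def coef (e f : M → R3) (p : M) (X : TangentSpace 𝓘(ℝ, Plane) p) : ℝ :=
  inner ℝ (e p) (dmap f p X)

/-- The one-form `z θ⁺ + z⁻¹ θ⁻`, where `θ = e · df`. -/
noncomputable def coefZ (c : LorentzConformalStructure M) (z : ℂ) (e f : M → R3) (p : M)
    (X : TangentSpace 𝓘(ℝ, Plane) p) : ℂ :=
  (z + z⁻¹) / 2 * coef e f p X + (z - z⁻¹) / 2 * coef e f p (c.hodge p X)

theorem mdifferentiableAt_cx {f : M → R3} {p : M}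
    (hf : MDifferentiableAt 𝓘(ℝ, Plane) 𝓘(ℝ, R3) f p) :
    MDifferentiableAt 𝓘(ℝ, Plane) 𝓘(ℝ, C3) (fun q => cx (f q)) p :=
  cxL.differentiableAt.mdifferentiableAt.comp p hf

theorem contMDiffAt_cx {f : M → R3} {p : M}
    (hf : ContMDiffAt 𝓘(ℝ, Plane) 𝓘(ℝ, R3) ∞ f p) :
    ContMDiffAt 𝓘(ℝ, Plane) 𝓘(ℝ, C3) ∞ (fun q => cx (f q)) p := contMDiffAt_clm cxL hf

theorem dmap_const_smul {f : M → R3} {p : M} (k : ℝ)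
    (hf : MDifferentiableAt 𝓘(ℝ, Plane) 𝓘(ℝ, R3) f p) (X : TangentSpace 𝓘(ℝ, Plane) p) :
    dmap (fun q => k • f q) p X = k • dmap f p X :=
  dmap_clm (k • ContinuousLinearMap.id ℝ R3) hf X

theorem mdifferentiableAt_const_smul {f : M → R3} {p : M} (k : ℝ)
    (hf : MDifferentiableAt 𝓘(ℝ, Plane) 𝓘(ℝ, R3) f p) :
    MDifferentiableAt 𝓘(ℝ, Plane) 𝓘(ℝ, R3) (fun q => k • f q) p :=
  (k • ContinuousLinearMap.id ℝ R3).differentiableAt.mdifferentiableAt.comp p hf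

theorem contMDiff_lincomb {f g : M → R3} (k l : ℝ) (hf : ContMDiff 𝓘(ℝ, Plane) 𝓘(ℝ, R3) ∞ f)
    (hg : ContMDiff 𝓘(ℝ, Plane) 𝓘(ℝ, R3) ∞ g) :
    ContMDiff 𝓘(ℝ, Plane) 𝓘(ℝ, R3) ∞ (fun q => k • f q + l • g q) := fun p =>
  (contMDiffAt_clm (k • ContinuousLinearMap.id ℝ R3) (hf p)).add
    (contMDiffAt_clm (l • ContinuousLinearMap.id ℝ R3) (hg p))

theorem dmap_lincomb {f g : M → R3} {p : M} (k l : ℝ)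
    (hf : MDifferentiableAt 𝓘(ℝ, Plane) 𝓘(ℝ, R3) f p)
    (hg : MDifferentiableAt 𝓘(ℝ, Plane) 𝓘(ℝ, R3) g p) (X : TangentSpace 𝓘(ℝ, Plane) p) :
    dmap (fun q => k • f q + l • g q) p X = k • dmap f p X + l • dmap g p X := by
  rw [dmap_add (mdifferentiableAt_const_smul k hf) (mdifferentiableAt_const_smul l hg)]
  exact congrArg₂ (· + ·) (dmap_const_smul k hf X) (dmap_const_smul l hg X)

namespace IsSmoothFrame

variable {N t w : M → R3}

theorem mdiff_n (h : IsSmoothFrame N t w) (p : M) :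
    MDifferentiableAt 𝓘(ℝ, Plane) 𝓘(ℝ, R3) N p := h.smooth_n.mdifferentiable (by simp) p

theorem mdiff_t (h : IsSmoothFrame N t w) (p : M) :
    MDifferentiableAt 𝓘(ℝ, Plane) 𝓘(ℝ, R3) t p := h.smooth_t.mdifferentiable (by simp) p

theorem mdiff_w (h : IsSmoothFrame N t w) (p : M) :
    MDifferentiableAt 𝓘(ℝ, Plane) 𝓘(ℝ, R3) w p := h.smooth_w.mdifferentiable (by simp) p

theorem coef_n_n (h : IsSmoothFrame N t w) (p : M) (X : TangentSpace 𝓘(ℝ, Plane) p) :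
    inner ℝ (N p) (dmap N p X) = (0 : ℝ) := by
  have := dmap_inner (h.mdiff_n p) (h.mdiff_n p) (fun q => (h.ortho q).n_n) X
  linarith

theorem dmap_n (h : IsSmoothFrame N t w) (p : M) (X : TangentSpace 𝓘(ℝ, Plane) p) :
    dmap N p X = coef t N p X • t p + coef w N p X • w p := by
  have h1 := (h.ortho p).decomp (dmap N p X)
  rwa [h.coef_n_n, zero_smul, zero_add] at h1

theorem dmap_t (h : IsSmoothFrame N t w) (p : M) (X : TangentSpace 𝓘(ℝ, Plane) p) :
    dmap t p X = -coef t N p X • N p + coef w t p X • w p := by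
  have h1 := (h.ortho p).decomp (dmap t p X)
  have h2 := dmap_inner (h.mdiff_t p) (h.mdiff_t p) (fun q => (h.ortho q).t_t) X
  have h3 := dmap_inner (h.mdiff_n p) (h.mdiff_t p) (fun q => (h.ortho q).n_t) X
  have h4 : inner ℝ (t p) (dmap t p X) = (0 : ℝ) := by linarith
  have h5 : inner ℝ (N p) (dmap t p X) = -coef t N p X := by rw [coef]; linarith
  rwa [h4, h5, zero_smul, add_zero] at h1

theorem dmap_w (h : IsSmoothFrame N t w) (p : M) (X : TangentSpace 𝓘(ℝ, Plane) p) :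
    dmap w p X = -coef w N p X • N p - coef w t p X • t p := by
  have h1 := (h.ortho p).decomp (dmap w p X)
  have h2 := dmap_inner (h.mdiff_w p) (h.mdiff_w p) (fun q => (h.ortho q).w_w) X
  have h3 := dmap_inner (h.mdiff_n p) (h.mdiff_w p) (fun q => (h.ortho q).n_w) X
  have h4 := dmap_inner (h.mdiff_t p) (h.mdiff_w p) (fun q => (h.ortho q).t_w) X
  have h5 : inner ℝ (w p) (dmap w p X) = (0 : ℝ) := by linarith
  have h6 : inner ℝ (N p) (dmap w p X) = -coef w N p X := by rw [coef]; linarith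
  have h7 : inner ℝ (t p) (dmap w p X) = -coef w t p X := by rw [coef]; linarith
  rw [h5, h6, h7] at h1
  rw [h1]
  module

theorem cross_dmap_n (h : IsSmoothFrame N t w) (p : M) (X : TangentSpace 𝓘(ℝ, Plane) p) :
    cross (N p) (dmap N p X) = coef t N p X • w p - coef w N p X • t p := by
  rw [h.dmap_n, ← crossR_apply, map_add, map_smul, map_smul, crossR_apply, crossR_apply,
    (h.ortho p).cross_n_t, cross_swap (N p) (w p), (h.ortho p).cross_w_n]
  module

theorem assocForm_apply_apply (h : IsSmoothFrame N t w) (c : LorentzConformalStructure M) (z : ℂ)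
    (p : M) (X : TangentSpace 𝓘(ℝ, Plane) p) (v : C3) :
    assocForm c N z p X v =
      (coefZ c z t N p X - coef t N p X) • crossProduct (cx (w p)) v
        - (coefZ c z w N p X - coef w N p X) • crossProduct (cx (t p)) v := by
  rw [assocForm_apply, offDiag_apply, offDiag_apply, h.cross_dmap_n, h.cross_dmap_n]
  change ((z + z⁻¹) / 2 - 1) • crossProduct (cx _) v + ((z - z⁻¹) / 2) • crossProduct (cx _) v = _
  simp only [cx_sub, cx_smul, map_sub, map_smul, LinearMap.sub_apply, LinearMap.smul_apply, coefZ]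
  module

/-- The structure equations of the frame: `z` enters only through the forms `t·dN` and `w·dN`, which
become `z θ⁺ + z⁻¹ θ⁻`. The form `w·dt`, rotating `N^⊥`, is unchanged. -/
theorem covD_n (h : IsSmoothFrame N t w) (c : LorentzConformalStructure M) (z : ℂ)
    (p : M) (X : TangentSpace 𝓘(ℝ, Plane) p) :
    covD (assocForm c N z) (fun q => cx (N q)) p X =
      coefZ c z t N p X • cx (t p) + coefZ c z w N p X • cx (w p) := by
  have h1 : dmap (fun q => cx (N q)) p X = cx (dmap N p X) := dmap_clm cxL (h.mdiff_n p) X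
  rw [covD, h1, h.assocForm_apply_apply, h.dmap_n, cx_crossProduct, cx_crossProduct,
    (h.ortho p).cross_w_n, cross_swap (t p), (h.ortho p).cross_n_t]
  simp only [cx_add, cx_neg, cx_smul]
  module

theorem covD_t (h : IsSmoothFrame N t w) (c : LorentzConformalStructure M) (z : ℂ)
    (p : M) (X : TangentSpace 𝓘(ℝ, Plane) p) :
    covD (assocForm c N z) (fun q => cx (t q)) p X =
      -coefZ c z t N p X • cx (N p) + (coef w t p X : ℂ) • cx (w p) := by
  have h1 : dmap (fun q => cx (t q)) p X = cx (dmap t p X) := dmap_clm cxL (h.mdiff_t p) X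
  rw [covD, h1, h.assocForm_apply_apply, h.dmap_t, cx_crossProduct, cross_self,
    cross_swap (w p), (h.ortho p).cross_t_w]
  simp only [cx_add, cx_neg, cx_smul, Complex.ofReal_neg]
  module

theorem covD_w (h : IsSmoothFrame N t w) (c : LorentzConformalStructure M) (z : ℂ)
    (p : M) (X : TangentSpace 𝓘(ℝ, Plane) p) :
    covD (assocForm c N z) (fun q => cx (w q)) p X =
      -coefZ c z w N p X • cx (N p) - (coef w t p X : ℂ) • cx (t p) := by
  have h1 : dmap (fun q => cx (w q)) p X = cx (dmap w p X) := dmap_clm cxL (h.mdiff_w p) X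
  rw [covD, h1, h.assocForm_apply_apply, h.dmap_w, cx_crossProduct (t p), cross_self,
    (h.ortho p).cross_t_w]
  simp only [cx_sub, cx_smul, Complex.ofReal_neg]
  module

theorem covD_combination (h : IsSmoothFrame N t w) (c : LorentzConformalStructure M) (z k : ℂ)
    (p : M) (X : TangentSpace 𝓘(ℝ, Plane) p) :
    covD (assocForm c N z) (fun q => cx (N q) + k • cx (t q)) p X =
      covD (assocForm c N z) (fun q => cx (N q)) p X
        + k • covD (assocForm c N z) (fun q => cx (t q)) p X := by
  have hk : MDifferentiableAt 𝓘(ℝ, Plane) 𝓘(ℝ, C3) (fun q => k • cx (t q)) p :=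
    mdifferentiableAt_smul (c := fun _ => k) mdifferentiableAt_const
      (mdifferentiableAt_cx (h.mdiff_t p))
  rw [covD_add (mdifferentiableAt_cx (h.mdiff_n p)) hk,
    covD_const_smul _ (mdifferentiableAt_cx (h.mdiff_t p))]

/-- The coefficient of `w` is the obstruction to the line of `N + it` being parallel. -/
theorem covD_add_I (h : IsSmoothFrame N t w) (c : LorentzConformalStructure M) (z : ℂ)
    (p : M) (X : TangentSpace 𝓘(ℝ, Plane) p) :
    covD (assocForm c N z) (fun q => cx (N q) + Complex.I • cx (t q)) p X =
      (-Complex.I * coefZ c z t N p X) • (cx (N p) + Complex.I • cx (t p))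
        + (coefZ c z w N p X + Complex.I * coef w t p X) • cx (w p) := by
  rw [h.covD_combination, h.covD_n, h.covD_t]
  linear_combination (norm := module) (Complex.I_mul_I * coefZ c z t N p X) • cx (t p)

theorem covD_sub_I (h : IsSmoothFrame N t w) (c : LorentzConformalStructure M) (z : ℂ)
    (p : M) (X : TangentSpace 𝓘(ℝ, Plane) p) :
    covD (assocForm c N z) (fun q => cx (N q) + (-Complex.I) • cx (t q)) p X =
      (Complex.I * coefZ c z t N p X) • (cx (N p) + (-Complex.I) • cx (t p))
        + (coefZ c z w N p X - Complex.I * coef w t p X) • cx (w p) := by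
  rw [h.covD_combination, h.covD_n, h.covD_t]
  linear_combination (norm := module) (Complex.I_mul_I * coefZ c z t N p X) • cx (t p)

/-- The rotation of a frame about its third vector. -/
theorem rotate (h : IsSmoothFrame N t w) {C S : ℝ} (hCS : C ^ 2 + S ^ 2 = 1) :
    IsSmoothFrame (fun p => C • N p + (-S) • t p) (fun p => C • t p + S • N p) w where
  smooth_n := contMDiff_lincomb C (-S) h.smooth_n h.smooth_t
  smooth_t := contMDiff_lincomb C S h.smooth_t h.smooth_n
  smooth_w := h.smooth_w
  ortho p := by
    have := (h.ortho p).rotate hCS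
    rwa [sub_eq_add_neg, ← neg_smul] at this

theorem coef_rotate_t_n (h : IsSmoothFrame N t w) {C S : ℝ} (hCS : C ^ 2 + S ^ 2 = 1) (p : M)
    (X : TangentSpace 𝓘(ℝ, Plane) p) :
    coef (fun p => C • t p + S • N p) (fun p => C • N p + (-S) • t p) p X = coef t N p X := by
  rw [coef, dmap_lincomb _ _ (h.mdiff_n p) (h.mdiff_t p), h.dmap_n, h.dmap_t]
  simp only [inner_add_left, inner_add_right, inner_smul_left, inner_smul_right, (h.ortho p).n_n,
    (h.ortho p).t_t, (h.ortho p).n_t, (h.ortho p).t_w, (h.ortho p).n_w,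
    real_inner_comm (N p) (t p)]
  simp
  linear_combination coef t N p X * hCS

theorem coef_rotate_w_n (h : IsSmoothFrame N t w) (C S : ℝ) (p : M)
    (X : TangentSpace 𝓘(ℝ, Plane) p) :
    coef w (fun p => C • N p + (-S) • t p) p X = C * coef w N p X - S * coef w t p X := by
  rw [coef, dmap_lincomb _ _ (h.mdiff_n p) (h.mdiff_t p), inner_add_right, inner_smul_right,
    inner_smul_right, coef, coef]
  ring

theorem coef_rotate_w_t (h : IsSmoothFrame N t w) (C S : ℝ) (p : M)
    (X : TangentSpace 𝓘(ℝ, Plane) p) :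
    coef w (fun p => C • t p + S • N p) p X = C * coef w t p X + S * coef w N p X := by
  rw [coef, dmap_lincomb _ _ (h.mdiff_t p) (h.mdiff_n p), inner_add_right, inner_smul_right,
    inner_smul_right, coef, coef]

end IsSmoothFrame

end SmoothFrame

/-! ### From a null line to an adapted real frame. -/

section NullFrame

namespace IsOrthoFrame

variable {n t w : R3}

theorem null_dot_self (h : IsOrthoFrame n t w) {k : ℂ} (hk : k ^ 2 = -1) :
    (cx n + k • cx t) ⬝ᵥ (cx n + k • cx t) = 0 := by
  simp only [add_dotProduct, dotProduct_add, smul_dotProduct, dotProduct_smul, cx_dotProduct,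
    h.n_n, h.t_t, h.n_t, real_inner_comm n t, smul_eq_mul]
  push_cast
  linear_combination hk

theorem null_dot_conj (h : IsOrthoFrame n t w) {k : ℂ} (hk : k ^ 2 = -1) :
    (cx n + k • cx t) ⬝ᵥ (cx n + (-k) • cx t) = 2 := by
  simp only [add_dotProduct, dotProduct_add, smul_dotProduct, dotProduct_smul, cx_dotProduct,
    h.n_n, h.t_t, h.n_t, real_inner_comm n t, smul_eq_mul]
  push_cast
  linear_combination -hk

theorem w_dot_null (h : IsOrthoFrame n t w) (k : ℂ) : cx w ⬝ᵥ (cx n + k • cx t) = 0 := by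
  simp only [dotProduct_add, dotProduct_smul, cx_dotProduct, real_inner_comm n w,
    real_inner_comm t w, h.n_w, h.t_w]
  simp

theorem null_linearIndependent (h : IsOrthoFrame n t w) {k : ℂ} (hk : k ^ 2 = -1) :
    LinearIndependent ℂ ![cx n + k • cx t, cx n + (-k) • cx t] := by
  have h1 := h.null_dot_conj hk
  have h0 : cx n + k • cx t ≠ 0 := by
    intro h0
    rw [h0, zero_dotProduct] at h1
    exact two_ne_zero h1.symm
  rw [LinearIndependent.pair_iff' h0]
  intro m hm
  rw [← hm, dotProduct_smul, h.null_dot_self hk, smul_zero] at h1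
  exact two_ne_zero h1.symm

theorem null_cross (h : IsOrthoFrame n t w) (k : ℂ) :
    crossProduct (cx n + k • cx t) (cx n + (-k) • cx t) = (-2 * k) • cx w := by
  have hself : ∀ a : R3, cx (cross a a) = 0 := fun a => by rw [← cx_crossProduct, cross_self]
  simp only [map_add, map_smul, LinearMap.add_apply, LinearMap.smul_apply, cx_crossProduct,
    hself, cross_swap t n, h.cross_n_t, cx_neg]
  module

theorem null_decomp (h : IsOrthoFrame n t w) {k : ℂ} (hk : k ^ 2 = -1) (v : C3) :
    v = (v ⬝ᵥ (cx n + (-k) • cx t) / 2) • (cx n + k • cx t)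
      + (v ⬝ᵥ (cx n + k • cx t) / 2) • (cx n + (-k) • cx t) + (v ⬝ᵥ cx w) • cx w := by
  have h1 := null_frame_decomp (h.null_dot_self hk) (h.null_dot_self (k := -k) (by rwa [neg_sq]))
    (by rw [h.null_dot_conj hk]; exact two_ne_zero) v
  rw [h.null_dot_conj hk, h.null_cross, dotProduct_smul, smul_smul] at h1
  have h2 : -((-2 * k) • (v ⬝ᵥ cx w)) / 2 ^ 2 * (-2 * k) = v ⬝ᵥ cx w := by
    rw [smul_eq_mul]
    linear_combination (-(v ⬝ᵥ cx w)) * hk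
  rwa [h2] at h1

end IsOrthoFrame

theorem star_cx_add_smul (n t : R3) (k : ℂ) :
    star (cx n + k • cx t) = cx n + (star k) • cx t := by
  rw [star_add, star_smul, star_cx, star_cx]

theorem conjLine_span (u : C3) :
    conjLine (Submodule.span ℂ {u}) = Submodule.span ℂ {star u} := by
  ext v
  change star v ∈ Submodule.span ℂ {u} ↔ _
  rw [Submodule.mem_span_singleton, Submodule.mem_span_singleton]
  constructor
  · rintro ⟨k, hk⟩
    exact ⟨star k, by rw [← star_smul, hk, star_star]⟩
  · rintro ⟨k, rfl⟩
    exact ⟨star k, by rw [star_smul, star_star]⟩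

/-- The imaginary part of a vector of `ℂ³`. -/
noncomputable def imL : C3 →L[ℝ] R3 :=
  LinearMap.toContinuousLinearMap
    { toFun := fun v => WithLp.toLp 2 fun i => (v i).im
      map_add' := fun x y => by ext i; simp
      map_smul' := fun k x => by ext i; simp }

theorem imL_apply (v : C3) (i : Fin 3) : imL v i = (v i).im := rfl

theorem imL_cx_add (n t : R3) : imL (cx n + Complex.I • cx t) = t := by
  ext i
  simp [imL_apply, cx]

/-- A null line that the reflection in `n^⊥` maps to its complex conjugate is spanned by
`n + i t` for a unit vector `t` orthogonal to `n`. -/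
theorem exists_normalized_null {n : R3} (hn : inner ℝ n n = (1 : ℝ)) {s : C3} (hs : s ≠ 0)
    (hss : s ⬝ᵥ s = 0)
    (hrefl : (Submodule.span ℂ {s}).map (reflC n) = conjLine (Submodule.span ℂ {s}))
    (hinf : Submodule.span ℂ {s} ⊓ conjLine (Submodule.span ℂ {s}) = ⊥) :
    s ⬝ᵥ cx n ≠ 0 ∧ ∃ t : R3, (s ⬝ᵥ cx n)⁻¹ • s = cx n + Complex.I • cx t ∧
      inner ℝ t t = (1 : ℝ) ∧ inner ℝ n t = (0 : ℝ) := by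
  have hmem : reflC n s ∈ conjLine (Submodule.span ℂ {s}) := by
    rw [← hrefl]
    exact Submodule.mem_map_of_mem (Submodule.mem_span_singleton_self s)
  obtain ⟨k, hk⟩ := Submodule.mem_span_singleton.1
    (show star (reflC n s) ∈ Submodule.span ℂ {s} from hmem)
  have hrs : reflC n s = s - (2 * (s ⬝ᵥ cx n)) • cx n := rfl
  rw [hrs, star_sub, star_smul, star_cx] at hk
  have h0 : s ⬝ᵥ cx n ≠ 0 := by
    intro h0
    rw [h0, mul_zero, star_zero, zero_smul, sub_zero] at hk
    have h1 : s ∈ conjLine (Submodule.span ℂ {s}) :=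
      Submodule.mem_span_singleton.2 ⟨k, hk⟩
    have h2 : s ∈ Submodule.span ℂ {s} ⊓ conjLine (Submodule.span ℂ {s}) :=
      ⟨Submodule.mem_span_singleton_self s, h1⟩
    rw [hinf, Submodule.mem_bot] at h2
    exact hs h2
  refine ⟨h0, imL ((s ⬝ᵥ cx n)⁻¹ • s), ?_⟩
  set m := s ⬝ᵥ cx n with hm
  set u := m⁻¹ • s with hu
  have hnn : cx n ⬝ᵥ cx n = 1 := by rw [cx_dotProduct, hn, Complex.ofReal_one]
  have hun : u ⬝ᵥ cx n = 1 := by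
    rw [hu, smul_dotProduct, ← hm, smul_eq_mul, inv_mul_cancel₀ h0]
  have huu : u ⬝ᵥ u = 0 := by
    rw [hu, smul_dotProduct, dotProduct_smul, hss, smul_zero, smul_zero]
  have hsu : s = m • u := by rw [hu, smul_smul, mul_inv_cancel₀ h0, one_smul]
  have hstar : star u ⬝ᵥ cx n = 1 := by
    rw [← star_cx n, Matrix.star_dotProduct_star, dotProduct_comm, hun, star_one]
  have hsm : star m ≠ 0 := star_ne_zero.2 h0
  have hk2 : (star m)⁻¹ • ((k * m) • u) = star u - (2 : ℂ) • cx n := by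
    rw [mul_smul, ← hsu, hk, hsu, star_smul, smul_sub, smul_smul, inv_mul_cancel₀ hsm, one_smul,
      smul_smul]
    have h2 : star (2 * m) = 2 * star m := by simp
    rw [h2]
    congr 2
    field_simp
  rw [smul_smul] at hk2
  -- Pairing with `n` fixes the factor: `1 - 2 = -1`. Hence `u + ū = 2n`, so the real part of `u` is
  -- `n`; the two real equations in `u·u = 0` then say that the imaginary part is unit and
  -- orthogonal to `n`.
  have hc : (star m)⁻¹ * (k * m) = -1 := by
    have h1 := congrArg (fun x => x ⬝ᵥ cx n) hk2
    simp only [smul_dotProduct, sub_dotProduct, hun, hstar, hnn, smul_eq_mul] at h1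
    linear_combination h1
  rw [hc] at hk2
  have hre : ∀ i, (u i).re = n i := by
    intro i
    have h1 := congrArg Complex.re (congrFun hk2 i)
    simp [cx] at h1
    linarith
  have hudec : u = cx n + Complex.I • cx (imL u) := by
    ext i
    apply Complex.ext
    · simp [cx, hre, imL_apply]
    · simp [cx, imL_apply]
  refine ⟨hudec, ?_⟩
  rw [hudec] at huu
  simp only [add_dotProduct, dotProduct_add, smul_dotProduct, dotProduct_smul, cx_dotProduct,
    hn, real_inner_comm n (imL u), smul_eq_mul] at huu
  generalize (inner ℝ n (imL u) : ℝ) = x at huu ⊢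
  generalize (inner ℝ (imL u) (imL u) : ℝ) = y at huu ⊢
  have h1 := congrArg Complex.re huu
  have h2 := congrArg Complex.im huu
  simp at h1 h2
  constructor <;> linarith

variable {M : Type*} [TopologicalSpace M] [ChartedSpace Plane M]

/-- The smooth frame adapted to a null line subbundle that the reflection in `N^⊥` maps to its
complex conjugate. -/
theorem exists_smoothFrame {N : M → R3} (hN : ContMDiff 𝓘(ℝ, Plane) 𝓘(ℝ, R3) ∞ N)
    (hunit : ∀ p, inner ℝ (N p) (N p) = (1 : ℝ)) {L : M → Submodule ℂ C3}
    (hL : IsNullLineSubbundle L) (hrefl : ∀ p, (L p).map (reflC (N p)) = conjLine (L p))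
    (hinf : ∀ p, L p ⊓ conjLine (L p) = ⊥) :
    ∃ t w : M → R3, IsSmoothFrame N t w ∧
      (∀ p, L p = Submodule.span ℂ {cx (N p) + Complex.I • cx (t p)}) ∧
      ∀ p, conjLine (L p) = Submodule.span ℂ {cx (N p) + (-Complex.I) • cx (t p)} := by
  have hex : ∀ p (s : C3), s ≠ 0 → s ⬝ᵥ s = 0 → L p = Submodule.span ℂ {s} →
      s ⬝ᵥ cx (N p) ≠ 0 ∧ ∃ t : R3, (s ⬝ᵥ cx (N p))⁻¹ • s = cx (N p) + Complex.I • cx t ∧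
      inner ℝ t t = (1 : ℝ) ∧ inner ℝ (N p) t = (0 : ℝ) := by
    intro p s hs hss hLs
    refine exists_normalized_null (hunit p) hs hss ?_ ?_
    · rw [← hLs, hrefl]
    · rw [← hLs, hinf]
  have hspan : ∀ p, ∃ t : R3, L p = Submodule.span ℂ {cx (N p) + Complex.I • cx t} ∧
      inner ℝ t t = (1 : ℝ) ∧ inner ℝ (N p) t = (0 : ℝ) := by
    intro p
    obtain ⟨s, -, hs⟩ := hL.exists_local_section p
    obtain ⟨hs0, hss, hLs⟩ := hs.self_of_nhds
    obtain ⟨h0, t, ht, htt, hnt⟩ := hex p _ hs0 hss hLs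
    refine ⟨t, ?_, htt, hnt⟩
    rw [← ht, hLs, Submodule.span_singleton_smul_eq (IsUnit.mk0 _ (inv_ne_zero h0))]
  choose t htL htt hnt using hspan
  have hdotN : ∀ p, (cx (N p) + Complex.I • cx (t p)) ⬝ᵥ cx (N p) = 1 := by
    intro p
    rw [add_dotProduct, smul_dotProduct, cx_dotProduct, cx_dotProduct, hunit,
      real_inner_comm, hnt]
    simp
  have hsmooth : ContMDiff 𝓘(ℝ, Plane) 𝓘(ℝ, R3) ∞ t := by
    intro p
    obtain ⟨s, hsm, hs⟩ := hL.exists_local_section p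
    obtain ⟨hs0, hss, hLs⟩ := hs.self_of_nhds
    have h0 := (hex p _ hs0 hss hLs).1
    have hd : ContMDiffAt 𝓘(ℝ, Plane) 𝓘(ℝ, ℂ) ∞ (fun q => s q ⬝ᵥ cx (N q)) p :=
      contMDiffAt_bilin dotB hsm (contMDiffAt_cx (hN p))
    have hinv : ContMDiffAt 𝓘(ℝ, Plane) 𝓘(ℝ, ℂ) ∞ (fun q => 1 / (s q ⬝ᵥ cx (N q))) p :=
      contMDiffAt_div contMDiffAt_const hd h0
    have hall := contMDiffAt_clm imL (contMDiffAt_bilin smulB hinv hsm)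
    refine hall.congr_of_eventuallyEq ?_
    filter_upwards [hs] with q hq
    obtain ⟨h0q, t', ht', -, -⟩ := hex q _ hq.1 hq.2.1 hq.2.2
    have hmem : cx (N q) + Complex.I • cx (t q) ∈ L q := by
      rw [htL q]; exact Submodule.mem_span_singleton_self _
    rw [hq.2.2] at hmem
    obtain ⟨k, hk⟩ := Submodule.mem_span_singleton.1 hmem
    have h1 := hdotN q
    rw [← hk, smul_dotProduct, smul_eq_mul] at h1
    -- The condition of having product `1` with `N` singles out one vector of the line, so the
    -- pointwise choice of `t` agrees with the smooth local formula.
    have hk' : k = 1 / (s q ⬝ᵥ cx (N q)) := by field_simp; exact h1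
    rw [ContinuousLinearMap.lsmul_apply, ← hk', hk, imL_cx_add]
  have hfr : ∀ p, IsOrthoFrame (N p) (t p) (cross (N p) (t p)) :=
    fun p => ⟨hunit p, htt p, hnt p, rfl⟩
  refine ⟨t, fun p => cross (N p) (t p),
    ⟨hN, hsmooth, fun p => contMDiffAt_bilin crossR (hN p) (hsmooth p), hfr⟩, htL, fun p => ?_⟩
  rw [htL p, conjLine_span, star_cx_add_smul]
  simp

end NullFrame

/-! ### The rotation angle and the scalar spectral identity. -/

section Dressing

/-- The cosine of the angle between a surface and its Bäcklund transform. -/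
noncomputable def bCos (a : ℝ) : ℝ := (1 - a ^ 2) / (1 + a ^ 2)

/-- The sine of the angle between a surface and its Bäcklund transform. -/
noncomputable def bSin (a : ℝ) : ℝ := 2 * a / (1 + a ^ 2)

theorem one_add_sq_ne_zero (a : ℝ) : 1 + a ^ 2 ≠ 0 := by positivity

theorem bCos_sq_add_bSin_sq (a : ℝ) : bCos a ^ 2 + bSin a ^ 2 = 1 := by
  have := one_add_sq_ne_zero a
  unfold bCos bSin
  field_simp
  ring

theorem bCos_eq {a : ℝ} (ha : 0 < a) : bCos a = (a⁻¹ - a) / (a⁻¹ + a) := by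
  have := one_add_sq_ne_zero a
  unfold bCos
  field_simp

theorem bSin_eq {a : ℝ} (ha : 0 < a) : bSin a = 2 / (a + a⁻¹) := by
  have := one_add_sq_ne_zero a
  have h2 : a ^ 2 + 1 ≠ 0 := by positivity
  unfold bSin
  field_simp
  ring

theorem one_add_I_mul_ne_zero (a : ℝ) : 1 + Complex.I * a ≠ 0 := fun h => by
  have := congrArg Complex.re h
  simp at this

theorem one_sub_I_mul_ne_zero (a : ℝ) : 1 - Complex.I * a ≠ 0 := fun h => by
  have := congrArg Complex.re h
  simp at this

theorem one_add_sq_ne_zero_complex (a : ℝ) : (1 : ℂ) + a ^ 2 ≠ 0 := by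
  exact_mod_cast one_add_sq_ne_zero a

theorem cayley_eq (a : ℝ) :
    (1 + Complex.I * a) / (1 - Complex.I * a) = bCos a + Complex.I * bSin a := by
  rw [div_eq_iff (one_sub_I_mul_ne_zero a), bCos, bSin]
  push_cast
  have := one_add_sq_ne_zero_complex a
  field_simp
  linear_combination (2 * (a : ℂ) ^ 2) * Complex.I_sq

theorem cayley_inv_eq (a : ℝ) :
    ((1 + Complex.I * a) / (1 - Complex.I * a))⁻¹ = bCos a - Complex.I * bSin a := by
  rw [cayley_eq]
  apply inv_eq_of_mul_eq_one_right
  have h : (bCos a : ℂ) ^ 2 + (bSin a : ℂ) ^ 2 = 1 := by exact_mod_cast bCos_sq_add_bSin_sq a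
  linear_combination h - (bSin a : ℂ) ^ 2 * Complex.I_sq

variable {n t w : R3} {l l' : Submodule ℂ C3}

/-- The action of `Γ` on the frame adapted to a pair of conjugate null lines. -/
theorem gamma_rotate (h : IsOrthoFrame n t w)
    (hl : l = Submodule.span ℂ {cx n + Complex.I • cx t})
    (hl' : l' = Submodule.span ℂ {cx n + (-Complex.I) • cx t}) (a : ℝ) :
    gamma l l' ((1 + Complex.I * a) / (1 - Complex.I * a)) (cx n) =
      cx (bCos a • n + (-bSin a) • t) := by
  have hI : Complex.I ^ 2 = -1 := Complex.I_sq
  have hI' : (-Complex.I) ^ 2 = -1 := by rw [neg_sq, hI]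
  have hn : cx n = (1 / 2 : ℂ) • (cx n + Complex.I • cx t)
      + (1 / 2 : ℂ) • (cx n + (-Complex.I) • cx t) := by module
  conv_lhs => rw [hn]
  rw [hl, hl', map_add, map_smul, map_smul,
    gamma_apply_left (h.null_dot_self hI) (h.null_dot_self hI') (h.null_linearIndependent hI),
    gamma_apply_right (h.null_dot_self hI) (h.null_dot_self hI') (h.null_linearIndependent hI),
    cayley_inv_eq, cayley_eq, cx_add, cx_smul, cx_smul]
  push_cast
  linear_combination (norm := module) ((bSin a : ℂ) * hI) • cx t

/-- Here `b` and `d` stand for `w·dN` and `w·*dN`. By linearity it suffices to look at the two parts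
of the star: for `d = b` both sides are `b (z² + a²)`, and for `d = -b` both are `b i (a/z + z/a)`.
-/
theorem spectral_identity {i a ai z zi b d : ℂ} (hi : i ^ 2 = -1) (ha : a * ai = 1)
    (hz : z * zi = 1) :
    ((z + zi) / 2 * d + (z - zi) / 2 * b + i * (((a + ai) * b + (a - ai) * d) / 2)) * (z - i * a)
      = ((z + zi) / 2 * b + (z - zi) / 2 * d + i * (-((a - ai) * b + (a + ai) * d) / 2))
        * (z + i * a) := by
  linear_combination (d - b) * hz + (d - b) * i ^ 2 * ha + (d - b) * hi

end Dressing

/-! ### The Bäcklund equation of a frame. -/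

section Transform

variable {M : Type*} [TopologicalSpace M] [ChartedSpace Plane M]
variable {N t w : M → R3} {L : M → Submodule ℂ C3} {c : LorentzConformalStructure M} {a : ℝ}

/-- The Bäcklund equation for a frame: the condition that the null line bundle spanned by `N + i t`
is parallel for the connection with parameter `ia`. -/
def IsBacklundFrame (c : LorentzConformalStructure M) (a : ℝ) (N t w : M → R3) : Prop :=
  ∀ (p : M) (X : TangentSpace 𝓘(ℝ, Plane) p), coef w t p X =
    -((a - a⁻¹) * coef w N p X + (a + a⁻¹) * coef w N p (c.hodge p X)) / 2

/-- At `z = ia` both `(z + z⁻¹)/2 = i(a - a⁻¹)/2` and `(z - z⁻¹)/2 = i(a + a⁻¹)/2` are imaginary.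
The vanishing of the `w`-component of the derivative of `N + it` is then `i` times a real equation.
-/
theorem IsSmoothFrame.isBacklundFrame (h : IsSmoothFrame N t w) (ha : 0 < a)
    (hL : ∀ p, L p = Submodule.span ℂ {cx (N p) + Complex.I • cx (t p)})
    (hpar : IsParallel (covD (assocForm c N (Complex.I * a))) L) : IsBacklundFrame c a N t w := by
  intro p X
  have hs : ContMDiffAt 𝓘(ℝ, Plane) 𝓘(ℝ, C3) ∞
      (fun q => cx (N q) + Complex.I • cx (t q)) p :=
    (contMDiffAt_cx (h.smooth_n p)).add
      (contMDiffAt_bilin smulB contMDiffAt_const (contMDiffAt_cx (h.smooth_t p)))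
  have h1 := hpar _ p hs (Filter.Eventually.of_forall fun q => by
    rw [hL q]; exact Submodule.mem_span_singleton_self _) X
  rw [hL p, h.covD_add_I] at h1
  obtain ⟨k, hk⟩ := Submodule.mem_span_singleton.1 h1
  have h2 := congrArg (fun v => cx (w p) ⬝ᵥ v) hk
  simp only [dotProduct_smul, dotProduct_add (cx (w p)) (_ • _) (_ • _),
    (h.ortho p).w_dot_null, cx_dotProduct, (h.ortho p).w_w, smul_zero, zero_add] at h2
  rw [Complex.ofReal_one, smul_eq_mul, mul_one, coefZ] at h2
  have ha' : (a : ℂ) ≠ 0 := by exact_mod_cast ha.ne'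
  have hinv : (Complex.I * a)⁻¹ = -(Complex.I * (a : ℂ)⁻¹) := by
    rw [mul_inv, Complex.inv_I, neg_mul]
  rw [hinv] at h2
  apply Complex.ofReal_injective
  push_cast
  have hI := Complex.I_sq
  linear_combination (Complex.I) * h2
    + (((a : ℂ) - (a : ℂ)⁻¹) / 2 * coef w N p X + ((a : ℂ) + (a : ℂ)⁻¹) / 2
      * coef w N p (c.hodge p X) + coef w t p X) * hI

namespace IsBacklundFrame

/-- The angle is chosen for this: `S (a + a⁻¹)/2 = 1` and `S (a - a⁻¹)/2 = -C`, so `w·dN` cancels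
and `w·*dN` remains. -/
theorem coef_normal (hb : IsBacklundFrame c a N t w) (h : IsSmoothFrame N t w) (ha : 0 < a)
    (p : M) (X : TangentSpace 𝓘(ℝ, Plane) p) :
    coef w (fun p => bCos a • N p + (-bSin a) • t p) p X = coef w N p (c.hodge p X) := by
  rw [h.coef_rotate_w_n, hb, bCos, bSin]
  have := one_add_sq_ne_zero a
  field_simp
  ring

theorem coef_tangent (hb : IsBacklundFrame c a N t w) (h : IsSmoothFrame N t w) (ha : 0 < a)
    (p : M) (X : TangentSpace 𝓘(ℝ, Plane) p) :
    coef w (fun p => bCos a • t p + bSin a • N p) p X =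
      ((a + a⁻¹) * coef w N p X + (a - a⁻¹) * coef w N p (c.hodge p X)) / 2 := by
  rw [h.coef_rotate_w_t, hb, bCos, bSin]
  have := one_add_sq_ne_zero a
  field_simp
  ring

end IsBacklundFrame

end Transform

/-! ### The transformed connections as gauge transforms. -/

section Transform

variable {M : Type*} [TopologicalSpace M] [ChartedSpace Plane M]
variable {N t w : M → R3} {L : M → Submodule ℂ C3} {c : LorentzConformalStructure M} {a : ℝ}

/-- The spectral parameter of the dressing transformation. -/
noncomputable def dressParam (a : ℝ) (z : ℂ) : ℂ :=
  (1 + Complex.I * a) / (1 - Complex.I * a) * ((z - Complex.I * a) / (z + Complex.I * a))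

theorem dressing_eq (L : M → Submodule ℂ C3) (a : ℝ) (z : ℂ) (p : M) :
    dressing L a z p = gamma (L p) (conjLine (L p)) (dressParam a z) := rfl

theorem dressParam_ne_zero {a : ℝ} {z : ℂ} (hz : z ≠ Complex.I * a)
    (hz' : z ≠ -(Complex.I * a)) : dressParam a z ≠ 0 :=
  mul_ne_zero (div_ne_zero (one_add_I_mul_ne_zero a) (one_sub_I_mul_ne_zero a))
    (div_ne_zero (sub_ne_zero.2 hz) (fun h => hz' (eq_neg_of_add_eq_zero_left h)))

namespace IsBacklundFrame

/-- It compares the `w`-components of the derivatives of the null fields in the two frames. The root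
`i` is left free because both `Complex.I` and its negative are needed, one for each null line. -/
theorem spectral_plus (hb : IsBacklundFrame c a N t w) (h : IsSmoothFrame N t w) (ha : 0 < a)
    {z : ℂ} (hz : z ≠ 0) (p : M) (X : TangentSpace 𝓘(ℝ, Plane) p) {i : ℂ} (hi : i ^ 2 = -1) :
    (coefZ c z w (fun p => bCos a • N p + (-bSin a) • t p) p X
        + i * coef w (fun p => bCos a • t p + bSin a • N p) p X) * (z - i * a) =
      (coefZ c z w N p X + i * coef w t p X) * (z + i * a) := by
  rw [coefZ, coefZ, hb.coef_normal h ha, hb.coef_normal h ha, hb.coef_tangent h ha, hb,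
    c.hodge_hodge]
  have ha' : (a : ℂ) ≠ 0 := by exact_mod_cast ha.ne'
  push_cast
  exact spectral_identity hi (mul_inv_cancel₀ ha') (mul_inv_cancel₀ hz)

/-- The connections of the transform are the gauge transforms of the original connections. -/
theorem covD_eq_gaugeAct (hb : IsBacklundFrame c a N t w) (h : IsSmoothFrame N t w) (ha : 0 < a)
    (hL : ∀ p, L p = Submodule.span ℂ {cx (N p) + Complex.I • cx (t p)})
    (hL' : ∀ p, conjLine (L p) = Submodule.span ℂ {cx (N p) + (-Complex.I) • cx (t p)})
    {z : ℂ} (hz : z ≠ 0) (hz1 : z ≠ Complex.I * a) (hz2 : z ≠ -(Complex.I * a))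
    {s : M → C3} {p : M} (hs : ContMDiffAt 𝓘(ℝ, Plane) 𝓘(ℝ, C3) ∞ s p)
    (X : TangentSpace 𝓘(ℝ, Plane) p) :
    covD (assocForm c (fun p => bCos a • N p + (-bSin a) • t p) z) s p X =
      gaugeAct (dressing L a z) (covD (assocForm c N z)) s p X := by
  have hI : Complex.I ^ 2 = -1 := Complex.I_sq
  have hI' : (-Complex.I) ^ 2 = -1 := by rw [neg_sq, hI]
  have hm0 := dressParam_ne_zero hz1 hz2
  set m := dressParam a z with hm
  set N' : M → R3 := fun p => bCos a • N p + (-bSin a) • t p with hN'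
  set t' : M → R3 := fun p => bCos a • t p + bSin a • N p with ht'
  have h' : IsSmoothFrame N' t' w := h.rotate (bCos_sq_add_bSin_sq a)
  let e : Fin 3 → M → C3 := ![fun q => cx (N q) + Complex.I • cx (t q),
    fun q => cx (N q) + (-Complex.I) • cx (t q), fun q => cx (w q)]
  have hnull : ∀ k : ℂ, ContMDiffAt 𝓘(ℝ, Plane) 𝓘(ℝ, C3) ∞ (fun q => cx (N q) + k • cx (t q)) p :=
    fun k => (contMDiffAt_cx (h.smooth_n p)).add
      (contMDiffAt_bilin smulB contMDiffAt_const (contMDiffAt_cx (h.smooth_t p)))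
  have hw : ContMDiffAt 𝓘(ℝ, Plane) 𝓘(ℝ, C3) ∞ (fun q => cx (w q)) p :=
    contMDiffAt_cx (h.smooth_w p)
  have he : ∀ j, MDifferentiableAt 𝓘(ℝ, Plane) 𝓘(ℝ, C3) (e j) p := by
    intro j
    fin_cases j
    exacts [(hnull _).mdifferentiableAt (by simp), (hnull _).mdifferentiableAt (by simp),
      hw.mdifferentiableAt (by simp)]
  have hdot : ∀ {y : M → C3}, ContMDiffAt 𝓘(ℝ, Plane) 𝓘(ℝ, C3) ∞ y p →
      ContMDiffAt 𝓘(ℝ, Plane) 𝓘(ℝ, ℂ) ∞ (fun q => s q ⬝ᵥ y q) p :=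
    fun hy => contMDiffAt_bilin dotB hs hy
  let f : Fin 3 → M → ℂ := ![fun q => s q ⬝ᵥ (cx (N q) + (-Complex.I) • cx (t q)) / 2,
    fun q => s q ⬝ᵥ (cx (N q) + Complex.I • cx (t q)) / 2, fun q => s q ⬝ᵥ cx (w q)]
  have hf : ∀ j, MDifferentiableAt 𝓘(ℝ, Plane) 𝓘(ℝ, ℂ) (f j) p := by
    intro j
    fin_cases j
    · exact (contMDiffAt_div (hdot (hnull _)) contMDiffAt_const two_ne_zero).mdifferentiableAt
        (by simp)
    · exact (contMDiffAt_div (hdot (hnull _)) contMDiffAt_const two_ne_zero).mdifferentiableAt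
        (by simp)
    · exact (hdot hw).mdifferentiableAt (by simp)
  have hdec : ∀ᶠ q in 𝓝 p, s q = ∑ j, f j q • e j q := by
    refine Filter.Eventually.of_forall fun q => ?_
    rw [Fin.sum_univ_three]
    exact (h.ortho q).null_decomp hI (s q)
  have hleft : ∀ k q, gamma (L q) (conjLine (L q)) k (cx (N q) + Complex.I • cx (t q)) =
      k • (cx (N q) + Complex.I • cx (t q)) := by
    intro k q
    rw [hL' q, hL q]
    exact gamma_apply_left ((h.ortho q).null_dot_self hI) ((h.ortho q).null_dot_self hI')
      ((h.ortho q).null_linearIndependent hI) k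
  have hright : ∀ k q, gamma (L q) (conjLine (L q)) k (cx (N q) + (-Complex.I) • cx (t q)) =
      k⁻¹ • (cx (N q) + (-Complex.I) • cx (t q)) := by
    intro k q
    rw [hL' q, hL q]
    exact gamma_apply_right ((h.ortho q).null_dot_self hI) ((h.ortho q).null_dot_self hI')
      ((h.ortho q).null_linearIndependent hI) k
  have hmid : ∀ k q, gamma (L q) (conjLine (L q)) k (cx (w q)) = cx (w q) := by
    intro k q
    rw [hL' q, hL q]
    exact gamma_apply_of_orthogonal ((h.ortho q).null_dot_self hI) ((h.ortho q).null_dot_self hI')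
      ((h.ortho q).null_linearIndependent hI) k ((h.ortho q).w_dot_null _)
      ((h.ortho q).w_dot_null _)
  have hinv : ∀ q, (dressing L a z q).inverse = gamma (L q) (conjLine (L q)) m⁻¹ := by
    intro q
    rw [dressing_eq, hL' q, hL q]
    exact gamma_inverse ((h.ortho q).null_dot_self hI) ((h.ortho q).null_dot_self hI')
      ((h.ortho q).null_linearIndependent hI) hm0
  let k : Fin 3 → ℂ := ![m, m⁻¹, 1]
  rw [covD_frame _ he hf hdec, gaugeAct_covD_frame (assocForm c N z) (m := k) ?_ he hf hdec ?_ ?_ X]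
  rotate_left
  · intro j
    fin_cases j
    exacts [hm0, inv_ne_zero hm0, one_ne_zero]
  · refine Filter.Eventually.of_forall fun q j => ?_
    rw [hinv q]
    fin_cases j
    · exact hleft _ q
    · exact hright _ q
    · change _ = (1 : ℂ)⁻¹ • _
      rw [inv_one, one_smul]
      exact hmid _ q
  · intro j
    rw [dressing_eq]
    fin_cases j
    · exact hleft _ p
    · exact hright _ p
    · change _ = (1 : ℂ) • _
      rw [one_smul]
      exact hmid _ p
  refine Finset.sum_congr rfl fun j _ => ?_
  congr 2
  rw [dressing_eq, ← hm]
  set q₀ : ℂ := (1 + Complex.I * a) / (1 - Complex.I * a) with hq₀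
  have hq0 : q₀ ≠ 0 := div_ne_zero (one_add_I_mul_ne_zero a) (one_sub_I_mul_ne_zero a)
  have hz1' : z - Complex.I * a ≠ 0 := sub_ne_zero.2 hz1
  have hz2' : z + Complex.I * a ≠ 0 := fun h => hz2 (eq_neg_of_add_eq_zero_left h)
  have hmq : m = q₀ * ((z - Complex.I * a) / (z + Complex.I * a)) := rfl
  have hq : q₀ = bCos a + Complex.I * bSin a := cayley_eq a
  have hqi : q₀⁻¹ = bCos a - Complex.I * bSin a := cayley_inv_eq a
  -- The rotation acts on its null eigenlines by the constants `q₀` and `q₀⁻¹`, so both frames have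
  -- the same null lines and both connections can be evaluated on the same fields.
  have hu' : ∀ q, cx (N' q) + Complex.I • cx (t' q) = q₀ • (cx (N q) + Complex.I • cx (t q)) := by
    intro q
    simp only [hN', ht', cx_add, cx_smul, hq]
    push_cast
    linear_combination (norm := module) (-(bSin a : ℂ) * hI) • cx (t q)
  have hv' : ∀ q, cx (N' q) + (-Complex.I) • cx (t' q) =
      q₀⁻¹ • (cx (N q) + (-Complex.I) • cx (t q)) := by
    intro q
    simp only [hN', ht', cx_add, cx_smul, hqi]
    push_cast
    linear_combination (norm := module) (-(bSin a : ℂ) * hI) • cx (t q)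
  have hα : coefZ c z t' N' p X = coefZ c z t N p X := by
    simp only [coefZ, hN', ht', h.coef_rotate_t_n (bCos_sq_add_bSin_sq a)]
  have hplus := hb.spectral_plus h ha hz p X hI
  have hminus := hb.spectral_plus h ha hz p X hI'
  rw [← hN', ← ht'] at hplus hminus
  set A := coefZ c z t N p X
  set β := coefZ c z w N p X
  set β' := coefZ c z w N' p X
  set γ := (coef w t p X : ℂ)
  set γ' := (coef w t' p X : ℂ)
  -- As `m = q₀ (z - ia)/(z + ia)`, this and `e2` are the spectral identity for the roots `i` and
  -- `-i`.
  have e1 : q₀⁻¹ * (β' + Complex.I * γ') = m⁻¹ * (β + Complex.I * γ) := by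
    rw [hmq]
    field_simp
    linear_combination hplus
  have e2 : q₀ * (β' - Complex.I * γ') = m * (β - Complex.I * γ) := by
    rw [hmq]
    field_simp
    linear_combination hminus
  have hc : q₀⁻¹ * q₀ = 1 := inv_mul_cancel₀ hq0
  have hcm : m⁻¹ * m = 1 := inv_mul_cancel₀ hm0
  have hnm : ∀ k : ℂ, MDifferentiableAt 𝓘(ℝ, Plane) 𝓘(ℝ, C3)
      (fun q => cx (N' q) + k • cx (t' q)) p := fun k =>
    (mdifferentiableAt_cx (h'.mdiff_n p)).add (mdifferentiableAt_smul (c := fun _ => k)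
      mdifferentiableAt_const (mdifferentiableAt_cx (h'.mdiff_t p)))
  -- In the null basis the derivative of `w` has the combinations occurring in `e1` and `e2` as
  -- coefficients, so the third field needs no new identity.
  have hsplit : ∀ (b g : ℂ) (x y : C3), -b • x - g • y = (-(b - Complex.I * g) / 2) •
      (x + Complex.I • y) + (-(b + Complex.I * g) / 2) • (x + (-Complex.I) • y) := by
    intro b g x y
    linear_combination (norm := module) (-g * hI) • y
  fin_cases j
  · change covD (assocForm c N' z) (fun q => cx (N q) + Complex.I • cx (t q)) p X =
      m⁻¹ • gamma _ _ m (covD (assocForm c N z) (fun q => cx (N q) + Complex.I • cx (t q)) p X)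
    have h1 : (fun q => cx (N q) + Complex.I • cx (t q)) =
        fun q => q₀⁻¹ • (cx (N' q) + Complex.I • cx (t' q)) := by
      funext q
      rw [hu', smul_smul, inv_mul_cancel₀ hq0, one_smul]
    rw [h.covD_add_I, map_add, map_smul, map_smul, hleft, hmid, h1,
      covD_const_smul (s := fun q => cx (N' q) + Complex.I • cx (t' q)) _ (hnm _),
      h'.covD_add_I, hα, hu']
    linear_combination (norm := module) e1 • cx (w p)
      + ((-Complex.I * A) * (hc - hcm)) • (cx (N p) + Complex.I • cx (t p))
  · change covD (assocForm c N' z) (fun q => cx (N q) + (-Complex.I) • cx (t q)) p X =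
      (m⁻¹)⁻¹ • gamma _ _ m (covD (assocForm c N z)
        (fun q => cx (N q) + (-Complex.I) • cx (t q)) p X)
    have h1 : (fun q => cx (N q) + (-Complex.I) • cx (t q)) =
        fun q => q₀ • (cx (N' q) + (-Complex.I) • cx (t' q)) := by
      funext q
      rw [hv', smul_smul, mul_inv_cancel₀ hq0, one_smul]
    rw [h.covD_sub_I, map_add, map_smul, map_smul, hright, hmid, h1,
      covD_const_smul (s := fun q => cx (N' q) + (-Complex.I) • cx (t' q)) _ (hnm _),
      h'.covD_sub_I, hα, hv', inv_inv]
    linear_combination (norm := module) e2 • cx (w p)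
      + ((Complex.I * A) * (hc - hcm)) • (cx (N p) + (-Complex.I) • cx (t p))
  · change covD (assocForm c N' z) (fun q => cx (w q)) p X =
      (1 : ℂ)⁻¹ • gamma _ _ m (covD (assocForm c N z) (fun q => cx (w q)) p X)
    rw [h.covD_w, h'.covD_w, hsplit, hsplit, map_add, map_smul, map_smul, hleft, hright, hu', hv']
    linear_combination (norm := module) ((-1 / 2 : ℂ) * e2) • (cx (N p) + Complex.I • cx (t p))
      + ((-1 / 2 : ℂ) * e1) • (cx (N p) + (-Complex.I) • cx (t p))

end IsBacklundFrame

end Transform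

theorem norm_eq_one_of_inner_self {v : R3} (h : inner ℝ v v = (1 : ℝ)) : ‖v‖ = 1 :=
  (sq_eq_sq₀ (norm_nonneg _) zero_le_one).1
    (((real_inner_self_eq_norm_sq v).symm.trans h).trans (one_pow 2).symm)

/-! ### The derivative at `1`, potentials and harmonicity of the transform. -/

section Backlund

variable {M : Type*} [TopologicalSpace M] [ChartedSpace Plane M]
variable {N t w : M → R3} {L : M → Submodule ℂ C3} {c : LorentzConformalStructure M} {a : ℝ}

theorem analyticAt_assocForm (c : LorentzConformalStructure M) (N : M → R3) (p : M)
    (X : TangentSpace 𝓘(ℝ, Plane) p) {α : ℂ} (hα : α ≠ 0) :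
    AnalyticAt ℂ (fun z => assocForm c N z p X) α := by
  simp only [assocForm_apply]
  have hinv : AnalyticAt ℂ (fun z : ℂ => z⁻¹) α := analyticAt_inv hα
  refine AnalyticAt.add (AnalyticAt.fun_smul ?_ analyticAt_const)
    (AnalyticAt.fun_smul ?_ analyticAt_const)
  · exact ((analyticAt_id.add hinv).div analyticAt_const two_ne_zero).sub analyticAt_const
  · exact (analyticAt_id.sub hinv).div analyticAt_const two_ne_zero

theorem hasDerivAt_dressParam (a : ℝ) :
    HasDerivAt (dressParam a) (Complex.I * bSin a) 1 := by
  have h1 := one_add_I_mul_ne_zero a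
  have h2 := one_sub_I_mul_ne_zero a
  have h := ((((hasDerivAt_id (1 : ℂ)).sub_const (Complex.I * a)).div
    ((hasDerivAt_id (1 : ℂ)).add_const (Complex.I * a)) h1).const_mul
      ((1 + Complex.I * a) / (1 - Complex.I * a)))
  refine h.congr_deriv ?_
  have h3 := one_add_sq_ne_zero_complex a
  simp only [bSin, id]
  push_cast
  field_simp
  linear_combination (2 * Complex.I * (a : ℂ) ^ 3) * Complex.I_sq

theorem dressParam_one (a : ℝ) : dressParam a 1 = 1 := by
  have h1 := one_add_I_mul_ne_zero a
  have h2 := one_sub_I_mul_ne_zero a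
  rw [dressParam]
  field_simp

/-- At `z = 1` the parameter is `1` with derivative `iS`, so `Γ` has derivative `iS` times the
difference of the projections to `L` and `L*`. Since `w × (N ± it) = ∓i (N ± it)` and `w × w = 0`,
this is the cross product with `-S w`. -/
theorem hasDerivAt_dressing (h : IsSmoothFrame N t w)
    (hL : ∀ p, L p = Submodule.span ℂ {cx (N p) + Complex.I • cx (t p)})
    (hL' : ∀ p, conjLine (L p) = Submodule.span ℂ {cx (N p) + (-Complex.I) • cx (t p)}) (p : M) :
    HasDerivAt (fun z => dressing L a z p) (crossEnd (cx (-bSin a • w p))) 1 := by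
  have hI : Complex.I ^ 2 = -1 := Complex.I_sq
  have hI' : (-Complex.I) ^ 2 = -1 := by rw [neg_sq, hI]
  have ho := h.ortho p
  simp only [dressing_eq]
  rw [hL' p, hL p]
  simp only [gamma_eq (ho.null_dot_self hI) (ho.null_dot_self hI') (ho.null_linearIndependent hI)]
  have hψ := hasDerivAt_dressParam a
  have hψi := hψ.inv (by rw [dressParam_one]; exact one_ne_zero)
  set u := cx (N p) + Complex.I • cx (t p) with hu
  set v := cx (N p) + (-Complex.I) • cx (t p) with hv
  refine (((hψ.smul_const (lineProj u v)).const_add (perpProj u v)).add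
    (hψi.smul_const (lineProj v u))).congr_deriv ?_
  rw [dressParam_one]
  have huv : u ⬝ᵥ v = 2 := ho.null_dot_conj hI
  have hvu : v ⬝ᵥ u = 2 := by rw [dotProduct_comm, huv]
  have hcn : crossProduct (cx (w p)) (cx (N p)) = cx (t p) := by
    rw [cx_crossProduct, ho.cross_w_n]
  have hct : crossProduct (cx (w p)) (cx (t p)) = -cx (N p) := by
    rw [cx_crossProduct, cross_swap, ho.cross_t_w, cx_neg]
  ext1 x
  have hx := ho.null_decomp hI x
  change (Complex.I * bSin a) • lineProj u v x
    + (-(Complex.I * bSin a) / 1 ^ 2) • lineProj v u x = crossProduct (cx (-bSin a • w p)) x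
  rw [lineProj_apply, lineProj_apply, huv, hvu]
  conv_rhs => rw [hx]
  rw [← hu, ← hv, cx_smul, map_smul, LinearMap.smul_apply]
  simp only [map_add, map_smul, cross_self]
  rw [hu, hv]
  simp only [map_add, map_smul, hcn, hct]
  rw [← hu, ← hv]
  generalize x ⬝ᵥ v = k
  generalize x ⬝ᵥ u = l
  rw [hu, hv]
  push_cast
  linear_combination (norm := module) ((bSin a : ℂ) * (k + l) / 2 * hI) • cx (t p)

/-- The form `N × *dN` changes by an exact form. -/
theorem IsBacklundFrame.cross_dmap_hodge (hb : IsBacklundFrame c a N t w)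
    (h : IsSmoothFrame N t w) (ha : 0 < a) (p : M) (X : TangentSpace 𝓘(ℝ, Plane) p) :
    cross (bCos a • N p + (-bSin a) • t p)
        (dmap (fun p => bCos a • N p + (-bSin a) • t p) p (c.hodge p X)) =
      cross (N p) (dmap N p (c.hodge p X)) + bSin a • dmap w p X := by
  have h' := h.rotate (bCos_sq_add_bSin_sq a)
  have h1 := h'.cross_dmap_n p (c.hodge p X)
  have h2 := hb.coef_normal h ha p X
  -- Now `h2` reads `C w·dN - S w·dt = w·*dN`, exactly the relation matching the `t`-components of
  -- the two sides.
  rw [h.coef_rotate_w_n] at h2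
  rw [hb.coef_normal h ha, c.hodge_hodge, h.coef_rotate_t_n (bCos_sq_add_bSin_sq a)] at h1
  rw [h1, h.cross_dmap_n, h.dmap_w, ← h2]
  module

/-- If `f` is a potential of `N × *dN`, then `f + sin • w` is one for the transform of `N`. -/
theorem IsBacklundFrame.isPotentialAt_transform (hb : IsBacklundFrame c a N t w) (h : IsSmoothFrame N t w)
    (ha : 0 < a) {f : M → R3} {p : M} (hfs : MDifferentiableAt 𝓘(ℝ, Plane) 𝓘(ℝ, R3) f p)
    (hf : IsPotentialAt c N f p) :
    IsPotentialAt c (fun p => bCos a • N p + (-bSin a) • t p) (fun p => f p + bSin a • w p) p := by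
  intro X
  have h1 : dmap (fun p => f p + bSin a • w p) p =
      dmap f p + dmap (fun p => bSin a • w p) p :=
    dmap_add hfs (mdifferentiableAt_const_smul _ (h.mdiff_w p))
  rw [h1]
  change dmap f p X + dmap (fun p => bSin a • w p) p X = _
  rw [dmap_const_smul _ (h.mdiff_w p), hf X]
  exact (hb.cross_dmap_hodge h ha p X).symm

variable [IsManifold 𝓘(ℝ, Plane) ∞ M]

/-- The form `N × *dN` changes by the exact form `S dw`, hence stays closed, and closedness is
harmonicity. -/
theorem IsBacklundFrame.isHarmonic (hb : IsBacklundFrame c a N t w) (h : IsSmoothFrame N t w)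
    (ha : 0 < a) (hN : IsHarmonic c N) :
    IsHarmonic c (fun p => bCos a • N p + (-bSin a) • t p) where
  smooth := (h.rotate (bCos_sq_add_bSin_sq a)).smooth_n
  unit p := by
    have h1 := ((h.rotate (bCos_sq_add_bSin_sq a)).ortho p).n_n
    exact norm_eq_one_of_inner_self h1
  tension p X Y := by
    have h' := h.rotate (bCos_sq_add_bSin_sq a)
    rw [← extD_cross_hodgeStar c h'.smooth_n]
    have heq : bilinForm crossR (fun p => bCos a • N p + (-bSin a) • t p)
        (hodgeStar c (dmap fun p => bCos a • N p + (-bSin a) • t p)) =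
        fun q => bilinForm crossR N (hodgeStar c (dmap N)) q
          + (bSin a • ContinuousLinearMap.id ℝ R3).comp (dmap w q) := by
      funext q
      ext1 Z
      exact hb.cross_dmap_hodge h ha q Z
    have hd := formDiffAt_bilinForm crossR (h.mdiff_n p)
      (formDiffAt_hodgeStar c (formDiffAt_dmap h.smooth_n p))
    have hdw := formDiffAt_dmap h.smooth_w p
    rw [heq, extD_add hd (hdw.clm _), extD_clm hdw, extD_dmap h.smooth_w, map_zero, add_zero,
      extD_cross_hodgeStar c h.smooth_n, hN.tension]

end Backlund

/-! ### The lemma and the theorem. -/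

theorem mainTheorem4 {M : Type*} [TopologicalSpace M] [ChartedSpace Plane M]
    [IsManifold 𝓘(ℝ, Plane) ∞ M] :
    -- gauging an arbitrary holomorphic family of metric connections by `Γ^L_{L'}`
    (∀ (L L' : M → Submodule ℂ C3), IsNullLineSubbundle L → IsNullLineSubbundle L' →
      (∀ p, L p ⊓ L' p = ⊥) →
      ∀ (A : ℂ → ConnForm M), (∀ z, IsMetricConn (A z)) →
      ∀ (k₁ k₂ k₃ k₄ : ℂ), k₁ * k₄ - k₂ * k₃ ≠ 0 →
      (∀ α : ℂ, k₁ * α + k₂ = 0 →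
        (∀ p (X : TangentSpace 𝓘(ℝ, Plane) p), AnalyticAt ℂ (fun z => A z p X) α) →
        (HolomorphicAcross
            (fun z => gaugeAct (fun p => gamma (L p) (L' p) ((k₁ * z + k₂) / (k₃ * z + k₄)))
              (covD (A z))) α ↔
          IsParallel (covD (A α)) L)) ∧
      (∀ β : ℂ, k₃ * β + k₄ = 0 →
        (∀ p (X : TangentSpace 𝓘(ℝ, Plane) p), AnalyticAt ℂ (fun z => A z p X) β) →
        (HolomorphicAcross
            (fun z => gaugeAct (fun p => gamma (L p) (L' p) ((k₁ * z + k₂) / (k₃ * z + k₄)))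
              (covD (A z))) β ↔
          IsParallel (covD (A β)) L'))) ∧
    -- the transform of a harmonic map
    (∀ (c : LorentzConformalStructure M) (N : M → R3), IsHarmonic c N →
      ∀ (a : ℝ), 0 < a →
      ∀ (L : M → Submodule ℂ C3), IsNullLineSubbundle L →
      IsParallel (covD (assocForm c N (Complex.I * a))) L →
      (∀ p, (L p).map (reflC (N p)) = conjLine (L p)) →
      (∀ p, L p ⊓ conjLine (L p) = ⊥) →
      ∃ N' : M → R3,
        (∀ p, cx (N' p) = dressingInfty L a p (cx (N p))) ∧
        IsHarmonic c N' ∧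
        (∀ z : ℂ, z ≠ 0 → IsFlat (assocForm c N' z)) ∧
        (∀ z : ℂ, z ≠ 0 → z ≠ Complex.I * a → z ≠ -(Complex.I * a) →
          ∀ (s : M → C3) (p : M), ContMDiffAt 𝓘(ℝ, Plane) 𝓘(ℝ, C3) ∞ s p →
          ∀ X : TangentSpace 𝓘(ℝ, Plane) p,
            covD (assocForm c N' z) s p X =
              gaugeAct (dressing L a z) (covD (assocForm c N z)) s p X) ∧
        HolomorphicAcross (fun z => gaugeAct (dressing L a z) (covD (assocForm c N z)))
          (Complex.I * a) ∧
        HolomorphicAcross (fun z => gaugeAct (dressing L a z) (covD (assocForm c N z)))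
          (-(Complex.I * a)) ∧
        -- the surfaces, on any open set on which `N × *dN` has a primitive `f`
        (∀ (W : Set M), IsOpen W →
          ∀ (f : M → R3), ContMDiffOn 𝓘(ℝ, Plane) 𝓘(ℝ, R3) ∞ f W →
          (∀ p ∈ W, IsPotentialAt c N f p) →
          ∃ f' : M → R3,
            ContMDiffOn 𝓘(ℝ, Plane) 𝓘(ℝ, R3) ∞ f' W ∧
            ∀ p ∈ W,
              -- `f' = f - ∂r/∂z|₁`, skew endomorphisms being identified with vectors
              HasDerivAt (fun z => dressing L a z p) (crossEnd (cx (f p - f' p))) 1 ∧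
              IsPotentialAt c N' f' p ∧
              IsBacklundAt a f N f' N' p ∧
              (∀ u ∈ L p ⊔ conjLine (L p), cx (f' p - f p) ⬝ᵥ u = 0) ∧
              (ImmersesAt f p → HasGaussMapAndCurvatureAt f N p (-1) ∧
                SecondFormSpansAt c f N p) ∧
              (ImmersesAt f' p → HasGaussMapAndCurvatureAt f' N' p (-1) ∧
                SecondFormSpansAt c f' N' p) ∧
              (ImmersesAt f p → ImmersesAt f' p → ∀ X : TangentSpace 𝓘(ℝ, Plane) p,
                (secondForm f' N' p X X = 0 ↔ secondForm f N p X X = 0)))) := by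
  refine ⟨?_, ?_⟩
  · intro L L' hL hL' hLL' A hA k₁ k₂ k₃ k₄ hdet
    exact ⟨fun α hα han => holomorphicAcross_iff_isParallel hL hL' hLL' hA hdet hα han,
      fun β hβ han => holomorphicAcross_iff_isParallel_pole hL hL' hLL' hA hdet hβ han⟩
  · intro c N hN a ha L hL hpar hrefl hinf
    obtain ⟨t, w, h, hLs, hLs'⟩ := exists_smoothFrame hN.smooth hN.inner_self hL hrefl hinf
    have hb : IsBacklundFrame c a N t w := h.isBacklundFrame ha hLs hpar
    have h' := h.rotate (bCos_sq_add_bSin_sq a)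
    have hN' := hb.isHarmonic h ha hN
    have hgauge := fun {z : ℂ} (hz : z ≠ 0) (hz1 : z ≠ Complex.I * a)
      (hz2 : z ≠ -(Complex.I * a)) {s : M → C3} {p : M}
      (hs : ContMDiffAt 𝓘(ℝ, Plane) 𝓘(ℝ, C3) ∞ s p) (X : TangentSpace 𝓘(ℝ, Plane) p) =>
      hb.covD_eq_gaugeAct h ha hLs hLs' hz hz1 hz2 hs X
    have hIa : Complex.I * (a : ℂ) ≠ 0 :=
      mul_ne_zero Complex.I_ne_zero (by exact_mod_cast ha.ne')
    refine ⟨fun p => bCos a • N p + (-bSin a) • t p,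
      fun p => (gamma_rotate (h.ortho p) (hLs p) (hLs' p) a).symm, hN',
      fun z hz => hN'.isFlat_assocForm hz, fun z hz hz1 hz2 s p hs X => hgauge hz hz1 hz2 hs X,
      ?_, ?_, ?_⟩
    · intro s p hs X
      -- The extension across the singular parameter is the family of connections of the transform,
      -- analytic at every non-zero parameter.
      refine ⟨_, analyticAt_covD (analyticAt_assocForm c
        (fun p => bCos a • N p + (-bSin a) • t p) p X hIa) s, ?_⟩
      have h1 : ∀ᶠ z in 𝓝 (Complex.I * (a : ℂ)), z ≠ 0 ∧ z ≠ -(Complex.I * a) :=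
        (eventually_ne_nhds hIa).and (eventually_ne_nhds (self_ne_neg.2 hIa))
      filter_upwards [self_mem_nhdsWithin, h1.filter_mono nhdsWithin_le_nhds] with z hz hz'
      exact (hgauge hz'.1 hz hz'.2 hs X).symm
    · intro s p hs X
      refine ⟨_, analyticAt_covD (analyticAt_assocForm c
        (fun p => bCos a • N p + (-bSin a) • t p) p X (neg_ne_zero.2 hIa)) s, ?_⟩
      have h1 : ∀ᶠ z in 𝓝 (-(Complex.I * (a : ℂ))), z ≠ 0 ∧ z ≠ Complex.I * a :=
        (eventually_ne_nhds (neg_ne_zero.2 hIa)).and (eventually_ne_nhds (neg_ne_self.2 hIa))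
      filter_upwards [self_mem_nhdsWithin, h1.filter_mono nhdsWithin_le_nhds] with z hz hz'
      exact (hgauge hz'.1 hz'.2 hz hs X).symm
    · intro W hW f hf hpot
      -- The derivative of the dressing gauge at `1` is `-S w`, so subtracting it from `f` adds `S
      -- w`.
      refine ⟨fun p => f p + bSin a • w p, hf.add fun p _ =>
        (contMDiffAt_clm (bSin a • ContinuousLinearMap.id ℝ R3)
          (h.smooth_w p)).contMDiffWithinAt, fun p hp => ?_⟩
      have hfp : MDifferentiableAt 𝓘(ℝ, Plane) 𝓘(ℝ, R3) f p :=
        (hf.contMDiffAt (hW.mem_nhds hp)).mdifferentiableAt (by simp)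
      have hpot' := hb.isPotentialAt_transform h ha hfp (hpot p hp)
      have ho := h.ortho p
      have ho' := h'.ortho p
      have hsurf := surface_of_isPotentialAt c ho (hpot p hp) (hN.inner_dmap p)
      have hsurf' := surface_of_isPotentialAt c ho' hpot' (hN'.inner_dmap p)
      have hdiff : f p + bSin a • w p - f p = bSin a • w p := add_sub_cancel_left _ _
      have hS : 0 < bSin a := by rw [bSin_eq ha]; positivity
      refine ⟨?_, hpot', ⟨?_, ?_, fun him => ?_, fun him => ?_, ?_, ?_⟩, ?_,
        fun him => ⟨(hsurf him).1, (hsurf him).2.1⟩,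
        fun him => ⟨(hsurf' him).1, (hsurf' him).2.1⟩, ?_⟩
      · have h1 : f p - (f p + bSin a • w p) = -bSin a • w p := by module
        rw [h1]
        exact hasDerivAt_dressing h hLs hLs' p
      · rw [hdiff, inner_smul_right, ho.n_w, mul_zero]
      · rw [hdiff, inner_smul_right, ho'.n_w, mul_zero]
      · rw [hdiff]
        exact (hsurf him).2.2 _
      · rw [hdiff]
        exact (hsurf' him).2.2 _
      · rw [dist_eq_norm, hdiff, norm_smul, norm_eq_one_of_inner_self ho.w_w, mul_one,
          Real.norm_of_nonneg hS.le, bSin_eq ha]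
      · rw [inner_add_left, inner_smul_left, inner_smul_left, ho.n_n, real_inner_comm, ho.n_t,
          ← bCos_eq ha]
        simp
      · intro u hu
        rw [hdiff, cx_smul, smul_dotProduct]
        rw [hLs' p, hLs p] at hu
        obtain ⟨x, hx, y, hy, rfl⟩ := Submodule.mem_sup.1 hu
        obtain ⟨k, rfl⟩ := Submodule.mem_span_singleton.1 hx
        obtain ⟨l, rfl⟩ := Submodule.mem_span_singleton.1 hy
        rw [dotProduct_add, dotProduct_smul, dotProduct_smul, ho.w_dot_null, ho.w_dot_null]
        simp
      · intro him him' X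
        -- Both second fundamental forms are non-zero multiples of the same metric, so their null
        -- directions coincide.
        obtain ⟨k, hk, hkm⟩ := (hsurf him).2.1
        obtain ⟨k', hk', hkm'⟩ := (hsurf' him').2.1
        rw [hkm, hkm', mul_eq_zero_iff_left hk, mul_eq_zero_iff_left hk']
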